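/- **Lemma 6.1.** Let $\Omega\subset\mathbb C$ be a bounded domain whose boundary $b\Omega$ consists of finitely many pairwise disjoint simple closed regular real-analytic curves. Let $T(z)$ be the complex unit tangent vector at $z\in b\Omega$ in the direction of the standard orientation ($\Omega$ to the left) and $ds$ arc length on $b\Omega$. Let $H^2(b\Omega)$ be the closure in $L^2(b\Omega,ds)$ of the space $A^\infty(\Omega)$ of functions holomorphic on $\Omega$ and $C^\infty$ on $\overline\Omega$. Let $S(z,a)$ be the Szegő kernel: for $a\in\Omega$, $S(\cdot,a)\in H^2(b\Omega)$ and $h(a)=\int_{b\Omega}h\,\overline{S(\cdot,a)}\,ds$ for all $h\in A^\infty(\Omega)$. Let $L(z,a)$ be the Garabedian kernel: for $a\in\Omega$, $L(\cdot,a)$ is holomorphic on $\Omega\setminus\{a\}$ with a simple pole at $a$ with residue $1/(2\pi)$, extends continuously to $b\Omega$, and satisfies $\frac1i L(z,a)T(z)=S(a,z)$ for $z\in b\Omega$. Here and below, the kernels and their derivatives with respect to the second variable are extended by continuity to boundary values of that variable. Let $\mathcal B$ be the complex linear span of the functions of $z$ $$\frac{\partial^m}{\partial\bar a^m}S(z,a),\qquad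 \frac{\partial^m}{\partial a^m}L(z,a)\qquad(m\ge 0,\ a\in\overline\Omega).$$ Then $\mathcal B$ is equal to the set of meromorphic functions $G$ on $\overline\Omega$ (that is, on a neighborhood of $\overline\Omega$) for which there is a meromorphic function $H$ on $\overline\Omega$ with $$G(z)=\overline{H(z)T(z)}$$ for all $z\in b\Omega$ that are not poles of $G$ or $H$. Functions in $\mathcal B$ are identified with their meromorphic extensions to $\overline\Omega$. -/

import Mathlib

open Set Filter Topology MeasureTheory Complex ComplexConjugate
open scoped ContDiff

noncomputable section

/-- `Ω` is a bounded plane domain whose boundary consists of the `n` pairwise disjoint simple closed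
real analytic curves `γ 0, …, γ (n - 1)`.  Each curve is parametrized over one period `[0, 1)` by a
regular real analytic map, in the standard sense: `i γ'` points into `Ω` (so `Ω` lies to the left
of the curve) and `-i γ'` points out of `Ω`. -/
structure IsAnalyticDomain {n : ℕ} (Ω : Set ℂ) (γ : Fin n → ℝ → ℂ) : Prop where
  isOpen : IsOpen Ω
  isConnected : IsConnected Ω
  isBounded : Bornology.IsBounded Ω
  analytic : ∀ j t, AnalyticAt ℝ (γ j) t
  periodic : ∀ j, Function.Periodic (γ j) 1
  deriv_ne_zero : ∀ j t, deriv (γ j) t ≠ 0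
  simple_disjoint : ∀ j k, ∀ s ∈ Ico (0 : ℝ) 1, ∀ t ∈ Ico (0 : ℝ) 1,
    γ j s = γ k t → j = k ∧ s = t
  frontier_eq : frontier Ω = ⋃ j, range (γ j)
  left_mem : ∀ j t, ∀ᶠ ε : ℝ in 𝓝[>] 0, γ j t + ε * (I * deriv (γ j) t) ∈ Ω
  right_notMem : ∀ j t, ∀ᶠ ε : ℝ in 𝓝[>] 0, γ j t - ε * (I * deriv (γ j) t) ∉ closure Ω

/-- The complex unit tangent vector `T(z)`, characterized by `T(γ_j(t)) = γ_j'(t) / |γ_j'(t)|`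
(see `unitTangent_apply`). -/
def unitTangent {n : ℕ} (γ : Fin n → ℝ → ℂ) (z : ℂ) : ℂ :=
  Classical.epsilon fun τ => ∃ j t, γ j t = z ∧ τ = deriv (γ j) t / ‖deriv (γ j) t‖

theorem unitTangent_apply {n : ℕ} {Ω : Set ℂ} {γ : Fin n → ℝ → ℂ} (hΩ : IsAnalyticDomain Ω γ)
    (j : Fin n) (t : ℝ) :
    unitTangent γ (γ j t) = deriv (γ j) t / ‖deriv (γ j) t‖ := by
  have hper : ∀ k s, deriv (γ k) (Int.fract s) = deriv (γ k) s := by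
    intro k s
    have h1 : (fun x => γ k (x - (⌊s⌋ : ℝ))) = γ k := by
      funext x
      simpa using (hΩ.periodic k).sub_int_mul_eq (x := x) ⌊s⌋
    have h2 := deriv_comp_sub_const (γ k) (⌊s⌋ : ℝ) s
    rw [h1] at h2
    exact h2.symm
  have hval : ∀ k s, γ k (Int.fract s) = γ k s := by
    intro k s
    have h := (hΩ.periodic k).sub_int_mul_eq (x := s) ⌊s⌋
    rwa [mul_one] at h
  obtain ⟨k, s, hks, hτ⟩ := Classical.epsilon_spec
    (p := fun τ : ℂ => ∃ k s, γ k s = γ j t ∧ τ = deriv (γ k) s / ‖deriv (γ k) s‖)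
    ⟨_, j, t, rfl, rfl⟩
  obtain ⟨rfl, hst⟩ := hΩ.simple_disjoint k j (Int.fract s)
    ⟨Int.fract_nonneg s, Int.fract_lt_one s⟩ (Int.fract t)
    ⟨Int.fract_nonneg t, Int.fract_lt_one t⟩ (by rw [hval, hval, hks])
  unfold unitTangent
  rw [hτ, ← hper k s, hst, hper k t]

/-- Arc length measure `ds` on the boundary. -/
def arcLength {n : ℕ} (γ : Fin n → ℝ → ℂ) : Measure ℂ :=
  ∑ j, Measure.map (γ j)
    ((volume.restrict (Ico (0 : ℝ) 1)).withDensity fun t => ‖deriv (γ j) t‖ₑ)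

/-- `A^∞(Ω)`: functions that are holomorphic on `Ω` and `C^∞` smooth on the closure of `Ω`. -/
def AInfty (Ω : Set ℂ) : Submodule ℂ (ℂ → ℂ) where
  carrier := {h | DifferentiableOn ℂ h Ω ∧ ContDiffOn ℝ ∞ h (closure Ω)}
  zero_mem' := ⟨differentiableOn_const 0, contDiffOn_const⟩
  add_mem' := fun hf hg => ⟨hf.1.add hg.1, hf.2.add hg.2⟩
  smul_mem' := fun c _ hf => ⟨hf.1.const_smul c, hf.2.const_smul c⟩

/-- The boundary values of functions in `A^∞(Ω)`, as elements of `L²(bΩ)`. -/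
def AInftyBoundary {n : ℕ} (Ω : Set ℂ) (γ : Fin n → ℝ → ℂ) :
    Submodule ℂ (Lp ℂ 2 (arcLength γ)) where
  carrier := {u | ∃ h ∈ AInfty Ω, u =ᵐ[arcLength γ] h}
  zero_mem' := ⟨0, (AInfty Ω).zero_mem, Lp.coeFn_zero _ _ _⟩
  add_mem' := by
    rintro u v ⟨h, hh, hu⟩ ⟨k, hk, hv⟩
    exact ⟨h + k, (AInfty Ω).add_mem hh hk, (Lp.coeFn_add u v).trans (hu.add hv)⟩
  smul_mem' := by
    rintro c u ⟨h, hh, hu⟩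
    exact ⟨c • h, (AInfty Ω).smul_mem c hh, (Lp.coeFn_smul c u).trans (hu.const_smul c)⟩

/-- The Hardy space `H²(bΩ)`, the closure of `A^∞(Ω)` in `L²(bΩ)`. -/
def hardySpace {n : ℕ} (Ω : Set ℂ) (γ : Fin n → ℝ → ℂ) :
    Submodule ℂ (Lp ℂ 2 (arcLength γ)) :=
  (AInftyBoundary Ω γ).topologicalClosure

/-- The boundary function `S(·, a) ∈ H²(bΩ)` of the Szegő kernel, for `a ∈ Ω`: the unique element
of the Hardy space with the reproducing property `h(a) = ⟨h, S(·, a)⟩ = ∫ h conj(S(·, a)) ds`. -/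
def szegoBoundary {n : ℕ} (Ω : Set ℂ) (γ : Fin n → ℝ → ℂ) (a : ℂ) : Lp ℂ 2 (arcLength γ) :=
  Classical.epsilon fun s => s ∈ hardySpace Ω γ ∧
    ∀ h ∈ AInfty Ω, ∫ w, h w * conj (s w) ∂(arcLength γ) = h a

/-- The Szegő kernel `S(z, a)` for `z, a ∈ Ω`.  The value at `z` of the element `S(·, a)` of the
Hardy space is `⟨S(·, a), S(·, z)⟩`. -/
def szego {n : ℕ} (Ω : Set ℂ) (γ : Fin n → ℝ → ℂ) (z a : ℂ) : ℂ :=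
  ∫ w, szegoBoundary Ω γ a w * conj (szegoBoundary Ω γ z w) ∂(arcLength γ)

/-- `ℓ` is the Garabedian kernel `L(·, a)`, where `a ∈ Ω`: it is holomorphic on `Ω - {a}` with a
simple pole with residue `1 / (2π)` at `a`, extends continuously to the boundary, and satisfies
`(1 / i) L(z, a) T(z) = S(a, z)` for `z ∈ bΩ`, where `S(a, z)` is the boundary value of the Szegő
kernel.  By the maximum principle these properties determine `ℓ` on `closure Ω - {a}`. -/
structure IsGarabedian {n : ℕ} (Ω : Set ℂ) (γ : Fin n → ℝ → ℂ) (a : ℂ) (ℓ : ℂ → ℂ) : Prop where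
  differentiableOn : DifferentiableOn ℂ ℓ (Ω \ {a})
  continuousOn : ContinuousOn ℓ (closure Ω \ {a})
  residue : Tendsto (fun z => (z - a) * ℓ z) (𝓝[≠] a) (𝓝 (1 / (2 * Real.pi)))
  boundary : ∀ z ∈ frontier Ω,
    (1 / I) * ℓ z * unitTangent γ z = extendFrom Ω (fun w => szego Ω γ a w) z

/-- The Garabedian kernel `L(z, a)` for `z, a ∈ Ω`, `z ≠ a`. -/
def garabedian {n : ℕ} (Ω : Set ℂ) (γ : Fin n → ℝ → ℂ) (z a : ℂ) : ℂ :=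
  (Classical.epsilon fun ℓ : ℂ → ℂ => IsGarabedian Ω γ a ℓ) z

/-- `∂^m S(z, a) / ∂ā^m` for `z ∈ Ω` and `a ∈ closure Ω`.  As `S(z, ·)` is antiholomorphic on `Ω`,
its `∂/∂ā` derivatives are the conjugates of the complex derivatives of its conjugate.  They are
extended continuously to the points `a` of the boundary. -/
def szegoDeriv {n : ℕ} (Ω : Set ℂ) (γ : Fin n → ℝ → ℂ) (m : ℕ) (z a : ℂ) : ℂ :=
  extendFrom Ω (fun w => conj (iteratedDeriv m (fun u => conj (szego Ω γ z u)) w)) a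

/-- `∂^m L(z, a) / ∂a^m` for `z ∈ Ω` and `a ∈ closure Ω`, `z ≠ a`, extended continuously to the
points `a` of the boundary. -/
def garabedianDeriv {n : ℕ} (Ω : Set ℂ) (γ : Fin n → ℝ → ℂ) (m : ℕ) (z a : ℂ) : ℂ :=
  extendFrom Ω (fun w => iteratedDeriv m (fun u => garabedian Ω γ z u) w) a

/-- The functions of `z` of the form `∂^m S(z, a) / ∂ā^m` or `∂^m L(z, a) / ∂a^m` with `m ≥ 0` and
`a` in the closure of `Ω`. -/
def classBGenerators {n : ℕ} (Ω : Set ℂ) (γ : Fin n → ℝ → ℂ) : Set (ℂ → ℂ) :=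
  {f | ∃ m : ℕ, ∃ a ∈ closure Ω,
    f = (fun z => szegoDeriv Ω γ m z a) ∨ f = (fun z => garabedianDeriv Ω γ m z a)}

/-- The class `ℬ` of meromorphic functions on `Ω`: the complex linear combinations of the
generators.  Meromorphic functions on `Ω` are represented by functions `ℂ → ℂ`, of which only the
values in `Ω` off a discrete subset of `Ω` (such as the set of poles) are relevant. -/
def classB {n : ℕ} (Ω : Set ℂ) (γ : Fin n → ℝ → ℂ) : Set (ℂ → ℂ) :=
  {g | ∃ b ∈ Submodule.span ℂ (classBGenerators Ω γ), g =ᶠ[codiscreteWithin Ω] b}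

end

/-! Call `(G, H)` a boundary pair if both functions are meromorphic near the closed domain and `G =
conj (H T)` on the boundary off the poles. As `|T| = 1`, the relation is symmetric in `G` and `H`,
and it is stable under linear combinations if the coefficients of `H` are conjugated. It also gives
`G H T = |G|²`, so a pair without poles satisfies `∫ |G|² ds = ∮ G H dw = 0` and vanishes
(`IsBoundaryPair.eq_zero`). A pair is thus determined by the poles of its two members, and the
theorem follows from two facts.

Existence: for each `a` in the closed domain and each `m` there is a pair whose first member is `(w
- a)^(-(m+1))` plus a holomorphic function (`exists_isPolePair`). This rests on the decomposition `u
= h + conj (k T)` of any function holomorphic near the boundary (`IsTube.exists_decomposition`),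
which is derived from the Kerzman–Stein equation. The kernel of that equation is the Cauchy kernel
minus its adjoint. It is bounded and skew-hermitian, so identity minus the operator is coercive and
invertible. It continues analytically in its first variable, and so does the solution.

Reciprocity: the pair with pole of order `m + 1` at `a` consists, up to constants, of the `m`-th
derivatives in the second variable of `L(·, a)` and `S(·, a)`. Products of two pairs are integrated
over contours just outside and just inside the boundary, which the boundary relation exchanges by
reflection; comparing residues gives `IsPolePair.eval_eq`. Pairs with a simple pole at an interior
point are identified with the two kernels by the uniqueness of the reproducing element and the
maximum principle.

Generators of `ℬ` therefore belong to boundary pairs. Conversely, the poles of `G` are removed by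
subtracting multiples of pole functions; then `H` has no boundary poles left, by the relation. Its
interior poles are removed by subtracting pole functions from `H` and their holomorphic partners
from `G`. What remains is a pair without poles, hence zero (`IsBoundaryPair.mem_classB`).

All contours are the curves `Γ j (t + i y)` in tubular coordinates, with positive height `y` inside
`Ω`. Cauchy's formula is obtained by gluing the pieces to an entire function that tends to zero at
infinity. Contours of negative height surround the closed domain, so that poles on the boundary
cause no singular integrals. -/

/-! ### Analytic continuation of periodic real analytic functions to strips. -/

/-- The horizontal strip `|Im ζ| < δ`. -/
def horizStrip (δ : ℝ) : Set ℂ := {ζ | |ζ.im| < δ}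

theorem isOpen_horizStrip (δ : ℝ) : IsOpen (horizStrip δ) :=
  isOpen_lt (continuous_abs.comp continuous_im) continuous_const

theorem convex_horizStrip (δ : ℝ) : Convex ℝ (horizStrip δ) := by
  have h : horizStrip δ = Complex.imLm ⁻¹' (Ioo (-δ) δ) := by
    ext z; simp [horizStrip, abs_lt]
  rw [h]
  exact (convex_Ioo _ _).linear_preimage _

theorem ofReal_mem_horizStrip {δ : ℝ} (hδ : 0 < δ) (t : ℝ) : (t : ℂ) ∈ horizStrip δ := by
  simpa [horizStrip] using hδ

theorem add_int_mem_horizStrip {δ : ℝ} {ζ : ℂ} (m : ℤ) :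
    ζ + m ∈ horizStrip δ ↔ ζ ∈ horizStrip δ := by
  simp [horizStrip]

theorem conj_mem_horizStrip {δ : ℝ} {ζ : ℂ} : conj ζ ∈ horizStrip δ ↔ ζ ∈ horizStrip δ := by
  simp [horizStrip]

theorem horizStrip_mono {δ δ' : ℝ} (h : δ ≤ δ') : horizStrip δ ⊆ horizStrip δ' :=
  fun _ hz => lt_of_lt_of_le hz h

/-- The Taylor series of `f` at `t` has complex coefficients and can be summed at complex arguments
within any radius below its radius of convergence. -/
theorem AnalyticAt.exists_complex_extension {f : ℝ → ℂ} {t : ℝ} (hf : AnalyticAt ℝ f t) :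
    ∃ r > 0, ∃ F : ℂ → ℂ, DifferentiableOn ℂ F (Metric.ball (t : ℂ) r) ∧
      ∀ s : ℝ, (s : ℂ) ∈ Metric.ball (t : ℂ) r → F s = f s := by
  obtain ⟨p, R, hp⟩ := hf
  obtain ⟨r, hr0, hr⟩ := ENNReal.lt_iff_exists_nnreal_btwn.1 hp.r_pos
  have hr0' : 0 < (r : ℝ) := by exact_mod_cast hr0
  have hrad : (r : ENNReal) < p.radius := hr.trans_le hp.r_le
  refine ⟨r, hr0', fun ζ => ∑' k, p.coeff k * (ζ - t) ^ k, ?_, ?_⟩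
  · refine differentiableOn_tsum_of_summable_norm (p.summable_norm_mul_pow hrad) ?_
      Metric.isOpen_ball ?_
    · intro k
      fun_prop
    · intro k ζ hζ
      rw [norm_mul, norm_pow]
      have h1 : ‖ζ - t‖ ≤ r := by
        rw [← dist_eq_norm]; exact (Metric.mem_ball.1 hζ).le
      rw [FormalMultilinearSeries.norm_apply_eq_norm_coef]
      gcongr
  · intro s hs
    have hs' : s - t ∈ Metric.eball (0 : ℝ) R := by
      have h2 : ‖s - t‖ < r := by
        have := Metric.mem_ball.1 hs
        rwa [dist_eq_norm, ← ofReal_sub, Complex.norm_real] at this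
      rw [Metric.mem_eball, edist_zero_right]
      refine lt_trans ?_ hr
      rw [← ofReal_norm, ← ENNReal.ofReal_coe_nnreal]
      exact (ENNReal.ofReal_lt_ofReal_iff hr0').2 h2
    have h := (hp.hasSum hs').tsum_eq
    rw [add_sub_cancel] at h
    rw [← h]
    refine tsum_congr fun k => ?_
    rw [FormalMultilinearSeries.apply_eq_pow_smul_coeff, Complex.real_smul]
    push_cast
    ring

/-- Both discs have real centres, so their intersection is convex and contains `Re ζ` along with
`ζ`. The identity theorem applies, started at real points near `Re ζ`. -/
theorem eq_of_eq_on_reals_ball {F₁ F₂ : ℂ → ℂ} {t₁ t₂ r₁ r₂ : ℝ} {f : ℝ → ℂ}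
    (h₁ : DifferentiableOn ℂ F₁ (Metric.ball (t₁ : ℂ) r₁))
    (h₂ : DifferentiableOn ℂ F₂ (Metric.ball (t₂ : ℂ) r₂))
    (e₁ : ∀ s : ℝ, (s : ℂ) ∈ Metric.ball (t₁ : ℂ) r₁ → F₁ s = f s)
    (e₂ : ∀ s : ℝ, (s : ℂ) ∈ Metric.ball (t₂ : ℂ) r₂ → F₂ s = f s)
    {ζ : ℂ} (z₁ : ζ ∈ Metric.ball (t₁ : ℂ) r₁) (z₂ : ζ ∈ Metric.ball (t₂ : ℂ) r₂) :
    F₁ ζ = F₂ ζ := by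
  have key : ∀ (t r : ℝ), ζ ∈ Metric.ball (t : ℂ) r → (ζ.re : ℂ) ∈ Metric.ball (t : ℂ) r := by
    intro t r h
    rw [Metric.mem_ball, dist_eq_norm] at h ⊢
    refine lt_of_le_of_lt ?_ h
    rw [← ofReal_sub, Complex.norm_real]
    simpa using abs_re_le_norm (ζ - t)
  set U := Metric.ball (t₁ : ℂ) r₁ ∩ Metric.ball (t₂ : ℂ) r₂
  have hU : IsOpen U := Metric.isOpen_ball.inter Metric.isOpen_ball
  have hconv : Convex ℝ U := (convex_ball _ _).inter (convex_ball _ _)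
  have hx : (ζ.re : ℂ) ∈ U := ⟨key _ _ z₁, key _ _ z₂⟩
  refine ((h₁.mono inter_subset_left).analyticOnNhd hU).eqOn_of_preconnected_of_frequently_eq
    ((h₂.mono inter_subset_right).analyticOnNhd hU) hconv.isPreconnected hx ?_ ⟨z₁, z₂⟩
  have hc : Tendsto (fun s : ℝ => (s : ℂ)) (𝓝[≠] ζ.re) (𝓝[≠] (ζ.re : ℂ)) := by
    refine tendsto_nhdsWithin_iff.2 ⟨(continuous_ofReal.tendsto _).mono_left nhdsWithin_le_nhds, ?_⟩
    filter_upwards [self_mem_nhdsWithin] with s hs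
    simpa using hs
  refine hc.frequently (Eventually.frequently ?_)
  have : ∀ᶠ s : ℝ in 𝓝 ζ.re, (s : ℂ) ∈ U :=
    (continuous_ofReal.tendsto _).eventually (hU.mem_nhds hx)
  filter_upwards [nhdsWithin_le_nhds this] with s hs
  rw [e₁ s hs.1, e₂ s hs.2]

/-- A Lebesgue number of the covering of one period by discs of convergence gives a strip of uniform
height; the local extensions agree on overlaps because they agree on the real axis. -/
theorem exists_strip_extension {f : ℝ → ℂ} (hf : ∀ t, AnalyticAt ℝ f t)
    (hp : Function.Periodic f 1) :
    ∃ δ > 0, ∃ F : ℂ → ℂ, DifferentiableOn ℂ F (horizStrip δ) ∧ Function.Periodic F 1 ∧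
      ∀ t : ℝ, F t = f t := by
  choose r hr F hF hFf using fun t => (hf t).exists_complex_extension
  have hcov : (Icc (0 : ℝ) 1) ⊆ ⋃ t, Metric.ball t (r t) := fun t _ =>
    mem_iUnion.2 ⟨t, Metric.mem_ball_self (hr t)⟩
  obtain ⟨δ, hδ, hleb⟩ := lebesgue_number_lemma_of_metric isCompact_Icc
    (fun _ => Metric.isOpen_ball) hcov
  have hleb' : ∀ x : ℝ, ∃ t, x ∈ Icc (0 : ℝ) 1 → Metric.ball x δ ⊆ Metric.ball t (r t) := by
    intro x
    by_cases hx : x ∈ Icc (0 : ℝ) 1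
    · obtain ⟨i, hi⟩ := hleb x hx; exact ⟨i, fun _ => hi⟩
    · exact ⟨0, fun h => absurd h hx⟩
  choose c hc using hleb'
  -- The real point at distance `δ / 2` from `x` on the side away from `c x` still lies in the disc
  -- about `c x`. This leaves room `δ / 2` for the imaginary part.
  have hball : ∀ x ∈ Icc (0 : ℝ) 1, ∀ ζ : ℂ, ζ.re = x → |ζ.im| < δ / 2 →
      ζ ∈ Metric.ball (c x : ℂ) (r (c x)) := by
    intro x hx ζ hre him
    have h1 : |x - c x| + δ / 2 < r (c x) ∨ |x - c x| + δ / 2 ≤ r (c x) := by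
      right
      rcases le_total (c x) x with h | h
      · have : x + δ / 2 ∈ Metric.ball x δ := by
          rw [Metric.mem_ball, Real.dist_eq, add_sub_cancel_left, abs_of_pos (by linarith)]; linarith
        have := hc x hx this
        rw [Metric.mem_ball, Real.dist_eq] at this
        have h3 := le_abs_self (x + δ / 2 - c x)
        rw [abs_of_nonneg (by linarith)]
        linarith
      · have : x - δ / 2 ∈ Metric.ball x δ := by
          rw [Metric.mem_ball, Real.dist_eq]
          have : x - δ / 2 - x = - (δ / 2) := by ring
          rw [this, abs_neg, abs_of_pos (by linarith)]; linarith
        have := hc x hx this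
        rw [Metric.mem_ball, Real.dist_eq] at this
        have h3 := neg_le_abs (x - δ / 2 - c x)
        rw [abs_of_nonpos (by linarith)]
        linarith
    have h1' : |x - c x| + δ / 2 ≤ r (c x) := h1.elim le_of_lt id
    rw [Metric.mem_ball, dist_eq_norm]
    calc ‖ζ - c x‖ ≤ |(ζ - c x).re| + |(ζ - c x).im| := norm_le_abs_re_add_abs_im _
      _ < |x - c x| + δ / 2 := by simp [hre]; exact him
      _ ≤ _ := h1'
  have hshift : ∀ (x : ℝ) (k : ℤ), DifferentiableOn ℂ (fun ζ => F (c x) (ζ - k))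
      (Metric.ball ((c x + k : ℝ) : ℂ) (r (c x))) := by
    intro x k
    refine (hF (c x)).comp (by fun_prop) ?_
    intro ζ hζ
    rw [Metric.mem_ball, dist_eq_norm] at hζ ⊢
    convert hζ using 2
    push_cast; ring
  have hshift' : ∀ (x : ℝ) (k : ℤ) (s : ℝ),
      (s : ℂ) ∈ Metric.ball ((c x + k : ℝ) : ℂ) (r (c x)) → F (c x) ((s : ℂ) - k) = f s := by
    intro x k s hs
    have : ((s - k : ℝ) : ℂ) ∈ Metric.ball (c x : ℂ) (r (c x)) := by
      rw [Metric.mem_ball, dist_eq_norm] at hs ⊢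
      convert hs using 2
      push_cast; ring
    have h2 := hFf _ _ this
    push_cast at h2
    rw [h2]
    simpa using hp.sub_int_mul_eq (x := s) k
  have hmem : ∀ ζ : ℂ, |ζ.im| < δ / 2 →
      ζ ∈ Metric.ball ((c (Int.fract ζ.re) + ⌊ζ.re⌋ : ℝ) : ℂ) (r (c (Int.fract ζ.re))) := by
    intro ζ hζ
    have h0 := hball (Int.fract ζ.re) ⟨Int.fract_nonneg _, (Int.fract_lt_one _).le⟩
      (ζ - ⌊ζ.re⌋) (by simp) (by simpa using hζ)
    rw [Metric.mem_ball, dist_eq_norm] at h0 ⊢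
    convert h0 using 2
    push_cast; ring
  -- The choice of disc and the floor both jump with `ζ`, but neighbouring choices are continuations
  -- of the same function on the reals, so the values fit together.
  refine ⟨δ / 2, by positivity, fun ζ => F (c (Int.fract ζ.re)) (ζ - ⌊ζ.re⌋), ?_, ?_, ?_⟩
  · intro ζ hζ
    have h1 := ((hshift (Int.fract ζ.re) ⌊ζ.re⌋).differentiableAt
      (Metric.isOpen_ball.mem_nhds (hmem ζ hζ)))
    refine (h1.congr_of_eventuallyEq ?_).differentiableWithinAt
    filter_upwards [Metric.isOpen_ball.mem_nhds (hmem ζ hζ),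
      (isOpen_horizStrip (δ / 2)).mem_nhds hζ] with ξ hξ hξ'
    exact eq_of_eq_on_reals_ball (hshift _ _) (hshift _ _) (f := f)
      (fun s hs => hshift' _ _ s hs) (fun s hs => hshift' _ _ s hs) (hmem ξ hξ') hξ
  · intro ζ
    simp
  · intro t
    have := hshift' (Int.fract t) ⌊t⌋ t (by
      have := hmem t (by simpa using hδ)
      simpa using this)
    simpa using this

/-! ### Contour integrals of periodic functions over a period rectangle. -/

theorem mem_reProdIm_uIcc {x₁ x₂ y₁ y₂ : ℝ} {ξ : ℂ} (hx : x₁ ≤ x₂) (hy : y₁ ≤ y₂) :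
    ξ ∈ (uIcc x₁ x₂) ×ℂ (uIcc y₁ y₂) ↔ (x₁ ≤ ξ.re ∧ ξ.re ≤ x₂) ∧ (y₁ ≤ ξ.im ∧ ξ.im ≤ y₂) := by
  rw [uIcc_of_le hx, uIcc_of_le hy, mem_reProdIm, mem_Icc, mem_Icc]

/-- Contour shift for a periodic function. -/
theorem periodic_integral_eq_of_strip {ψ : ℂ → ℂ} {y₁ y₂ : ℝ} (hy : y₁ ≤ y₂)
    (hp : Function.Periodic ψ 1) (hc : ContinuousOn ψ {ξ | y₁ ≤ ξ.im ∧ ξ.im ≤ y₂})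
    (hd : DifferentiableOn ℂ ψ {ξ | y₁ < ξ.im ∧ ξ.im < y₂}) :
    ∫ t in (0 : ℝ)..1, ψ (t + y₁ * I) = ∫ t in (0 : ℝ)..1, ψ (t + y₂ * I) := by
  have h := integral_boundary_rect_eq_zero_of_continuousOn_of_differentiableOn ψ
    (y₁ * I) (1 + y₂ * I) (hc.mono ?_) (hd.mono ?_)
  · have h2 : ∀ y : ℝ, ψ (1 + y * I) = ψ (y * I) := fun y => by rw [add_comm, hp]
    simpa [h2, sub_eq_zero] using h
  · intro ξ hξ
    have := (mem_reProdIm_uIcc (by simp) (by simpa using hy)).1 hξ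
    simpa using this.2
  · intro ξ hξ
    have := hξ.2
    simpa [hy] using this

theorem integral_inv_horizontal {x₁ x₂ y : ℝ} (hy : y ≠ 0) :
    ∫ x in x₁..x₂, ((x : ℂ) + y * I)⁻¹ = log (x₂ + y * I) - log (x₁ + y * I) := by
  have hne : ∀ x : ℝ, (x : ℂ) + y * I ≠ 0 := fun x h => hy (by simpa using congrArg im h)
  refine intervalIntegral.integral_eq_sub_of_hasDerivAt (f := fun x : ℝ => log (x + y * I)) ?_ ?_
  · intro x _
    have h1 : HasDerivAt (fun x : ℝ => (x : ℂ) + y * I) 1 x :=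
      (ofRealCLM.hasDerivAt (x := x)).add_const _
    have := h1.clog_real (Or.inr (by simpa using hy))
    simpa using this
  · refine (Continuous.inv₀ (by fun_prop) hne).intervalIntegrable _ _

theorem integral_inv_vertical {x y₁ y₂ : ℝ} (hx : 0 < x) :
    I * ∫ y in y₁..y₂, ((x : ℂ) + y * I)⁻¹ = log (x + y₂ * I) - log (x + y₁ * I) := by
  have hne : ∀ y : ℝ, (x : ℂ) + y * I ≠ 0 := fun y h => hx.ne' (by simpa using congrArg re h)
  rw [← intervalIntegral.integral_const_mul]
  refine intervalIntegral.integral_eq_sub_of_hasDerivAt (f := fun y : ℝ => log (x + y * I)) ?_ ?_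
  · intro y _
    have h1 : HasDerivAt (fun y : ℝ => (x : ℂ) + y * I) I y := by
      simpa using ((ofRealCLM.hasDerivAt (x := y)).mul_const I).const_add (x : ℂ)
    have := h1.clog_real (Or.inl (by simpa using hx))
    simpa [div_eq_mul_inv] using this
  · refine (continuous_const.mul (Continuous.inv₀ (by fun_prop) hne)).intervalIntegrable _ _

/-- The principal logarithm is a primitive on the horizontal sides and on the right side. The left
side crosses the slit, and there `log (-·)` is used, which differs from `log` by `π i` below the
real axis and by `-π i` above it; the two discrepancies add up to `2 π i`. -/
theorem rect_integral_inv {x₁ x₂ y₁ y₂ : ℝ} (hx₁ : x₁ < 0) (hx₂ : 0 < x₂) (hy₁ : y₁ < 0)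
    (hy₂ : 0 < y₂) :
    (∫ x in x₁..x₂, ((x : ℂ) + y₁ * I)⁻¹) - (∫ x in x₁..x₂, ((x : ℂ) + y₂ * I)⁻¹) +
      I * (∫ y in y₁..y₂, ((x₂ : ℂ) + y * I)⁻¹) - I * (∫ y in y₁..y₂, ((x₁ : ℂ) + y * I)⁻¹) =
    2 * Real.pi * I := by
  have hleft : I * (∫ y in y₁..y₂, ((x₁ : ℂ) + y * I)⁻¹) =
      log (-(x₁ + y₂ * I)) - log (-(x₁ + y₁ * I)) := by
    have h := integral_inv_vertical (x := -x₁) (y₁ := -y₁) (y₂ := -y₂) (by linarith)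
    have h7 := intervalIntegral.integral_comp_neg (a := y₂) (b := y₁)
      (fun y : ℝ => (((-x₁ : ℝ) : ℂ) + (y : ℂ) * I)⁻¹)
    rw [← h7, intervalIntegral.integral_symm] at h
    have h3 : ∀ y : ℝ, (((-x₁ : ℝ) : ℂ) + ((-y : ℝ) : ℂ) * I) = -((x₁ : ℂ) + y * I) := fun y => by
      push_cast; ring
    simp only [h3, inv_neg, intervalIntegral.integral_neg, neg_neg] at h
    exact h
  rw [hleft, integral_inv_vertical hx₂, integral_inv_horizontal hy₁.ne,
    integral_inv_horizontal hy₂.ne']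
  have e1 : log (-(x₁ + y₁ * I)) = log (x₁ + y₁ * I) + Real.pi * I := by
    apply Complex.ext
    · simp [log_re]
      rw [← norm_neg]; congr 2; ring
    · simp only [log_im, add_im, mul_im, ofReal_re, I_im, ofReal_im, I_re]
      rw [arg_neg_eq_arg_add_pi_of_im_neg (by simpa using hy₁)]; simp
  have e2 : log (-(x₁ + y₂ * I)) = log (x₁ + y₂ * I) - Real.pi * I := by
    apply Complex.ext
    · simp [log_re]
      rw [← norm_neg]; congr 2; ring
    · simp only [log_im, sub_im, mul_im, ofReal_re, I_im, ofReal_im, I_re]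
      rw [arg_neg_eq_arg_sub_pi_of_im_pos (by simpa using hy₂)]; simp
  rw [e1, e2]
  ring

/-- Residue theorem for a periodic function with one simple pole in a period strip. -/
theorem periodic_integral_sub_eq_residue {ψ F : ℂ → ℂ} {y₁ y₂ : ℝ} {ζ : ℂ} (h₁ : y₁ < ζ.im)
    (h₂ : ζ.im < y₂) (hp : Function.Periodic ψ 1)
    (hc : ContinuousOn F {ξ | |ξ.re - ζ.re| ≤ 1 / 2 ∧ y₁ ≤ ξ.im ∧ ξ.im ≤ y₂})
    (hd : DifferentiableOn ℂ F {ξ | |ξ.re - ζ.re| < 1 / 2 ∧ y₁ < ξ.im ∧ ξ.im < y₂})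
    (hF : ∀ ξ, |ξ.re - ζ.re| ≤ 1 / 2 → y₁ ≤ ξ.im → ξ.im ≤ y₂ → ξ ≠ ζ → ψ ξ = F ξ / (ξ - ζ)) :
    (∫ t in (0 : ℝ)..1, ψ (t + y₁ * I)) - ∫ t in (0 : ℝ)..1, ψ (t + y₂ * I) =
      2 * Real.pi * I * F ζ := by
  have hy : y₁ ≤ y₂ := (h₁.trans h₂).le
  -- The period rectangle is centred at `Re ζ`: the pole is then interior, and the integrals of `ψ`
  -- over the vertical sides cancel by periodicity.
  set x₁ := ζ.re - 1 / 2 with hx₁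
  set x₂ := ζ.re + 1 / 2 with hx₂
  have hx : x₁ ≤ x₂ := by linarith
  have hsub : (uIcc x₁ x₂) ×ℂ (uIcc y₁ y₂) ⊆ {ξ | |ξ.re - ζ.re| ≤ 1 / 2 ∧ y₁ ≤ ξ.im ∧ ξ.im ≤ y₂} := by
    intro ξ hξ
    have := (mem_reProdIm_uIcc hx hy).1 hξ
    exact ⟨abs_le.2 ⟨by linarith [this.1.1], by linarith [this.1.2]⟩, this.2⟩
  have hopen : IsOpen {ξ : ℂ | |ξ.re - ζ.re| < 1 / 2 ∧ y₁ < ξ.im ∧ ξ.im < y₂} := by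
    refine (isOpen_lt (f := fun ξ : ℂ => |ξ.re - ζ.re|) (by fun_prop) continuous_const).inter
      ((isOpen_lt continuous_const continuous_im).inter (isOpen_lt continuous_im continuous_const))
  have hζ : ζ ∈ {ξ : ℂ | |ξ.re - ζ.re| < 1 / 2 ∧ y₁ < ξ.im ∧ ξ.im < y₂} :=
    ⟨by simp, h₁, h₂⟩
  have hFd : DifferentiableAt ℂ F ζ := hd.differentiableAt (hopen.mem_nhds hζ)
  have hmem : {ξ : ℂ | |ξ.re - ζ.re| ≤ 1 / 2 ∧ y₁ ≤ ξ.im ∧ ξ.im ≤ y₂} ∈ 𝓝 ζ :=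
    mem_of_superset (hopen.mem_nhds hζ) fun ξ hξ => ⟨hξ.1.le, hξ.2.1.le, hξ.2.2.le⟩
  -- Cauchy's theorem is applied to the difference quotient of `F` at `ζ`. Off `ζ` this is `ψ ξ - F
  -- ζ / (ξ - ζ)`, so only the rectangle integral of `1 / (ξ - ζ)` remains to be evaluated.
  have h := integral_boundary_rect_eq_zero_of_differentiable_on_off_countable (dslope F ζ)
    (x₁ + y₁ * I) (x₂ + y₂ * I) {ζ} (countable_singleton _)
    (by
      simp only [add_re, ofReal_re, mul_re, I_re, mul_zero, ofReal_im, I_im, mul_one, sub_self,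
        add_zero, add_im, mul_im, zero_add]
      exact ((continuousOn_dslope hmem).2 ⟨hc, hFd⟩).mono hsub)
    (by
      simp only [add_re, ofReal_re, mul_re, I_re, mul_zero, ofReal_im, I_im, mul_one, sub_self,
        add_zero, add_im, mul_im, zero_add, min_eq_left hx, max_eq_right hx, min_eq_left hy,
        max_eq_right hy]
      rintro ξ ⟨hξ, hne⟩
      have hξ1 := hξ.1
      have hξ2 := hξ.2
      refine (differentiableAt_dslope_of_ne hne).2 (hd.differentiableAt (hopen.mem_nhds ?_))
      exact ⟨abs_lt.2 ⟨by linarith [hξ1.1], by linarith [hξ1.2]⟩, hξ2.1, hξ2.2⟩)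
  simp only [add_re, ofReal_re, mul_re, I_re, mul_zero, ofReal_im, I_im, mul_one, sub_self,
        add_zero, add_im, mul_im, zero_add, smul_eq_mul] at h
  have hds : ∀ ξ : ℂ, |ξ.re - ζ.re| ≤ 1 / 2 → y₁ ≤ ξ.im → ξ.im ≤ y₂ → ξ ≠ ζ →
      dslope F ζ ξ = ψ ξ - F ζ * (ξ - ζ)⁻¹ := by
    intro ξ a b c d
    rw [dslope_of_ne _ d, slope_def_field, hF ξ a b c d]
    ring
  have hcont : ∀ ξ : ℂ, ξ ∈ {ξ : ℂ | |ξ.re - ζ.re| ≤ 1 / 2 ∧ y₁ ≤ ξ.im ∧ ξ.im ≤ y₂} → ξ ≠ ζ →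
      ContinuousWithinAt ψ {ξ : ℂ | |ξ.re - ζ.re| ≤ 1 / 2 ∧ y₁ ≤ ξ.im ∧ ξ.im ≤ y₂} ξ := by
    intro ξ hξ hne
    have h1 : ContinuousWithinAt (fun ξ => F ξ / (ξ - ζ))
        {ξ : ℂ | |ξ.re - ζ.re| ≤ 1 / 2 ∧ y₁ ≤ ξ.im ∧ ξ.im ≤ y₂} ξ :=
      (hc ξ hξ).div (by fun_prop) (sub_ne_zero.2 hne)
    refine h1.congr_of_eventuallyEq ?_ (hF ξ hξ.1 hξ.2.1 hξ.2.2 hne)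
    filter_upwards [self_mem_nhdsWithin, nhdsWithin_le_nhds (isOpen_ne.mem_nhds hne)] with w hw hw'
    exact hF w hw.1 hw.2.1 hw.2.2 hw'
  have hor : ∀ y : ℝ, y₁ ≤ y → y ≤ y₂ → y ≠ ζ.im →
      ∫ x in x₁..x₂, dslope F ζ (x + y * I) = (∫ t in (0 : ℝ)..1, ψ (t + y * I)) -
        F ζ * ∫ x in (-(1 / 2) : ℝ)..(1 / 2), ((x : ℂ) + (y - ζ.im : ℝ) * I)⁻¹ := by
    intro y ha hb hne
    have hpt : ∀ x ∈ (uIcc x₁ x₂), |((x : ℂ) + y * I).re - ζ.re| ≤ 1 / 2 := by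
      intro x hxx
      rw [uIcc_of_le hx] at hxx
      simp only [add_re, ofReal_re, mul_re, I_re, mul_zero, ofReal_im, I_im, mul_one, sub_self,
        add_zero]
      exact abs_le.2 ⟨by linarith [hxx.1], by linarith [hxx.2]⟩
    have hne' : ∀ x : ℝ, (x : ℂ) + y * I ≠ ζ := fun x hh => hne (by simpa using congrArg im hh)
    have e1 : ∫ x in x₁..x₂, dslope F ζ (x + y * I) =
        ∫ x in x₁..x₂, (ψ (x + y * I) - F ζ * ((x : ℂ) + y * I - ζ)⁻¹) :=
      intervalIntegral.integral_congr fun x hxx =>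
        hds _ (hpt x hxx) (by simpa using ha) (by simpa using hb) (hne' x)
    rw [e1, intervalIntegral.integral_sub, intervalIntegral.integral_const_mul]
    · congr 1
      · have hper : Function.Periodic (fun t : ℝ => ψ (t + y * I)) 1 := by
          intro t
          have := hp (t + y * I)
          simp only
          rw [← this]; congr 1; push_cast; ring
        have := hper.intervalIntegral_add_eq x₁ 0
        rw [zero_add] at this
        rw [← this]
        congr 1
        rw [hx₁, hx₂]; ring
      · congr 1
        have := intervalIntegral.integral_comp_sub_right (a := x₁) (b := x₂)
          (fun x : ℝ => ((x : ℂ) + (y - ζ.im : ℝ) * I)⁻¹) ζ.re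
        rw [show x₁ - ζ.re = -(1 / 2) by rw [hx₁]; ring,
          show x₂ - ζ.re = 1 / 2 by rw [hx₂]; ring] at this
        rw [← this]
        refine intervalIntegral.integral_congr fun x _ => ?_
        congr 1
        conv_lhs => rw [← re_add_im ζ]
        push_cast
        ring
    · refine ContinuousOn.intervalIntegrable ?_
      intro x hxx
      refine ContinuousWithinAt.comp (t := {ξ : ℂ | |ξ.re - ζ.re| ≤ 1 / 2 ∧ y₁ ≤ ξ.im ∧ ξ.im ≤ y₂})
        (f := fun x : ℝ => (x : ℂ) + y * I) (g := ψ)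
        (hcont _ ⟨hpt x hxx, by simpa using ha, by simpa using hb⟩ (hne' x))
        (by fun_prop) ?_
      intro x' hx'
      exact ⟨hpt x' hx', by simpa using ha, by simpa using hb⟩
    · refine Continuous.intervalIntegrable ?_ _ _
      exact continuous_const.mul (Continuous.inv₀ (by fun_prop) fun x => sub_ne_zero.2 (hne' x))
  have ver : ∀ x : ℝ, |x - ζ.re| = 1 / 2 →
      ∫ y in y₁..y₂, dslope F ζ (x + y * I) = (∫ y in y₁..y₂, ψ (x + y * I)) -
        F ζ * ∫ y in (y₁ - ζ.im)..(y₂ - ζ.im), (((x - ζ.re : ℝ) : ℂ) + y * I)⁻¹ := by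
    intro x hxx
    have hne' : ∀ y : ℝ, (x : ℂ) + y * I ≠ ζ := fun y hh => by
      have := congrArg re hh
      simp at this
      rw [this] at hxx; simp at hxx
    have hpt : ∀ y ∈ (uIcc y₁ y₂), y₁ ≤ ((x : ℂ) + y * I).im ∧ ((x : ℂ) + y * I).im ≤ y₂ := by
      intro y hyy
      rw [uIcc_of_le hy] at hyy
      simpa using hyy
    have hxx' : ∀ y : ℝ, |((x : ℂ) + y * I).re - ζ.re| ≤ 1 / 2 := fun y => by
      simpa using hxx.le
    have e1 : ∫ y in y₁..y₂, dslope F ζ (x + y * I) =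
        ∫ y in y₁..y₂, (ψ (x + y * I) - F ζ * ((x : ℂ) + y * I - ζ)⁻¹) :=
      intervalIntegral.integral_congr fun y hyy =>
        hds _ (hxx' y) (hpt y hyy).1 (hpt y hyy).2 (hne' y)
    rw [e1, intervalIntegral.integral_sub, intervalIntegral.integral_const_mul]
    · congr 2
      rw [← intervalIntegral.integral_comp_sub_right
        (fun y : ℝ => (((x - ζ.re : ℝ) : ℂ) + y * I)⁻¹) ζ.im]
      refine intervalIntegral.integral_congr fun y _ => ?_
      congr 1
      conv_lhs => rw [← re_add_im ζ]
      push_cast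
      ring
    · refine ContinuousOn.intervalIntegrable ?_
      intro y hyy
      refine ContinuousWithinAt.comp (t := {ξ : ℂ | |ξ.re - ζ.re| ≤ 1 / 2 ∧ y₁ ≤ ξ.im ∧ ξ.im ≤ y₂})
        (f := fun y : ℝ => (x : ℂ) + y * I) (g := ψ)
        (hcont _ ⟨hxx' y, hpt y hyy⟩ (hne' y))
        (by fun_prop) ?_
      intro y' hy'
      exact ⟨hxx' y', hpt y' hy'⟩
    · refine Continuous.intervalIntegrable ?_ _ _
      exact continuous_const.mul (Continuous.inv₀ (by fun_prop) fun x => sub_ne_zero.2 (hne' x))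
  rw [hor y₁ le_rfl hy h₁.ne, hor y₂ hy le_rfl h₂.ne', ver x₂ (by rw [hx₂]; norm_num),
    ver x₁ (by rw [hx₁]; norm_num)] at h
  have hper : ∫ y in y₁..y₂, ψ (x₂ + y * I) = ∫ y in y₁..y₂, ψ (x₁ + y * I) := by
    refine intervalIntegral.integral_congr fun y _ => ?_
    have := hp (x₁ + y * I)
    rw [← this]; congr 1
    rw [hx₁, hx₂]; push_cast; ring
  have hw := rect_integral_inv (x₁ := x₁ - ζ.re) (x₂ := x₂ - ζ.re) (y₁ := y₁ - ζ.im)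
    (y₂ := y₂ - ζ.im) (by rw [hx₁]; norm_num) (by rw [hx₂]; norm_num) (by linarith) (by linarith)
  rw [show x₁ - ζ.re = -(1 / 2) by rw [hx₁]; ring,
          show x₂ - ζ.re = 1 / 2 by rw [hx₂]; ring] at hw h
  rw [hper] at h
  linear_combination h + F ζ * hw

/-! ### Holomorphic dependence of integrals on a parameter. -/

/-- On a disc about `a` of half the radius of a disc missing the curve, the denominators stay away
from zero, which gives a constant bound for differentiating under the integral sign. -/
theorem hasDerivAt_integral_div_sub_pow {g c : ℝ → ℂ} (hg : Continuous g) (hc : Continuous c)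
    {a : ℂ} (ha : ∀ t ∈ Icc (0 : ℝ) 1, c t ≠ a) (m : ℕ) :
    HasDerivAt (fun a => ∫ t in (0 : ℝ)..1, g t / (c t - a) ^ (m + 1))
      ((m + 1) * ∫ t in (0 : ℝ)..1, g t / (c t - a) ^ (m + 2)) a := by
  have hcomp : IsCompact (c '' Icc (0 : ℝ) 1) := isCompact_Icc.image hc
  have hnot : a ∈ (c '' Icc (0 : ℝ) 1)ᶜ := by
    rintro ⟨t, ht, h⟩; exact ha t ht h
  obtain ⟨ε, hε, hball⟩ := Metric.isOpen_iff.1 hcomp.isClosed.isOpen_compl a hnot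
  have hdist : ∀ t ∈ Icc (0 : ℝ) 1, ∀ b ∈ Metric.ball a (ε / 2), ε / 2 ≤ ‖c t - b‖ := by
    intro t ht b hb
    by_contra! hlt
    refine absurd (mem_image_of_mem c ht) (hball ?_)
    rw [Metric.mem_ball, dist_eq_norm] at hb ⊢
    calc ‖c t - a‖ = ‖(c t - b) + (b - a)‖ := by congr 1; ring
      _ ≤ ‖c t - b‖ + ‖b - a‖ := norm_add_le _ _
      _ < ε := by linarith
  have hne : ∀ t ∈ Icc (0 : ℝ) 1, ∀ b ∈ Metric.ball a (ε / 2), c t - b ≠ 0 := by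
    intro t ht b hb h
    have := hdist t ht b hb
    rw [h, norm_zero] at this
    linarith
  have hcont : ∀ b ∈ Metric.ball a (ε / 2), ∀ k : ℕ,
      ContinuousOn (fun t => g t / (c t - b) ^ k) (uIcc 0 1) := by
    intro b hb k
    rw [uIcc_of_le zero_le_one]
    exact hg.continuousOn.div (by fun_prop) fun t ht => pow_ne_zero _ (hne t ht b hb)
  obtain ⟨C, hC⟩ := (isCompact_Icc (a := (0 : ℝ)) (b := 1)).exists_bound_of_continuousOn
    hg.continuousOn
  have hmem : ∀ {t : ℝ}, t ∈ uIoc (0 : ℝ) 1 → t ∈ Icc (0 : ℝ) 1 := fun {t} ht => by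
    rw [uIoc_of_le zero_le_one] at ht; exact ⟨ht.1.le, ht.2⟩
  have hae : a ∈ Metric.ball a (ε / 2) := Metric.mem_ball_self (by positivity)
  have key := (intervalIntegral.hasDerivAt_integral_of_dominated_loc_of_deriv_le
    (μ := volume) (a := 0) (b := 1)
    (F := fun b t => g t / (c t - b) ^ (m + 1))
    (F' := fun b t => (m + 1) * (g t / (c t - b) ^ (m + 2)))
    (x₀ := a) (s := Metric.ball a (ε / 2)) (bound := fun _ => (m + 1) * (C / (ε / 2) ^ (m + 2)))
    (Metric.ball_mem_nhds _ (by positivity))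
    ?_ (hcont a hae _).intervalIntegrable ?_ ?_ intervalIntegrable_const ?_).2
  · rwa [intervalIntegral.integral_const_mul] at key
  · filter_upwards [Metric.ball_mem_nhds a (by positivity : 0 < ε / 2)] with b hb
    exact (hcont b hb _).intervalIntegrable.1.aestronglyMeasurable.mono_measure
      (by rw [uIoc_of_le zero_le_one])
  · exact ((hcont a hae _).intervalIntegrable.1.aestronglyMeasurable.mono_measure
      (by rw [uIoc_of_le zero_le_one])).const_mul _
  · refine ae_of_all _ fun t ht b hb => ?_
    rw [norm_mul, norm_div, norm_pow]
    have h1 : ‖((m : ℂ) + 1)‖ = m + 1 := by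
      have : ((m : ℂ) + 1) = ((m + 1 : ℕ) : ℂ) := by push_cast; rfl
      rw [this, Complex.norm_natCast]; push_cast; rfl
    rw [h1]
    have := hdist t (hmem ht) b hb
    have h2 := hC t (hmem ht)
    have h0 : 0 ≤ C := (norm_nonneg _).trans h2
    gcongr
  · refine ae_of_all _ fun t ht b hb => ?_
    have hb' := hne t (hmem ht) b hb
    have h1 : HasDerivAt (fun b => (c t - b) ^ (m + 1))
        (((m + 1 : ℕ) : ℂ) * (c t - b) ^ m * (-1)) b := by
      simpa using ((hasDerivAt_id b).const_sub (c t)).fun_pow (m + 1)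
    have h2 := (hasDerivAt_const b (g t)).fun_div h1 (pow_ne_zero _ hb')
    refine h2.congr_deriv ?_
    field_simp
    push_cast
    ring

/-- A bounded family of holomorphic functions integrates to a holomorphic function. -/
theorem differentiableOn_integral_of_norm_le {Y : Type*} [MeasurableSpace Y] {μ : Measure Y}
    {f : ℂ → Y → ℂ} {U : Set ℂ} (hU : IsOpen U) {b : Y → ℝ} (hb : Integrable b μ)
    (hd : ∀ y, DifferentiableOn ℂ (fun ζ => f ζ y) U)
    (hm : ∀ ζ ∈ U, AEStronglyMeasurable (f ζ) μ) (hle : ∀ y, ∀ ζ ∈ U, ‖f ζ y‖ ≤ b y) :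
    DifferentiableOn ℂ (fun ζ => ∫ y, f ζ y ∂μ) U := by
  intro ζ₀ hζ₀
  obtain ⟨ε, hε, hball⟩ := Metric.isOpen_iff.1 hU ζ₀ hζ₀
  have hd' : ∀ y, ∀ ζ ∈ U, HasDerivAt (fun ζ => f ζ y) (deriv (fun ζ => f ζ y) ζ) ζ :=
    fun y ζ hζ => ((hd y).differentiableAt (hU.mem_nhds hζ)).hasDerivAt
  have key := (hasDerivAt_integral_of_dominated_loc_of_deriv_le (μ := μ) (F := f)
    (F' := fun ζ y => deriv (fun ζ => f ζ y) ζ) (x₀ := ζ₀) (s := Metric.ball ζ₀ (ε / 2))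
    (bound := fun y => b y / (ε / 4)) (Metric.ball_mem_nhds _ (by positivity))
    ?_ ?_ ?_ ?_ ?_ ?_).2
  · exact key.differentiableAt.differentiableWithinAt
  · filter_upwards [hU.mem_nhds hζ₀] with ζ hζ using hm ζ hζ
  · exact hb.mono' (hm ζ₀ hζ₀) (ae_of_all _ fun y => hle y ζ₀ hζ₀)
  -- The derivative is measurable in `y` as a limit of difference quotients along a sequence in `U`
  -- tending to `ζ₀`.
  · have hu : Tendsto (fun k : ℕ => ζ₀ + ((ε / 2 / (k + 1 : ℝ) : ℝ) : ℂ)) atTop (𝓝[≠] ζ₀) := by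
      refine tendsto_nhdsWithin_iff.2 ⟨?_, Eventually.of_forall fun k => ?_⟩
      · have h1 : Tendsto (fun k : ℕ => ε / 2 / (k + 1 : ℝ)) atTop (𝓝 0) :=
          tendsto_const_nhds.div_atTop (tendsto_natCast_atTop_atTop.atTop_add tendsto_const_nhds)
        have h2 := (continuous_ofReal.tendsto 0).comp h1
        simpa using h2.const_add ζ₀
      · have : ε / 2 / (k + 1 : ℝ) ≠ 0 := by positivity
        rw [mem_compl_singleton_iff, Ne, add_eq_left]
        exact_mod_cast this
    refine aestronglyMeasurable_of_tendsto_ae atTop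
      (f := fun (k : ℕ) y => slope (fun ζ => f ζ y) ζ₀ (ζ₀ + ((ε / 2 / (k + 1 : ℝ) : ℝ) : ℂ)))
      (fun k => ?_) (ae_of_all _ fun y => ?_)
    · simp only [slope_def_field]
      have hk : ζ₀ + ((ε / 2 / (k + 1 : ℝ) : ℝ) : ℂ) ∈ U := by
        refine hball ?_
        rw [Metric.mem_ball, dist_eq_norm, add_sub_cancel_left, Complex.norm_real,
          Real.norm_of_nonneg (by positivity)]
        have : ε / 2 / (k + 1 : ℝ) ≤ ε / 2 := div_le_self (by positivity) (by linarith [k.cast_nonneg (α := ℝ)])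
        linarith
      simp only [div_eq_mul_inv]
      exact AEStronglyMeasurable.mul_const ((hm _ hk).sub (hm _ hζ₀)) _
    · exact (hasDerivAt_iff_tendsto_slope.1 (hd' y ζ₀ hζ₀)).comp hu
  -- Cauchy's estimate on discs of radius `ε / 4` turns the bound for `f` into a bound for its
  -- derivative.
  · refine ae_of_all _ fun y ζ hζ => ?_
    have hsub : Metric.closedBall ζ (ε / 4) ⊆ U := by
      refine subset_trans ?_ hball
      refine Metric.closedBall_subset_ball' ?_
      have := Metric.mem_ball.1 hζ
      linarith
    refine Complex.norm_deriv_le_of_forall_mem_sphere_norm_le (by positivity) ?_ ?_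
    · exact ((hd y).mono hsub).diffContOnCl_ball subset_rfl
    · intro ξ hξ
      exact hle y ξ (hsub (Metric.sphere_subset_closedBall hξ))
  · exact hb.div_const _
  · refine ae_of_all _ fun y ζ hζ => hd' y ζ (hball ?_)
    exact Metric.ball_subset_ball (by linarith) hζ

/-! ### Tubular coordinates around the boundary curves. -/

theorem AnalyticAt.exists_analytic_inverse {f : ℂ → ℂ} {a : ℂ} (hf : AnalyticAt ℂ f a)
    (hf' : deriv f a ≠ 0) :
    ∃ ψ : ℂ → ℂ, AnalyticAt ℂ ψ (f a) ∧ ψ (f a) = a ∧ deriv ψ (f a) = (deriv f a)⁻¹ ∧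
      (∀ᶠ x in 𝓝 a, ψ (f x) = x) ∧ ∀ᶠ z in 𝓝 (f a), f (ψ z) = z :=
  ⟨_, hf.analyticAt_localInverse hf',
    (hf.hasStrictDerivAt.eventually_left_inverse hf').self_of_nhds,
    (hf.hasStrictDerivAt.to_localInverse hf').hasDerivAt.deriv,
    hf.hasStrictDerivAt.eventually_left_inverse hf',
    hf.hasStrictDerivAt.eventually_right_inverse hf'⟩

theorem DifferentiableOn.analyticAt_strip {f : ℂ → ℂ} {δ : ℝ} (hf : DifferentiableOn ℂ f (horizStrip δ))
    {ζ : ℂ} (hζ : ζ ∈ horizStrip δ) : AnalyticAt ℂ f ζ :=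
  hf.analyticAt ((isOpen_horizStrip δ).mem_nhds hζ)

theorem Function.Periodic.apply_add_int {f : ℂ → ℂ} (hf : Function.Periodic f 1) (ζ : ℂ) (m : ℤ) :
    f (ζ + m) = f ζ := by
  simpa using hf.int_mul m ζ

theorem Function.Periodic.deriv_complex {f : ℂ → ℂ} (hf : Function.Periodic f 1) :
    Function.Periodic (deriv f) 1 := by
  intro x
  rw [← deriv_comp_add_const f 1 x]
  congr 1
  funext y
  exact hf y

/-- A neighborhood of the real line that is invariant under integer shifts contains a strip. -/
theorem eventually_horizStrip_subset {U : Set ℂ} (hU : IsOpen U) (hR : ∀ t : ℝ, (t : ℂ) ∈ U)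
    (hper : ∀ ζ : ℂ, ∀ m : ℤ, ζ + m ∈ U → ζ ∈ U) : ∀ᶠ δ in 𝓝[>] (0 : ℝ), horizStrip δ ⊆ U := by
  obtain ⟨ε, hε, h⟩ := ((isCompact_Icc (a := (0 : ℝ)) (b := 1)).image
    continuous_ofReal).exists_thickening_subset_open hU (by rintro _ ⟨t, -, rfl⟩; exact hR t)
  filter_upwards [Ioo_mem_nhdsGT hε] with δ hδ ζ hζ
  refine hper ζ (-⌊ζ.re⌋) (h ?_)
  rw [Metric.mem_thickening_iff]
  refine ⟨(Int.fract ζ.re : ℝ), ⟨_, ⟨Int.fract_nonneg _, (Int.fract_lt_one _).le⟩, rfl⟩, ?_⟩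
  rw [dist_eq_norm]
  have : ζ + ((-⌊ζ.re⌋ : ℤ) : ℂ) - (Int.fract ζ.re : ℝ) = ζ.im * I := by
    apply Complex.ext <;> simp
    rw [← Int.self_sub_floor]; ring
  rw [this, norm_mul, norm_I, mul_one, Complex.norm_real]
  exact lt_trans hζ hδ.2

theorem eventually_horizStrip_ne_zero {f : ℂ → ℂ} {δ₀ : ℝ} (hδ₀ : 0 < δ₀)
    (hf : DifferentiableOn ℂ f (horizStrip δ₀)) (hp : Function.Periodic f 1)
    (h0 : ∀ t : ℝ, f t ≠ 0) : ∀ᶠ δ in 𝓝[>] (0 : ℝ), ∀ ζ ∈ horizStrip δ, f ζ ≠ 0 := by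
  have := eventually_horizStrip_subset (U := horizStrip δ₀ ∩ f ⁻¹' {0}ᶜ)
    (hf.continuousOn.isOpen_inter_preimage (isOpen_horizStrip _) isOpen_compl_singleton)
    (fun t => ⟨ofReal_mem_horizStrip hδ₀ t, h0 t⟩)
    (fun ζ m h => by
      rw [mem_inter_iff, add_int_mem_horizStrip, mem_preimage, hp.apply_add_int] at h
      exact h)
  filter_upwards [this] with δ hδ ζ hζ using (hδ hζ).2

variable {n : ℕ}

/-- Tubular coordinates `Γ j` around the boundary curves: holomorphic extensions of the curves to a
strip, together with holomorphic extensions `σ j` of the speeds `|γ_j'|`. -/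
structure IsTube (Ω : Set ℂ) (γ : Fin n → ℝ → ℂ) (δ : ℝ) (Γ σ : Fin n → ℂ → ℂ) : Prop where
  dom : IsAnalyticDomain Ω γ
  pos : 0 < δ
  diff : ∀ j, DifferentiableOn ℂ (Γ j) (horizStrip δ)
  per : ∀ j, Function.Periodic (Γ j) 1
  apply_ofReal : ∀ j (t : ℝ), Γ j t = γ j t
  inj : ∀ j k, ∀ ζ ∈ horizStrip δ, ∀ ξ ∈ horizStrip δ, Γ j ζ = Γ k ξ → j = k ∧ ∃ m : ℤ, ξ = ζ + m
  deriv_ne : ∀ j, ∀ ζ ∈ horizStrip δ, deriv (Γ j) ζ ≠ 0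
  mem : ∀ j, ∀ ζ ∈ horizStrip δ, 0 < ζ.im → Γ j ζ ∈ Ω
  notMem : ∀ j, ∀ ζ ∈ horizStrip δ, ζ.im < 0 → Γ j ζ ∉ closure Ω
  speed_diff : ∀ j, DifferentiableOn ℂ (σ j) (horizStrip δ)
  speed_per : ∀ j, Function.Periodic (σ j) 1
  speed_ofReal : ∀ j (t : ℝ), σ j t = ‖deriv (γ j) t‖
  speed_ne : ∀ j, ∀ ζ ∈ horizStrip δ, σ j ζ ≠ 0

theorem IsTube.mono {Ω : Set ℂ} {γ : Fin n → ℝ → ℂ} {δ δ' : ℝ} {Γ σ : Fin n → ℂ → ℂ}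
    (h : IsTube Ω γ δ Γ σ) (h0 : 0 < δ') (hle : δ' ≤ δ) : IsTube Ω γ δ' Γ σ where
  dom := h.dom
  pos := h0
  diff j := (h.diff j).mono (horizStrip_mono hle)
  per := h.per
  apply_ofReal := h.apply_ofReal
  inj j k ζ hζ ξ hξ := h.inj j k ζ (horizStrip_mono hle hζ) ξ (horizStrip_mono hle hξ)
  deriv_ne j ζ hζ := h.deriv_ne j ζ (horizStrip_mono hle hζ)
  mem j ζ hζ := h.mem j ζ (horizStrip_mono hle hζ)
  notMem j ζ hζ := h.notMem j ζ (horizStrip_mono hle hζ)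
  speed_diff j := (h.speed_diff j).mono (horizStrip_mono hle)
  speed_per := h.speed_per
  speed_ofReal := h.speed_ofReal
  speed_ne j ζ hζ := h.speed_ne j ζ (horizStrip_mono hle hζ)

theorem deriv_eq_of_eq_ofReal {F : ℂ → ℂ} {f : ℝ → ℂ} (h : ∀ t : ℝ, F t = f t) {t : ℝ}
    (hF : DifferentiableAt ℂ F t) : deriv F t = deriv f t := by
  have h1 := hF.hasDerivAt.comp_ofReal
  have h2 : (fun t : ℝ => F t) = f := funext h
  rw [h2] at h1
  exact h1.deriv.symm

/-- Away from zeros the modulus is `exp (log (Re² + Im²) / 2)`, a composition of real analytic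
functions. This lets the speed of a curve be continued to a strip. -/
theorem AnalyticAt.deriv_norm_analytic {f : ℝ → ℂ} {t : ℝ} (hf : AnalyticAt ℝ f t)
    (h0 : f t ≠ 0) : AnalyticAt ℝ (fun s => ((‖f s‖ : ℝ) : ℂ)) t := by
  have hre : AnalyticAt ℝ (fun s => (f s).re) t := (reCLM.analyticAt _).comp hf
  have him : AnalyticAt ℝ (fun s => (f s).im) t := (imCLM.analyticAt _).comp hf
  have h1 : AnalyticAt ℝ (fun s => (f s).re ^ 2 + (f s).im ^ 2) t := (hre.pow 2).add (him.pow 2)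
  have hpos : 0 < (f t).re ^ 2 + (f t).im ^ 2 := by
    have := normSq_pos.2 h0
    rw [normSq_apply] at this
    nlinarith
  have h2 : AnalyticAt ℝ (fun s => Real.exp (Real.log ((f s).re ^ 2 + (f s).im ^ 2) / 2)) t :=
    (analyticAt_rexp).comp ((h1.log hpos).div_const)
  have h3 : (fun s => ((‖f s‖ : ℝ) : ℂ)) =ᶠ[𝓝 t]
      fun s => ((Real.exp (Real.log ((f s).re ^ 2 + (f s).im ^ 2) / 2) : ℝ) : ℂ) := by
    filter_upwards [hf.continuousAt.eventually_ne h0] with s hs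
    have hpos : 0 < ‖f s‖ := norm_pos_iff.2 hs
    have : (f s).re ^ 2 + (f s).im ^ 2 = ‖f s‖ ^ 2 := by
      rw [Complex.sq_norm, normSq_apply]; ring
    rw [this, Real.log_pow]
    push_cast
    rw [mul_div_cancel_left₀ _ (two_ne_zero), ← ofReal_exp, Real.exp_log hpos]
  exact ((ofRealCLM.analyticAt _).comp h2).congr h3.symm

/-- `Ω` and the complement of its closure are disjoint open sets covering everything off the
frontier. This decides on which side of the boundary each half of a tube lies. -/
theorem IsPreconnected.subset_of_disjoint_frontier {S Ω : Set ℂ} (hS : IsPreconnected S)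
    (hΩ : IsOpen Ω) (hd : ∀ z ∈ S, z ∉ frontier Ω) : S ⊆ Ω ∨ S ⊆ (closure Ω)ᶜ := by
  refine isPreconnected_iff_subset_of_disjoint.1 hS Ω (closure Ω)ᶜ hΩ isClosed_closure.isOpen_compl
    ?_ ?_
  · intro z hz
    by_cases h : z ∈ closure Ω
    · left
      by_contra h'
      exact hd z hz ⟨h, by rwa [hΩ.interior_eq]⟩
    · exact Or.inr h
  · ext z
    simp only [mem_inter_iff, mem_compl_iff, mem_empty_iff_false, iff_false, not_and, not_not]
    exact fun _ h => subset_closure h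

/-- The nonvanishing and injectivity conditions hold on the real axis, are open and are invariant
under integer shifts, so compactness of one period yields them on a thin strip. The upper and lower
half strips are connected and their images miss the boundary, so their sides are determined by a
single point each, supplied by the normals to the curve. -/
theorem exists_tube {Ω : Set ℂ} {γ : Fin n → ℝ → ℂ} (hΩ : IsAnalyticDomain Ω γ) :
    ∃ δ Γ σ, IsTube Ω γ δ Γ σ := by
  choose δ₁ hδ₁ Γ hΓ hΓp hΓr using fun j =>
    exists_strip_extension (hΩ.analytic j) (hΩ.periodic j)
  have hder_per : ∀ j, Function.Periodic (deriv (γ j)) 1 := by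
    intro j x
    rw [← deriv_comp_add_const (γ j) 1 x]
    congr 1
    funext y
    exact hΩ.periodic j y
  choose δ₂ hδ₂ σ hσ hσp hσr using fun j =>
    exists_strip_extension (f := fun t => ((‖deriv (γ j) t‖ : ℝ) : ℂ))
      (fun t => ((hΩ.analytic j t).deriv).deriv_norm_analytic (hΩ.deriv_ne_zero j t))
      (fun t => by simp only [hder_per j t])
  have hderiv : ∀ j (t : ℝ), deriv (Γ j) t = deriv (γ j) t := fun j t =>
    deriv_eq_of_eq_ofReal (hΓr j) ((hΓ j).differentiableAt
      ((isOpen_horizStrip _).mem_nhds (ofReal_mem_horizStrip (hδ₁ j) t)))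
  have hderiv0 : ∀ j (t : ℝ), deriv (Γ j) t ≠ 0 := fun j t => by
    rw [hderiv]; exact hΩ.deriv_ne_zero j t
  have hΓa : ∀ j (t : ℝ), AnalyticAt ℂ (Γ j) t := fun j t =>
    (hΓ j).analyticAt_strip (ofReal_mem_horizStrip (hδ₁ j) t)
  have E1 : ∀ᶠ δ in 𝓝[>] (0 : ℝ), ∀ j, δ ≤ δ₁ j := eventually_all.2 fun j => by
    filter_upwards [Ioo_mem_nhdsGT (hδ₁ j)] with δ h using h.2.le
  have E2 : ∀ᶠ δ in 𝓝[>] (0 : ℝ), ∀ j, δ ≤ δ₂ j := eventually_all.2 fun j => by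
    filter_upwards [Ioo_mem_nhdsGT (hδ₂ j)] with δ h using h.2.le
  have E3 : ∀ᶠ δ in 𝓝[>] (0 : ℝ), ∀ j, ∀ ζ ∈ horizStrip δ, deriv (Γ j) ζ ≠ 0 :=
    eventually_all.2 fun j => eventually_horizStrip_ne_zero (hδ₁ j)
      ((hΓ j).deriv (isOpen_horizStrip _)) (hΓp j).deriv_complex (hderiv0 j)
  have E4 : ∀ᶠ δ in 𝓝[>] (0 : ℝ), ∀ j, ∀ ζ ∈ horizStrip δ, σ j ζ ≠ 0 :=
    eventually_all.2 fun j => eventually_horizStrip_ne_zero (hδ₂ j) (hσ j) (hσp j) fun t => by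
      rw [hσr]; simpa using hΩ.deriv_ne_zero j t
  have E5 : ∀ᶠ δ in 𝓝[>] (0 : ℝ), ∀ j k, ∀ ζ ∈ horizStrip δ, ∀ ξ ∈ horizStrip δ,
      Γ j ζ = Γ k ξ → j = k ∧ ∃ m : ℤ, ξ = ζ + m := by
    refine eventually_all.2 fun j => eventually_all.2 fun k => ?_
    -- `W` is the open set of pairs near which injectivity modulo integers holds. A pair of real
    -- parameters with equal values is in it by a local inverse, any other real pair by continuity.
    set W : Set (ℂ × ℂ) := {p | ∀ᶠ q : ℂ × ℂ in 𝓝 p, Γ j q.1 = Γ k q.2 → j = k ∧ ∃ m : ℤ, q.2 = q.1 + m}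
    have hW : IsOpen W := isOpen_setOfPred_eventually_nhds
    have hloc : ∀ s t : ℝ, ((s : ℂ), (t : ℂ)) ∈ W := by
      intro s t
      have hcont : ContinuousAt (fun q : ℂ × ℂ => (Γ j q.1, Γ k q.2)) ((s : ℂ), (t : ℂ)) := by
        refine ContinuousAt.prodMk ?_ ?_
        · exact ContinuousAt.comp (f := Prod.fst) (x := ((s : ℂ), (t : ℂ)))
            (hΓa j s).continuousAt continuousAt_fst
        · exact ContinuousAt.comp (f := Prod.snd) (x := ((s : ℂ), (t : ℂ)))
            (hΓa k t).continuousAt continuousAt_snd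
      by_cases hst : γ j s = γ k t
      · have hfr : ∀ l u, γ l (Int.fract u) = γ l u := by
          intro l u
          have h := (hΩ.periodic l).sub_int_mul_eq (x := u) ⌊u⌋
          rwa [mul_one] at h
        obtain ⟨rfl, hf⟩ := hΩ.simple_disjoint j k (Int.fract s)
          ⟨Int.fract_nonneg s, Int.fract_lt_one s⟩ (Int.fract t)
          ⟨Int.fract_nonneg t, Int.fract_lt_one t⟩ (by rw [hfr, hfr, hst])
        obtain ⟨m, hm⟩ := Int.fract_eq_fract.1 hf.symm
        obtain ⟨ψ, -, -, -, hψ, -⟩ := (hΓa j s).exists_analytic_inverse (hderiv0 j s)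
        have h1 : ∀ᶠ q : ℂ × ℂ in 𝓝 ((s : ℂ), (t : ℂ)), ψ (Γ j q.1) = q.1 :=
          (continuousAt_fst (p := ((s : ℂ), (t : ℂ)))).eventually hψ
        have h2 : Tendsto (fun q : ℂ × ℂ => q.2 - m) (𝓝 ((s : ℂ), (t : ℂ))) (𝓝 (s : ℂ)) := by
          have : (s : ℂ) = (t : ℂ) - m := by
            have : s = t - m := by linarith
            rw [this]; push_cast; ring
          rw [this]
          exact (continuous_snd.sub continuous_const).continuousAt
        have h3 : ∀ᶠ q : ℂ × ℂ in 𝓝 ((s : ℂ), (t : ℂ)), ψ (Γ j (q.2 - m)) = q.2 - m :=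
          h2.eventually hψ
        filter_upwards [h1, h3] with q hq1 hq3 heq
        refine ⟨rfl, m, ?_⟩
        have : Γ j (q.2 - m) = Γ j q.2 := by
          rw [← (hΓp j).apply_add_int (q.2 - m) m, sub_add_cancel]
        rw [this, ← heq, hq1] at hq3
        rw [hq3]; ring
      · have hne : ((Γ j (s : ℂ), Γ k (t : ℂ)) : ℂ × ℂ) ∈ {p : ℂ × ℂ | p.1 ≠ p.2} := by
          simpa [hΓr] using hst
        have hop : IsOpen {p : ℂ × ℂ | p.1 ≠ p.2} := isOpen_ne_fun continuous_fst continuous_snd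
        filter_upwards [hcont.eventually (hop.mem_nhds hne)] with q hq h
        exact absurd h hq
    have hK : IsCompact ((fun t : ℝ => (t : ℂ)) '' Icc (0 : ℝ) 1) :=
      isCompact_Icc.image continuous_ofReal
    obtain ⟨ε, hε, hth⟩ := (hK.prod hK).exists_thickening_subset_open hW (by
      rintro ⟨_, _⟩ ⟨⟨s, -, rfl⟩, ⟨t, -, rfl⟩⟩; exact hloc s t)
    filter_upwards [Ioo_mem_nhdsGT hε] with δ hδ ζ hζ ξ hξ heq
    have hfr : ∀ w : ℂ, w ∈ horizStrip δ →
        dist (w - ⌊w.re⌋) ((Int.fract w.re : ℝ) : ℂ) < ε := by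
      intro w hw
      rw [dist_eq_norm]
      have : w - ⌊w.re⌋ - (Int.fract w.re : ℝ) = w.im * I := by
        apply Complex.ext <;> simp
      rw [this, norm_mul, norm_I, mul_one, Complex.norm_real]
      exact lt_trans hw hδ.2
    have hmem : ((ζ - ⌊ζ.re⌋, ξ - ⌊ξ.re⌋) : ℂ × ℂ) ∈ W := by
      refine hth (Metric.mem_thickening_iff.2 ⟨(((Int.fract ζ.re : ℝ) : ℂ),
        ((Int.fract ξ.re : ℝ) : ℂ)), ⟨⟨_, ⟨Int.fract_nonneg _, (Int.fract_lt_one _).le⟩, rfl⟩,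
        ⟨_, ⟨Int.fract_nonneg _, (Int.fract_lt_one _).le⟩, rfl⟩⟩, ?_⟩)
      rw [Prod.dist_eq]
      exact max_lt (hfr ζ hζ) (hfr ξ hξ)
    have e1 : ∀ l (w : ℂ) (m : ℤ), Γ l (w - m) = Γ l w := fun l w m => by
      rw [← (hΓp l).apply_add_int (w - m) m, sub_add_cancel]
    obtain ⟨hjk, m, hm⟩ := (show ∀ᶠ q in 𝓝 _, _ from hmem).self_of_nhds (by simp only [e1, heq])
    refine ⟨hjk, m - ⌊ζ.re⌋ + ⌊ξ.re⌋, ?_⟩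
    simp only at hm
    push_cast
    linear_combination hm
  obtain ⟨δ, ⟨⟨⟨⟨e1, e2⟩, e3⟩, e4⟩, e5⟩, hδ⟩ :=
    ((((E1.and E2).and E3).and E4).and E5 |>.and self_mem_nhdsWithin).exists
  have hδ : 0 < δ := hδ
  have hsmall : ∀ j, DifferentiableOn ℂ (Γ j) (horizStrip δ) := fun j =>
    (hΓ j).mono (horizStrip_mono (e1 j))
  have hfront : ∀ j, ∀ ζ ∈ horizStrip δ, ζ.im ≠ 0 → Γ j ζ ∉ frontier Ω := by
    intro j ζ hζ him hmem
    rw [hΩ.frontier_eq] at hmem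
    obtain ⟨k, t, ht⟩ := mem_iUnion.1 hmem
    rw [← hΓr] at ht
    obtain ⟨-, m, hm⟩ := e5 k j t (ofReal_mem_horizStrip hδ t) ζ hζ ht
    apply him
    rw [hm]; simp
  have hside : ∀ j, ∃ ζ ∈ horizStrip δ, 0 < ζ.im ∧
      Γ j ζ ∈ Ω ∧ ∃ ξ ∈ horizStrip δ, ξ.im < 0 ∧ Γ j ξ ∉ closure Ω := by
    intro j
    obtain ⟨ψ, hψa, hψ0, hψd, -, hψ⟩ := (hΓa j (0 : ℝ)).exists_analytic_inverse (hderiv0 j 0)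
    set c := deriv (γ j) 0 with hc
    have hc0 : c ≠ 0 := hΩ.deriv_ne_zero j 0
    -- In the coordinate of the strip the normal ray `γ 0 + ε s i γ' 0` leaves the origin with
    -- velocity `s i`. Thus `s = 1` leads into the upper half and `s = -1` into the lower half.
    have hcurve : ∀ s : ℝ, HasDerivAt (fun ε : ℝ => ψ (Γ j ((0 : ℝ) : ℂ) + ε * (s * (I * c)))) (s * I) 0 := by
      intro s
      have h1 : HasDerivAt (fun ε : ℝ => Γ j ((0 : ℝ) : ℂ) + ε * (s * (I * c))) (s * (I * c)) 0 := by
        simpa using ((ofRealCLM.hasDerivAt (x := (0 : ℝ))).mul_const (s * (I * c))).const_add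
          (Γ j ((0 : ℝ) : ℂ))
      have h2 : HasDerivAt ψ ((deriv (Γ j) ((0 : ℝ) : ℂ))⁻¹)
          (Γ j ((0 : ℝ) : ℂ) + ((0 : ℝ) : ℂ) * (s * (I * c))) := by
        rw [ofReal_zero, zero_mul, add_zero, ← ofReal_zero, ← hψd]
        exact hψa.differentiableAt.hasDerivAt
      have h3 := HasDerivAt.comp (0 : ℝ) h2 h1
      refine h3.congr_deriv ?_
      rw [hderiv, ← hc]
      field_simp
    have him : ∀ s : ℝ, s ≠ 0 → ∀ᶠ ε : ℝ in 𝓝[>] 0,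
        0 < s * (ψ (Γ j ((0 : ℝ) : ℂ) + ε * (s * (I * c)))).im := by
      intro s hs
      have h1 : HasDerivAt (fun ε : ℝ => s * (ψ (Γ j ((0 : ℝ) : ℂ) + ε * (s * (I * c)))).im) (s * s) 0 := by
        have := (imCLM.hasFDerivAt.comp_hasDerivAt (0 : ℝ) (hcurve s)).const_mul s
        simpa using this
      have h2 := hasDerivAt_iff_tendsto_slope.1 h1
      have h3 : ∀ᶠ ε in 𝓝[≠] (0 : ℝ), 0 < slope (fun ε : ℝ =>
          s * (ψ (Γ j ((0 : ℝ) : ℂ) + ε * (s * (I * c)))).im) 0 ε :=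
        h2.eventually_const_lt (mul_self_pos.2 hs)
      have h4 : 𝓝[>] (0 : ℝ) ≤ 𝓝[≠] 0 := nhdsWithin_mono _ fun x hx => ne_of_gt hx
      filter_upwards [h4 h3, self_mem_nhdsWithin] with ε hε hpos
      rw [slope_def_field] at hε
      have h5 : (ψ (Γ j ((0 : ℝ) : ℂ) + ((0 : ℝ) : ℂ) * (s * (I * c)))).im = 0 := by
        rw [ofReal_zero, zero_mul, add_zero, ← ofReal_zero, hψ0]; simp
      rw [h5, mul_zero, sub_zero, sub_zero] at hε
      exact (div_pos_iff_of_pos_right hpos).1 hε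
    have hnear : ∀ s : ℝ, ∀ᶠ ε : ℝ in 𝓝[>] 0,
        ψ (Γ j ((0 : ℝ) : ℂ) + ε * (s * (I * c))) ∈ horizStrip δ ∧
        Γ j (ψ (Γ j ((0 : ℝ) : ℂ) + ε * (s * (I * c)))) = Γ j ((0 : ℝ) : ℂ) + ε * (s * (I * c)) := by
      intro s
      have h1 := (hcurve s).continuousAt.eventually
        ((isOpen_horizStrip δ).mem_nhds (by
          beta_reduce
          rw [ofReal_zero, zero_mul, add_zero, ← ofReal_zero, hψ0]
          exact ofReal_mem_horizStrip hδ 0))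
      have h2 : Tendsto (fun ε : ℝ => Γ j ((0 : ℝ) : ℂ) + ε * (s * (I * c))) (𝓝 0)
          (𝓝 (Γ j ((0 : ℝ) : ℂ))) := by
        have : Continuous (fun ε : ℝ => Γ j ((0 : ℝ) : ℂ) + ε * (s * (I * c))) := by fun_prop
        simpa using this.tendsto 0
      exact nhdsWithin_le_nhds (h1.and (h2.eventually hψ))
    have hL := hΩ.left_mem j 0
    have hR := hΩ.right_notMem j 0
    obtain ⟨ε, ⟨⟨hl, him1⟩, hn1⟩, hεpos⟩ :=
      (((hL.and (him 1 one_ne_zero)).and (hnear 1)).and self_mem_nhdsWithin).exists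
    obtain ⟨ε', ⟨⟨hr, him2⟩, hn2⟩, hεpos'⟩ :=
      (((hR.and (him (-1) (by norm_num))).and (hnear (-1))).and self_mem_nhdsWithin).exists
    refine ⟨_, hn1.1, by simpa using him1, ?_, _, hn2.1, by linarith, ?_⟩
    · rw [hn1.2, hΓr]; simpa using hl
    · rw [hn2.2, hΓr]; simpa [sub_eq_add_neg] using hr
  have hup : IsPreconnected {ζ : ℂ | ζ ∈ horizStrip δ ∧ 0 < ζ.im} := by
    refine Convex.isPreconnected ?_
    exact (convex_horizStrip δ).inter (convex_halfSpace_im_gt 0)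
  have hdown : IsPreconnected {ζ : ℂ | ζ ∈ horizStrip δ ∧ ζ.im < 0} := by
    refine Convex.isPreconnected ?_
    exact (convex_horizStrip δ).inter (convex_halfSpace_im_lt 0)
  refine ⟨δ, Γ, σ, hΩ, hδ, hsmall, hΓp, hΓr, e5, e3, ?_, ?_, fun j =>
    (hσ j).mono (horizStrip_mono (e2 j)), hσp, hσr, e4⟩
  · intro j ζ hζ him
    obtain ⟨w, hw, hw', hwΩ, -⟩ := hside j
    rcases (hup.image (Γ j) ((hsmall j).continuousOn.mono fun _ h => h.1)).subset_of_disjoint_frontier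
      hΩ.isOpen (by rintro _ ⟨z, hz, rfl⟩; exact hfront j z hz.1 hz.2.ne') with h | h
    · exact h ⟨ζ, ⟨hζ, him⟩, rfl⟩
    · exact absurd (subset_closure hwΩ) (h ⟨w, ⟨hw, hw'⟩, rfl⟩)
  · intro j ζ hζ him
    obtain ⟨-, -, -, -, w, hw, hw', hwΩ⟩ := hside j
    rcases (hdown.image (Γ j) ((hsmall j).continuousOn.mono fun _ h => h.1)).subset_of_disjoint_frontier
      hΩ.isOpen (by rintro _ ⟨z, hz, rfl⟩; exact hfront j z hz.1 hz.2.ne) with h | h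
    · exact absurd (subset_closure (h ⟨w, ⟨hw, hw'⟩, rfl⟩)) hwΩ
    · exact h ⟨ζ, ⟨hζ, him⟩, rfl⟩

/-! ### Cauchy integrals along the displaced boundary curves. -/

theorem tendsto_integral_div_sub_cocompact {g c : ℝ → ℂ} (hg : Continuous g) (hc : Continuous c) :
    Tendsto (fun z => ∫ t in (0 : ℝ)..1, g t / (c t - z)) (cocompact ℂ) (𝓝 0) := by
  obtain ⟨C, hC⟩ := (isCompact_Icc (a := (0 : ℝ)) (b := 1)).exists_bound_of_continuousOn
    hg.continuousOn
  obtain ⟨R, hR⟩ := (isCompact_Icc (a := (0 : ℝ)) (b := 1)).exists_bound_of_continuousOn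
    hc.continuousOn
  have h1 : Tendsto (fun z : ℂ => C / (‖z‖ - R)) (cocompact ℂ) (𝓝 0) :=
    tendsto_const_nhds.div_atTop (tendsto_atTop_add_const_right _ (-R) tendsto_norm_cocompact_atTop)
  refine squeeze_zero_norm' ?_ h1
  filter_upwards [tendsto_norm_cocompact_atTop.eventually_gt_atTop R] with z hz
  have := intervalIntegral.norm_integral_le_of_norm_le_const (a := (0 : ℝ)) (b := 1)
    (f := fun t => g t / (c t - z)) (C := C / (‖z‖ - R)) ?_
  · simpa using this
  · intro t ht
    rw [uIoc_of_le zero_le_one] at ht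
    have ht' : t ∈ Icc (0 : ℝ) 1 := ⟨ht.1.le, ht.2⟩
    rw [norm_div]
    have h2 : ‖z‖ - R ≤ ‖c t - z‖ := by
      have := norm_sub_norm_le z (c t)
      rw [norm_sub_rev] at this
      linarith [hR t ht']
    have h3 : 0 ≤ C := (norm_nonneg _).trans (hC t ht')
    have h4 : 0 < ‖z‖ - R := by linarith
    gcongr
    exact hC t ht'

variable {Ω : Set ℂ} {γ : Fin n → ℝ → ℂ} {δ : ℝ} {Γ σ : Fin n → ℂ → ℂ}

/-- The contour integral `∫ M dw` along the curves `Γ j (· + i y)`. -/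
noncomputable def heightIntegral (Γ : Fin n → ℂ → ℂ) (y : ℝ) (M : ℂ → ℂ) : ℂ :=
  ∑ j, ∫ t in (0 : ℝ)..1, M (Γ j (t + y * I)) * deriv (Γ j) (t + y * I)

/-- The Cauchy transform along the curves `Γ j (· + i y)`. -/
noncomputable def cauchyT (Γ : Fin n → ℂ → ℂ) (y : ℝ) (h : ℂ → ℂ) (z : ℂ) : ℂ :=
  (2 * Real.pi * I)⁻¹ * heightIntegral Γ y (fun w => h w / (w - z))

/-- The union of the images of the strip `|Im ζ| < η` under the maps `Γ j`. -/
def tube (Γ : Fin n → ℂ → ℂ) (η : ℝ) : Set ℂ := {z | ∃ j, ∃ ζ ∈ horizStrip η, Γ j ζ = z}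

/-- The union of the images of the closed strip `a ≤ Im ζ ≤ b` under the maps `Γ j`. -/
def slab (Γ : Fin n → ℂ → ℂ) (a b : ℝ) : Set ℂ := {z | ∃ j ζ, a ≤ ζ.im ∧ ζ.im ≤ b ∧ Γ j ζ = z}

theorem mem_horizStrip {δ : ℝ} {ζ : ℂ} : ζ ∈ horizStrip δ ↔ -δ < ζ.im ∧ ζ.im < δ :=
  abs_lt (a := ζ.im) (b := δ)

theorem two_pi_I_ne : (2 * Real.pi * I : ℂ) ≠ 0 := two_pi_I_ne_zero

theorem line_mem_horizStrip {y δ : ℝ} (hy : |y| < δ) (t : ℝ) : (t : ℂ) + y * I ∈ horizStrip δ := by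
  simpa [horizStrip] using hy

theorem tube_mono {η η' : ℝ} (h : η ≤ η') : tube Γ η ⊆ tube Γ η' := by
  rintro z ⟨j, ζ, hζ, rfl⟩
  exact ⟨j, ζ, horizStrip_mono h hζ, rfl⟩

namespace IsTube

theorem analyticAt (hT : IsTube Ω γ δ Γ σ) (j : Fin n) {ζ : ℂ} (hζ : ζ ∈ horizStrip δ) :
    AnalyticAt ℂ (Γ j) ζ := (hT.diff j).analyticAt_strip hζ

theorem diff_deriv (hT : IsTube Ω γ δ Γ σ) (j : Fin n) :
    DifferentiableOn ℂ (deriv (Γ j)) (horizStrip δ) := (hT.diff j).deriv (isOpen_horizStrip δ)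

theorem continuous_line {f : ℂ → ℂ} {y : ℝ} (hy : |y| < δ) (hf : ContinuousOn f (horizStrip δ)) :
    Continuous fun t : ℝ => f (t + y * I) :=
  hf.comp_continuous (by fun_prop) (line_mem_horizStrip hy)

theorem isOpen_tube (hT : IsTube Ω γ δ Γ σ) {η : ℝ} (hη : η ≤ δ) : IsOpen (tube Γ η) := by
  rw [isOpen_iff_mem_nhds]
  rintro z ⟨j, ζ, hζ, rfl⟩
  have h1 := hT.analyticAt j (horizStrip_mono hη hζ)
  rw [← h1.hasStrictDerivAt.map_nhds_eq (hT.deriv_ne j ζ (horizStrip_mono hη hζ))]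
  refine mem_of_superset (image_mem_map ((isOpen_horizStrip η).mem_nhds hζ)) ?_
  rintro _ ⟨ξ, hξ, rfl⟩
  exact ⟨j, ξ, hξ, rfl⟩

theorem apply_add_int (hT : IsTube Ω γ δ Γ σ) (j : Fin n) (ζ : ℂ) (m : ℤ) :
    Γ j (ζ + m) = Γ j ζ := (hT.per j).apply_add_int ζ m

theorem isCompact_slab (hT : IsTube Ω γ δ Γ σ) {a b : ℝ} (ha : -δ < a) (hb : b < δ) :
    IsCompact (slab Γ a b) := by
  have h : slab Γ a b = ⋃ j, Γ j '' (Icc (0 : ℝ) 1 ×ℂ Icc a b) := by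
    ext z
    simp only [slab, mem_ofPred_eq, mem_iUnion, mem_image]
    refine exists_congr fun j => ⟨?_, ?_⟩
    · rintro ⟨ζ, h1, h2, rfl⟩
      refine ⟨ζ + (-⌊ζ.re⌋ : ℤ), ⟨?_, ?_⟩, hT.apply_add_int _ _ _⟩
      · simpa [← sub_eq_add_neg] using
          And.intro (Int.fract_nonneg ζ.re) (Int.fract_lt_one ζ.re).le
      · simpa using And.intro h1 h2
    · rintro ⟨ζ, h1, rfl⟩
      exact ⟨ζ, h1.2.1, h1.2.2, rfl⟩
  rw [h]
  refine isCompact_iUnion fun j => (isCompact_Icc.reProdIm isCompact_Icc).image_of_continuousOn ?_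
  refine (hT.diff j).continuousOn.mono fun ζ hζ => mem_horizStrip.2 ⟨?_, ?_⟩
  · exact ha.trans_le hζ.2.1
  · exact hζ.2.2.trans_lt hb

theorem mem_frontier_iff (hT : IsTube Ω γ δ Γ σ) {z : ℂ} :
    z ∈ frontier Ω ↔ ∃ j, ∃ t : ℝ, Γ j t = z := by
  rw [hT.dom.frontier_eq]
  simp [hT.apply_ofReal]

theorem apply_mem_frontier (hT : IsTube Ω γ δ Γ σ) (j : Fin n) (t : ℝ) : Γ j t ∈ frontier Ω :=
  hT.mem_frontier_iff.2 ⟨j, t, rfl⟩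

theorem apply_mem_iff (hT : IsTube Ω γ δ Γ σ) (j : Fin n) {ζ : ℂ} (hζ : ζ ∈ horizStrip δ) :
    Γ j ζ ∈ Ω ↔ 0 < ζ.im := by
  refine ⟨fun h => ?_, hT.mem j ζ hζ⟩
  rcases lt_trichotomy ζ.im 0 with h1 | h1 | h1
  · exact absurd (subset_closure h) (hT.notMem j ζ hζ h1)
  · have h2 : ζ = (ζ.re : ℂ) := by apply Complex.ext <;> simp [h1]
    have h3 := hT.apply_mem_frontier j ζ.re
    rw [← h2, frontier, hT.dom.isOpen.interior_eq] at h3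
    exact absurd h h3.2
  · exact h1

theorem apply_mem_closure_iff (hT : IsTube Ω γ δ Γ σ) (j : Fin n) {ζ : ℂ} (hζ : ζ ∈ horizStrip δ) :
    Γ j ζ ∈ closure Ω ↔ 0 ≤ ζ.im := by
  refine ⟨fun h => not_lt.1 fun h1 => hT.notMem j ζ hζ h1 h, fun h => ?_⟩
  rcases h.eq_or_lt with h1 | h1
  · have h2 : ζ = (ζ.re : ℂ) := by apply Complex.ext <;> simp [← h1]
    rw [h2]
    exact frontier_subset_closure (hT.apply_mem_frontier j ζ.re)
  · exact subset_closure (hT.mem j ζ hζ h1)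

theorem mem_cases (hT : IsTube Ω γ δ Γ σ) (z : ℂ) : z ∈ Ω ∨ z ∈ frontier Ω ∨ z ∉ closure Ω := by
  by_cases h : z ∈ Ω
  · exact Or.inl h
  · by_cases h' : z ∈ closure Ω
    · exact Or.inr (Or.inl ⟨h', by rwa [hT.dom.isOpen.interior_eq]⟩)
    · exact Or.inr (Or.inr h')

theorem frontier_subset_tube (hT : IsTube Ω γ δ Γ σ) {η : ℝ} (hη : 0 < η) :
    frontier Ω ⊆ tube Γ η := by
  intro z hz
  obtain ⟨j, t, rfl⟩ := hT.mem_frontier_iff.1 hz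
  exact ⟨j, t, ofReal_mem_horizStrip hη t, rfl⟩

theorem hasDerivAt_heightIntegral (hT : IsTube Ω γ δ Γ σ) {y : ℝ} (hy : |y| < δ) {g : ℂ → ℂ}
    (hg : ∀ j, Continuous fun t : ℝ => g (Γ j (t + y * I))) {a : ℂ}
    (ha : ∀ j (t : ℝ), Γ j (t + y * I) ≠ a) (m : ℕ) :
    HasDerivAt (fun a => heightIntegral Γ y (fun w => g w / (w - a) ^ (m + 1)))
      ((m + 1) * heightIntegral Γ y (fun w => g w / (w - a) ^ (m + 2))) a := by
  unfold heightIntegral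
  rw [Finset.mul_sum]
  refine HasDerivAt.fun_sum fun j _ => ?_
  have h := hasDerivAt_integral_div_sub_pow
    ((hg j).mul (continuous_line hy (hT.diff_deriv j).continuousOn))
    (continuous_line hy (hT.diff j).continuousOn) (a := a) (fun t _ => ha j t) m
  simp only [div_mul_eq_mul_div]
  exact h

theorem differentiableAt_cauchyT (hT : IsTube Ω γ δ Γ σ) {y : ℝ} (hy : |y| < δ) {g : ℂ → ℂ}
    (hg : ∀ j, Continuous fun t : ℝ => g (Γ j (t + y * I))) {a : ℂ}
    (ha : ∀ j (t : ℝ), Γ j (t + y * I) ≠ a) : DifferentiableAt ℂ (cauchyT Γ y g) a := by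
  have := (hT.hasDerivAt_heightIntegral hy hg ha 0).differentiableAt
  simp only [zero_add, pow_one] at this
  exact this.const_mul _

theorem tendsto_cauchyT (hT : IsTube Ω γ δ Γ σ) {y : ℝ} (hy : |y| < δ) {g : ℂ → ℂ}
    (hg : ∀ j, Continuous fun t : ℝ => g (Γ j (t + y * I))) :
    Tendsto (cauchyT Γ y g) (cocompact ℂ) (𝓝 0) := by
  have h : Tendsto (fun z => heightIntegral Γ y (fun w => g w / (w - z))) (cocompact ℂ) (𝓝 0) := by
    unfold heightIntegral
    have h0 : (0 : ℂ) = ∑ _j : Fin n, (0 : ℂ) := by simp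
    rw [show 𝓝 (0 : ℂ) = 𝓝 (∑ _j : Fin n, (0 : ℂ)) by rw [← h0]]
    refine tendsto_finsetSum _ fun j _ => ?_
    have h := tendsto_integral_div_sub_cocompact
      ((hg j).mul (continuous_line hy (hT.diff_deriv j).continuousOn))
      (continuous_line hy (hT.diff j).continuousOn)
    simp only [div_mul_eq_mul_div]
    exact h
  have h2 := h.const_mul (2 * Real.pi * I : ℂ)⁻¹
  rwa [mul_zero] at h2

theorem strip_subset {y₁ y₂ : ℝ} (h₁ : -δ < y₁) (h₂ : y₂ < δ) :
    {ξ : ℂ | y₁ ≤ ξ.im ∧ ξ.im ≤ y₂} ⊆ horizStrip δ :=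
  fun _ hξ => mem_horizStrip.2 ⟨h₁.trans_le hξ.1, hξ.2.trans_lt h₂⟩

theorem open_strip_subset {y₁ y₂ : ℝ} (h₁ : -δ < y₁) (h₂ : y₂ < δ) :
    {ξ : ℂ | y₁ < ξ.im ∧ ξ.im < y₂} ⊆ horizStrip δ :=
  fun _ hξ => mem_horizStrip.2 ⟨h₁.trans hξ.1, hξ.2.trans h₂⟩

theorem curve_integral_shift (hT : IsTube Ω γ δ Γ σ) {y₁ y₂ : ℝ} (h₁ : -δ < y₁) (h : y₁ ≤ y₂)
    (h₂ : y₂ < δ) {M : ℂ → ℂ} (j : Fin n)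
    (hc : ContinuousOn (fun ξ => M (Γ j ξ)) {ξ | y₁ ≤ ξ.im ∧ ξ.im ≤ y₂})
    (hd : DifferentiableOn ℂ (fun ξ => M (Γ j ξ)) {ξ | y₁ < ξ.im ∧ ξ.im < y₂}) :
    ∫ t in (0 : ℝ)..1, M (Γ j (t + y₁ * I)) * deriv (Γ j) (t + y₁ * I) =
      ∫ t in (0 : ℝ)..1, M (Γ j (t + y₂ * I)) * deriv (Γ j) (t + y₂ * I) := by
  refine periodic_integral_eq_of_strip (ψ := fun ξ => M (Γ j ξ) * deriv (Γ j) ξ) h ?_ ?_ ?_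
  · intro ξ
    simp only [hT.per j ξ, (hT.per j).deriv_complex ξ]
  · exact hc.mul ((hT.diff_deriv j).continuousOn.mono (strip_subset h₁ h₂))
  · exact hd.mul ((hT.diff_deriv j).mono (open_strip_subset h₁ h₂))

theorem heightIntegral_shift (hT : IsTube Ω γ δ Γ σ) {y₁ y₂ : ℝ} (h₁ : -δ < y₁) (h : y₁ ≤ y₂)
    (h₂ : y₂ < δ) {M : ℂ → ℂ}
    (hc : ∀ j, ContinuousOn (fun ξ => M (Γ j ξ)) {ξ | y₁ ≤ ξ.im ∧ ξ.im ≤ y₂})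
    (hd : ∀ j, DifferentiableOn ℂ (fun ξ => M (Γ j ξ)) {ξ | y₁ < ξ.im ∧ ξ.im < y₂}) :
    heightIntegral Γ y₁ M = heightIntegral Γ y₂ M :=
  Finset.sum_congr rfl fun j _ => hT.curve_integral_shift h₁ h h₂ j (hc j) (hd j)

/-- The integrand has a simple pole at `ζ` with residue `h (Γ k ζ)`. Injectivity modulo integers
excludes any other zero of the denominator within half a period of `ζ`, so dividing by the
difference quotient of `Γ k` is harmless there. -/
theorem curve_integral_jump (hT : IsTube Ω γ δ Γ σ) {y₁ y₂ : ℝ} (h₁ : -δ < y₁) (h₂ : y₂ < δ)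
    {h : ℂ → ℂ} (k : Fin n) {ζ : ℂ} (hζ₁ : y₁ < ζ.im) (hζ₂ : ζ.im < y₂)
    (hc : ContinuousOn (fun ξ => h (Γ k ξ)) {ξ | y₁ ≤ ξ.im ∧ ξ.im ≤ y₂})
    (hd : DifferentiableOn ℂ (fun ξ => h (Γ k ξ)) {ξ | y₁ < ξ.im ∧ ξ.im < y₂}) :
    (∫ t in (0 : ℝ)..1, h (Γ k (t + y₁ * I)) / (Γ k (t + y₁ * I) - Γ k ζ) * deriv (Γ k) (t + y₁ * I)) -
      ∫ t in (0 : ℝ)..1, h (Γ k (t + y₂ * I)) / (Γ k (t + y₂ * I) - Γ k ζ) *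
        deriv (Γ k) (t + y₂ * I) = 2 * Real.pi * I * h (Γ k ζ) := by
  have hζ : ζ ∈ horizStrip δ := open_strip_subset h₁ h₂ ⟨hζ₁, hζ₂⟩
  have hds : DifferentiableOn ℂ (dslope (Γ k) ζ) (horizStrip δ) :=
    (Complex.differentiableOn_dslope ((isOpen_horizStrip δ).mem_nhds hζ)).2 (hT.diff k)
  have hne : ∀ ξ ∈ horizStrip δ, |ξ.re - ζ.re| ≤ 1 / 2 → dslope (Γ k) ζ ξ ≠ 0 := by
    intro ξ hξ hre
    by_cases heq : ξ = ζ
    · rw [heq, dslope_same]; exact hT.deriv_ne k ζ hζ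
    · rw [dslope_of_ne _ heq, slope_def_field]
      refine div_ne_zero (sub_ne_zero.2 fun h' => ?_) (sub_ne_zero.2 heq)
      obtain ⟨-, m, hm⟩ := hT.inj k k ξ hξ ζ hζ h'
      have h3 : (m : ℝ) = ζ.re - ξ.re := by rw [hm]; simp
      rw [abs_sub_comm, ← h3] at hre
      have : |m| < 1 := by
        have : (|m| : ℝ) < 1 := by linarith
        exact_mod_cast this
      rw [Int.abs_lt_one_iff] at this
      apply heq
      rw [hm, this]; simp
  have key := periodic_integral_sub_eq_residue
    (ψ := fun ξ => h (Γ k ξ) / (Γ k ξ - Γ k ζ) * deriv (Γ k) ξ)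
    (F := fun ξ => h (Γ k ξ) * deriv (Γ k) ξ / dslope (Γ k) ζ ξ) hζ₁ hζ₂ ?_ ?_ ?_ ?_
  · rw [dslope_same, mul_div_cancel_right₀ _ (hT.deriv_ne k ζ hζ)] at key
    exact key
  · intro ξ
    simp only [hT.per k ξ, (hT.per k).deriv_complex ξ]
  · refine ContinuousOn.div ((hc.mono fun ξ hξ => hξ.2).mul ((hT.diff_deriv k).continuousOn.mono
      fun ξ hξ => strip_subset h₁ h₂ hξ.2)) (hds.continuousOn.mono
      fun ξ hξ => strip_subset h₁ h₂ hξ.2) fun ξ hξ => hne ξ (strip_subset h₁ h₂ hξ.2) hξ.1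
  · refine DifferentiableOn.div ((hd.mono fun ξ hξ => hξ.2).mul ((hT.diff_deriv k).mono
      fun ξ hξ => open_strip_subset h₁ h₂ hξ.2)) (hds.mono
      fun ξ hξ => open_strip_subset h₁ h₂ hξ.2) fun ξ hξ => hne ξ (open_strip_subset h₁ h₂ hξ.2) hξ.1.le
  · intro ξ hre hi1 hi2 hξ
    rw [dslope_of_ne _ hξ, slope_def_field]
    have := hne ξ (strip_subset h₁ h₂ ⟨hi1, hi2⟩) hre
    rw [dslope_of_ne _ hξ, slope_def_field] at this
    have h3 : Γ k ξ - Γ k ζ ≠ 0 := fun h' => this (by rw [h', zero_div])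
    have h4 := sub_ne_zero.2 hξ
    field_simp

theorem continuousOn_div_sub (hT : IsTube Ω γ δ Γ σ) {h : ℂ → ℂ} {z : ℂ} {S : Set ℂ} {j : Fin n}
    (hS : S ⊆ horizStrip δ)
    (hc : ContinuousOn (fun ξ => h (Γ j ξ)) S) (hz : ∀ ξ ∈ S, Γ j ξ ≠ z) :
    ContinuousOn (fun ξ => h (Γ j ξ) / (Γ j ξ - z)) S :=
  hc.div (((hT.diff j).continuousOn.mono hS).sub continuousOn_const) fun ξ hξ =>
    sub_ne_zero.2 (hz ξ hξ)

theorem differentiableOn_div_sub (hT : IsTube Ω γ δ Γ σ) {h : ℂ → ℂ} {z : ℂ} {S : Set ℂ} {j : Fin n}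
    (hS : S ⊆ horizStrip δ)
    (hc : DifferentiableOn ℂ (fun ξ => h (Γ j ξ)) S) (hz : ∀ ξ ∈ S, Γ j ξ ≠ z) :
    DifferentiableOn ℂ (fun ξ => h (Γ j ξ) / (Γ j ξ - z)) S :=
  hc.div (((hT.diff j).mono hS).sub (differentiableOn_const _)) fun ξ hξ =>
    sub_ne_zero.2 (hz ξ hξ)

theorem cauchyT_shift (hT : IsTube Ω γ δ Γ σ) {y₁ y₂ : ℝ} (h₁ : -δ < y₁) (h : y₁ ≤ y₂)
    (h₂ : y₂ < δ) {h : ℂ → ℂ} {z : ℂ}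
    (hc : ∀ j, ContinuousOn (fun ξ => h (Γ j ξ)) {ξ | y₁ ≤ ξ.im ∧ ξ.im ≤ y₂})
    (hd : ∀ j, DifferentiableOn ℂ (fun ξ => h (Γ j ξ)) {ξ | y₁ < ξ.im ∧ ξ.im < y₂})
    (hz : ∀ j, ∀ ξ ∈ {ξ : ℂ | y₁ ≤ ξ.im ∧ ξ.im ≤ y₂}, Γ j ξ ≠ z) :
    cauchyT Γ y₁ h z = cauchyT Γ y₂ h z := by
  unfold cauchyT
  congr 1
  refine hT.heightIntegral_shift h₁ ‹_› h₂ (fun j => ?_) fun j => ?_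
  · exact hT.continuousOn_div_sub (strip_subset h₁ h₂) (hc j) (hz j)
  · exact hT.differentiableOn_div_sub (open_strip_subset h₁ h₂) (hd j)
      fun ξ hξ => hz j ξ ⟨hξ.1.le, hξ.2.le⟩

/-- Lowering the contour from `y₂` to `y₁` moves it outwards across the point. Only the curve that
carries the point contributes a residue; the others are shifted freely, since their tubes are
disjoint from it. -/
theorem cauchyT_jump (hT : IsTube Ω γ δ Γ σ) {y₁ y₂ : ℝ} (h₁ : -δ < y₁) (h₂ : y₂ < δ)
    {h : ℂ → ℂ} (k : Fin n) {ζ : ℂ} (hζ₁ : y₁ < ζ.im) (hζ₂ : ζ.im < y₂)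
    (hc : ∀ j, ContinuousOn (fun ξ => h (Γ j ξ)) {ξ | y₁ ≤ ξ.im ∧ ξ.im ≤ y₂})
    (hd : ∀ j, DifferentiableOn ℂ (fun ξ => h (Γ j ξ)) {ξ | y₁ < ξ.im ∧ ξ.im < y₂}) :
    cauchyT Γ y₁ h (Γ k ζ) = cauchyT Γ y₂ h (Γ k ζ) + h (Γ k ζ) := by
  have hζ : ζ ∈ horizStrip δ := open_strip_subset h₁ h₂ ⟨hζ₁, hζ₂⟩
  have key : heightIntegral Γ y₁ (fun w => h w / (w - Γ k ζ)) -
      heightIntegral Γ y₂ (fun w => h w / (w - Γ k ζ)) = 2 * Real.pi * I * h (Γ k ζ) := by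
    unfold heightIntegral
    rw [← Finset.sum_sub_distrib, Finset.sum_eq_single k]
    · exact hT.curve_integral_jump h₁ h₂ k hζ₁ hζ₂ (hc k) (hd k)
    · intro j _ hjk
      have hz : ∀ ξ ∈ {ξ : ℂ | y₁ ≤ ξ.im ∧ ξ.im ≤ y₂}, Γ j ξ ≠ Γ k ζ := fun ξ hξ heq =>
        hjk (hT.inj j k ξ (strip_subset h₁ h₂ hξ) ζ hζ heq).1
      rw [sub_eq_zero]
      refine hT.curve_integral_shift h₁ (hζ₁.trans hζ₂).le h₂ j ?_ ?_
        (M := fun w => h w / (w - Γ k ζ))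
      · exact hT.continuousOn_div_sub (strip_subset h₁ h₂) (hc j) hz
      · exact hT.differentiableOn_div_sub (open_strip_subset h₁ h₂) (hd j)
          fun ξ hξ => hz ξ ⟨hξ.1.le, hξ.2.le⟩
    · simp
  unfold cauchyT
  have h2 := two_pi_I_ne
  rw [sub_eq_iff_eq_add] at key
  rw [key]
  field_simp
  ring

/-- Coinciding points have parameters that differ by an integer, so the height is well defined on
the tube. -/
theorem ne_of_im_lt (hT : IsTube Ω γ δ Γ σ) {j k : Fin n} {ζ ξ : ℂ} (hζ : ζ ∈ horizStrip δ)
    (hξ : ξ ∈ horizStrip δ) (h : ζ.im ≠ ξ.im) : Γ j ζ ≠ Γ k ξ := by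
  intro heq
  obtain ⟨-, m, rfl⟩ := hT.inj j k ζ hζ ξ hξ heq
  simp at h

/-- If a Cauchy transform, corrected by holomorphic functions inside and outside, extends
holomorphically across the boundary, then it vanishes. -/
theorem eq_zero_of_glue (hT : IsTube Ω γ δ Γ σ) {y η : ℝ} (hy : 0 ≤ y) (hyη : y < η) (hη : η ≤ δ)
    {h Fi Fo X : ℂ → ℂ} (hcont : ∀ j, Continuous fun t : ℝ => h (Γ j (t + y * I)))
    (hFi : DifferentiableOn ℂ Fi Ω) (hFo : DifferentiableOn ℂ Fo (closure Ω)ᶜ)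
    (hlim : Tendsto Fo (cocompact ℂ) (𝓝 0)) (hX : DifferentiableOn ℂ X (tube Γ η))
    (hi : ∀ j ζ, y < ζ.im → ζ.im < η → cauchyT Γ y h (Γ j ζ) + Fi (Γ j ζ) = X (Γ j ζ))
    (ho : ∀ j ζ, -η < ζ.im → ζ.im < 0 → cauchyT Γ y h (Γ j ζ) + Fo (Γ j ζ) = X (Γ j ζ)) :
    (∀ z ∈ Ω, z ∉ slab Γ 0 y → cauchyT Γ y h z + Fi z = 0) ∧
    (∀ z ∉ closure Ω, cauchyT Γ y h z + Fo z = 0) ∧ ∀ z ∈ tube Γ η, X z = 0 := by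
  classical
  have hyδ : |y| < δ := by rw [abs_of_nonneg hy]; linarith
  -- By `hi` and `ho` the three pieces agree on overlaps, so `E` is entire. It tends to zero at
  -- infinity and vanishes by Liouville's theorem.
  set E : ℂ → ℂ := fun z => if z ∈ tube Γ η then X z else
    if z ∈ Ω then cauchyT Γ y h z + Fi z else cauchyT Γ y h z + Fo z with hE
  have hstrip : ∀ ζ : ℂ, ζ ∈ horizStrip η → ζ ∈ horizStrip δ := fun ζ => (horizStrip_mono hη ·)
  have hEi : ∀ z ∈ Ω, z ∉ slab Γ 0 y → E z = cauchyT Γ y h z + Fi z := by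
    intro z hz hns
    by_cases hzt : z ∈ tube Γ η
    · simp only [hE, if_pos hzt]
      obtain ⟨j, ζ, hζ, rfl⟩ := hzt
      have h0 := (hT.apply_mem_iff j (hstrip ζ hζ)).1 hz
      rw [hi j ζ _ (abs_lt.1 hζ).2]
      by_contra! hle
      exact hns ⟨j, ζ, h0.le, hle, rfl⟩
    · simp only [hE, if_neg hzt, if_pos hz]
  have hEo : ∀ z ∉ closure Ω, E z = cauchyT Γ y h z + Fo z := by
    intro z hz
    by_cases hzt : z ∈ tube Γ η
    · simp only [hE, if_pos hzt]
      obtain ⟨j, ζ, hζ, rfl⟩ := hzt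
      rw [ho j ζ (abs_lt.1 hζ).1]
      by_contra! hle
      exact hz ((hT.apply_mem_closure_iff j (hstrip ζ hζ)).2 hle)
    · simp only [hE, if_neg hzt, if_neg (fun h' => hz (subset_closure h'))]
  have hslab := hT.isCompact_slab (a := 0) (b := y) (by linarith [hT.pos]) (by linarith)
  have hcurve : ∀ j (t : ℝ), Γ j (t + y * I) ∈ slab Γ 0 y := fun j t =>
    ⟨j, _, by simpa using hy, by simp, rfl⟩
  have hslab_tube : slab Γ 0 y ⊆ tube Γ η := by
    rintro z ⟨j, ζ, h0, h1, rfl⟩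
    exact ⟨j, ζ, mem_horizStrip.2 ⟨by linarith, by linarith⟩, rfl⟩
  have hslab_cl : slab Γ 0 y ⊆ closure Ω := by
    rintro z ⟨j, ζ, h0, h1, rfl⟩
    exact (hT.apply_mem_closure_iff j (mem_horizStrip.2 ⟨by linarith, by linarith⟩)).2 h0
  have hdiff : Differentiable ℂ E := by
    intro z
    by_cases hzt : z ∈ tube Γ η
    · refine (hX.differentiableAt ((hT.isOpen_tube hη).mem_nhds hzt)).congr_of_eventuallyEq ?_
      filter_upwards [(hT.isOpen_tube hη).mem_nhds hzt] with w hw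
      simp only [hE, if_pos hw]
    · have hns : z ∉ slab Γ 0 y := fun h' => hzt (hslab_tube h')
      have hC : DifferentiableAt ℂ (cauchyT Γ y h) z := hT.differentiableAt_cauchyT hyδ hcont
        fun j t heq => hns (heq ▸ hcurve j t)
      rcases hT.mem_cases z with hz | hz | hz
      · refine (hC.add (hFi.differentiableAt (hT.dom.isOpen.mem_nhds hz))).congr_of_eventuallyEq ?_
        filter_upwards [hT.dom.isOpen.mem_nhds hz, hslab.isClosed.isOpen_compl.mem_nhds hns]
          with w hw hw' using hEi w hw hw'
      · exact absurd (hT.frontier_subset_tube (hy.trans_lt hyη) hz) hzt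
      · have hop : IsOpen (closure Ω)ᶜ := isClosed_closure.isOpen_compl
        refine (hC.add (hFo.differentiableAt (hop.mem_nhds hz))).congr_of_eventuallyEq ?_
        filter_upwards [hop.mem_nhds hz] with w hw using hEo w hw
  have hlimE : Tendsto E (cocompact ℂ) (𝓝 0) := by
    have h1 : Tendsto (fun z => cauchyT Γ y h z + Fo z) (cocompact ℂ) (𝓝 0) := by
      simpa using (hT.tendsto_cauchyT hyδ hcont).add hlim
    refine h1.congr' ?_
    have hcl : IsCompact (closure Ω) := hT.dom.isBounded.isCompact_closure
    filter_upwards [hcl.compl_mem_cocompact] with z hz using (hEo z hz).symm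
  have hzero : ∀ z, E z = 0 := fun z => hdiff.apply_eq_of_tendsto_cocompact z hlimE
  refine ⟨fun z hz hns => (hEi z hz hns) ▸ hzero z, fun z hz => (hEo z hz) ▸ hzero z,
    fun z hz => ?_⟩
  have := hzero z
  simp only [hE, if_pos hz] at this
  exact this

/-- Cauchy's integral formula on `Ω`. -/
theorem cauchyT_eq (hT : IsTube Ω γ δ Γ σ) {y : ℝ} (hy : 0 ≤ y) (hyδ : y < δ) {h : ℂ → ℂ}
    (hd : DifferentiableOn ℂ h Ω)
    (hc : ∀ j, ContinuousOn (fun ξ => h (Γ j ξ)) {ξ | y ≤ ξ.im ∧ ξ.im < δ}) :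
    (∀ z ∈ Ω, z ∉ slab Γ 0 y → cauchyT Γ y h z = h z) ∧ ∀ z ∉ closure Ω, cauchyT Γ y h z = 0 := by
  obtain ⟨η, hyη, hηδ⟩ := exists_between hyδ
  have hc' : ∀ j, ContinuousOn (fun ξ => h (Γ j ξ)) {ξ | y ≤ ξ.im ∧ ξ.im ≤ η} := fun j =>
    (hc j).mono fun ξ hξ => ⟨hξ.1, hξ.2.trans_lt hηδ⟩
  have hstrip : ∀ ξ : ℂ, y < ξ.im → ξ.im < δ → ξ ∈ horizStrip δ := fun ξ h1 h2 =>
    mem_horizStrip.2 ⟨by linarith, h2⟩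
  have hd0 : ∀ j, DifferentiableOn ℂ (fun ξ => h (Γ j ξ)) {ξ | y < ξ.im ∧ ξ.im < δ} := by
    intro j
    refine hd.comp ((hT.diff j).mono fun ξ hξ => hstrip ξ hξ.1 hξ.2) fun ξ hξ => ?_
    exact hT.mem j ξ (hstrip ξ hξ.1 hξ.2) (hy.trans_lt hξ.1)
  have hd' : ∀ j, DifferentiableOn ℂ (fun ξ => h (Γ j ξ)) {ξ | y < ξ.im ∧ ξ.im < η} := fun j =>
    (hd0 j).mono fun ξ hξ => ⟨hξ.1, hξ.2.trans hηδ⟩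
  have hη0 : |η| < δ := by rw [abs_of_nonneg (hy.trans hyη.le)]; exact hηδ
  -- The glued function is the transform at a larger height `η`. Between the heights `y` and `η` the
  -- jump gives `cauchyT Γ y h - h`, outside the domain the contour shift gives `cauchyT Γ y h`.
  have key := hT.eq_zero_of_glue hy hyη hηδ.le (h := h) (Fi := fun z => -h z) (Fo := 0)
    (X := cauchyT Γ η h) ?_ hd.neg (differentiableOn_const 0) tendsto_const_nhds ?_ ?_ ?_
  · refine ⟨fun z hz hns => ?_, fun z hz => ?_⟩
    · have := key.1 z hz hns
      rwa [← sub_eq_add_neg, sub_eq_zero] at this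
    · have := key.2.1 z hz
      simpa using this
  · intro j
    refine (hc j).comp_continuous (f := fun t : ℝ => (t : ℂ) + y * I) (by fun_prop) fun t => ?_
    simpa using hyδ
  · rintro z ⟨j, ζ, hζ, rfl⟩
    refine (hT.differentiableAt_cauchyT hη0 (fun j => ?_) fun k t => ?_).differentiableWithinAt
    · refine (hc j).comp_continuous (f := fun t : ℝ => (t : ℂ) + η * I) (by fun_prop) fun t => ?_
      simpa using ⟨hyη.le, hηδ⟩
    · refine hT.ne_of_im_lt (line_mem_horizStrip hη0 t) (horizStrip_mono hηδ.le hζ) ?_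
      simpa using (abs_lt.1 hζ).2.ne'
  · intro j ζ h1 h2
    rw [hT.cauchyT_jump (by linarith [hT.pos]) hηδ j h1 h2 hc' hd']
    ring
  · intro j ζ h1 h2
    simp only [Pi.zero_apply, add_zero]
    refine hT.cauchyT_shift (by linarith [hT.pos]) hyη.le hηδ hc' hd' fun k ξ hξ => ?_
    exact hT.ne_of_im_lt (strip_subset (by linarith [hT.pos]) hηδ hξ)
      (mem_horizStrip.2 ⟨by linarith, by linarith [hT.pos]⟩) (by linarith [hξ.1] : ζ.im < ξ.im).ne'

theorem exists_mem_notMem_slab (hT : IsTube Ω γ δ Γ σ) {y : ℝ} (hyδ : y < δ)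
    [Nonempty (Fin n)] : ∃ z ∈ Ω, z ∉ slab Γ 0 y := by
  obtain ⟨y', h1, h2⟩ := exists_between (max_lt hyδ hT.pos)
  have h3 : 0 < y' := (le_max_right _ _).trans_lt h1
  have h4 : y < y' := (le_max_left _ _).trans_lt h1
  let j : Fin n := Classical.arbitrary _
  have hmem : ((0 : ℝ) : ℂ) + y' * I ∈ horizStrip δ :=
    line_mem_horizStrip (by rw [abs_of_pos h3]; exact h2) 0
  refine ⟨Γ j ((0 : ℝ) + y' * I), hT.mem j _ hmem (by simpa using h3), ?_⟩
  rintro ⟨k, ζ, h5, h6, h7⟩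
  refine hT.ne_of_im_lt (mem_horizStrip.2 ⟨by linarith [hT.pos], by linarith⟩) hmem ?_ h7
  simpa using (h6.trans_lt h4).ne

/-- Cauchy's theorem on `Ω`. -/
theorem heightIntegral_eq_zero (hT : IsTube Ω γ δ Γ σ) {y : ℝ} (hy : 0 ≤ y) (hyδ : y < δ)
    {h : ℂ → ℂ} (hd : DifferentiableOn ℂ h Ω)
    (hc : ∀ j, ContinuousOn (fun ξ => h (Γ j ξ)) {ξ | y ≤ ξ.im ∧ ξ.im < δ}) :
    heightIntegral Γ y h = 0 := by
  rcases isEmpty_or_nonempty (Fin n) with hn | hn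
  · simp [heightIntegral]
  obtain ⟨a, ha, has⟩ := hT.exists_mem_notMem_slab hyδ
  -- Cauchy's formula for `(w - a) h` at `a`: the value is zero and the factor cancels the Cauchy
  -- denominator.
  have h1 := (hT.cauchyT_eq hy hyδ (h := fun w => (w - a) * h w)
    ((differentiableOn_id.sub_const a).mul hd) (fun j => ?_)).1 a ha has
  · simp only [sub_self, zero_mul, cauchyT] at h1
    have h1 := (mul_eq_zero.1 h1).resolve_left (inv_ne_zero two_pi_I_ne)
    rw [← h1]
    unfold heightIntegral
    refine Finset.sum_congr rfl fun j _ => intervalIntegral.integral_congr fun t _ => ?_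
    have : Γ j (t + y * I) - a ≠ 0 := by
      refine sub_ne_zero.2 fun heq => has ?_
      exact ⟨j, _, by simpa using hy, by simp, heq⟩
    field_simp
  · exact (((hT.diff j).continuousOn.mono fun ξ hξ => mem_horizStrip.2 ⟨by linarith [hξ.1], hξ.2⟩).sub
      continuousOn_const).mul (hc j)

end IsTube

/-! ### Integral equations with bounded skew-hermitian kernels. -/

section SkewOperator

variable {X : Type*} [MeasurableSpace X] {μ : Measure X}

theorem integrable_kernel_mul {K : X → X → ℂ} (hK : StronglyMeasurable (Function.uncurry K)) {M : ℝ}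
    (hM : ∀ x y, ‖K x y‖ ≤ M) {v : X → ℂ} (hv : Integrable v μ) (x : X) :
    Integrable (fun y => K x y * v y) μ := by
  refine Integrable.bdd_mul (c := M) hv ?_ (ae_of_all _ (hM x))
  exact (hK.comp_measurable measurable_prodMk_left).aestronglyMeasurable

theorem norm_kernel_integral_le {K : X → X → ℂ} {M : ℝ}
    (hM : ∀ x y, ‖K x y‖ ≤ M) {v : X → ℂ} (hv : Integrable v μ) (x : X) :
    ‖∫ y, K x y * v y ∂μ‖ ≤ M * ∫ y, ‖v y‖ ∂μ := by
  rw [← integral_const_mul]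
  refine norm_integral_le_of_norm_le (hv.norm.const_mul M) (ae_of_all _ fun y => ?_)
  rw [norm_mul]
  exact mul_le_mul_of_nonneg_right (hM x y) (norm_nonneg _)

variable [IsFiniteMeasure μ]

theorem stronglyMeasurable_kernel_integral {K : X → X → ℂ}
    (hK : StronglyMeasurable (Function.uncurry K)) {v : X → ℂ} (hv : AEStronglyMeasurable v μ) :
    StronglyMeasurable fun x => ∫ y, K x y * v y ∂μ := by
  have h1 : (fun x => ∫ y, K x y * v y ∂μ) = fun x => ∫ y, K x y * hv.mk v y ∂μ := by
    funext x
    refine integral_congr_ae ?_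
    filter_upwards [hv.ae_eq_mk] with y hy
    rw [hy]
  rw [h1]
  refine StronglyMeasurable.integral_prod_right (f := fun x y => K x y * hv.mk v y) ?_
  exact hK.mul (hv.stronglyMeasurable_mk.comp_measurable measurable_snd)

/-- The integral operator with a bounded kernel on `L²` of a finite measure space. -/
theorem exists_kernel_operator {K : X → X → ℂ} (hK : StronglyMeasurable (Function.uncurry K))
    {M : ℝ} (hM : ∀ x y, ‖K x y‖ ≤ M) :
    ∃ T : Lp ℂ 2 μ →L[ℂ] Lp ℂ 2 μ, ∀ v : Lp ℂ 2 μ, T v =ᵐ[μ] fun x => ∫ y, K x y * v y ∂μ := by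
  have hint : ∀ v : Lp ℂ 2 μ, Integrable v μ := fun v => (Lp.memLp v).integrable one_le_two
  have hmem : ∀ v : Lp ℂ 2 μ, MemLp (fun x => ∫ y, K x y * v y ∂μ) 2 μ := fun v =>
    MemLp.of_bound (stronglyMeasurable_kernel_integral hK (hint v).1).aestronglyMeasurable
      (M * ∫ y, ‖v y‖ ∂μ) (ae_of_all _ fun x => norm_kernel_integral_le hM (hint v) x)
  -- On an empty space the given bound may be negative.
  set M' := max M 0
  have hM' : ∀ x y, ‖K x y‖ ≤ M' := fun x y => (hM x y).trans (le_max_left _ _)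
  have hM0 : 0 ≤ M' := le_max_right _ _
  let T₀ : Lp ℂ 2 μ →ₗ[ℂ] Lp ℂ 2 μ :=
    { toFun := fun v => (hmem v).toLp _
      map_add' := by
        intro u v
        rw [← MemLp.toLp_add]
        refine (MemLp.toLp_eq_toLp_iff _ _).2 (ae_of_all _ fun x => ?_)
        simp only [Pi.add_apply]
        rw [← integral_add (integrable_kernel_mul hK hM (hint u) x)
          (integrable_kernel_mul hK hM (hint v) x)]
        refine integral_congr_ae ?_
        filter_upwards [Lp.coeFn_add u v] with y hy
        rw [hy, Pi.add_apply, mul_add]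
      map_smul' := by
        intro c v
        rw [← MemLp.toLp_const_smul]
        refine (MemLp.toLp_eq_toLp_iff _ _).2 (ae_of_all _ fun x => ?_)
        simp only [Pi.smul_apply, RingHom.id_apply, smul_eq_mul]
        rw [← integral_const_mul]
        refine integral_congr_ae ?_
        filter_upwards [Lp.coeFn_smul c v] with y hy
        rw [hy, Pi.smul_apply, smul_eq_mul]
        ring }
  have hT₀ : ∀ v, T₀ v =ᵐ[μ] fun x => ∫ y, K x y * v y ∂μ := fun v => (hmem v).coeFn_toLp
  have hL1 : ∀ v : Lp ℂ 2 μ, ∫ y, ‖v y‖ ∂μ ≤ (μ univ ^ (1 / 2 : ℝ)).toReal * ‖v‖ := by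
    intro v
    have h1 : ∫ y, ‖v y‖ ∂μ = (eLpNorm v 1 μ).toReal := by
      rw [integral_norm_eq_lintegral_enorm (hint v).1, eLpNorm_one_eq_lintegral_enorm]
    rw [h1, Lp.norm_def, mul_comm, ← ENNReal.toReal_mul]
    refine ENNReal.toReal_mono ?_ ?_
    · exact ENNReal.mul_ne_top (Lp.eLpNorm_ne_top v)
        (ENNReal.rpow_ne_top_of_nonneg (by norm_num) (measure_ne_top μ univ))
    · have := eLpNorm_le_eLpNorm_mul_rpow_measure_univ (p := 1) (q := 2) (f := v) (μ := μ)
        one_le_two (hint v).1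
      refine this.trans_eq ?_
      congr 2
      norm_num
  refine ⟨T₀.mkContinuous ((μ univ ^ (1 / 2 : ℝ)).toReal * (M' * (μ univ ^ (1 / 2 : ℝ)).toReal))
    fun v => ?_, fun v => ?_⟩
  · have h1 : ∀ᵐ x ∂μ, ‖T₀ v x‖ ≤ M' * ((μ univ ^ (1 / 2 : ℝ)).toReal * ‖v‖) := by
      filter_upwards [hT₀ v] with x hx
      rw [hx]
      exact (norm_kernel_integral_le hM' (hint v) x).trans
        (mul_le_mul_of_nonneg_left (hL1 v) hM0)
    have h2 := Lp.norm_le_of_ae_bound (p := 2) (f := T₀ v) (by positivity) h1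
    refine h2.trans (le_of_eq ?_)
    have h3 : (measureUnivNNReal μ : ℝ) ^ ((2 : ENNReal).toReal)⁻¹ = (μ univ ^ (1 / 2 : ℝ)).toReal := by
      rw [← ENNReal.toReal_rpow]
      norm_num
      rfl
    rw [h3]
    ring
  · exact hT₀ v

/-- A Fredholm equation of the second kind with a bounded skew-hermitian kernel is solvable. -/
theorem exists_solution_of_skew {K : X → X → ℂ} (hK : StronglyMeasurable (Function.uncurry K))
    {M : ℝ} (hM : ∀ x y, ‖K x y‖ ≤ M) (hskew : ∀ x y, K x y = -conj (K y x)) {c : X → ℂ}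
    (hc : MemLp c 2 μ) :
    ∃ v : X → ℂ, MemLp v 2 μ ∧ ∀ᵐ x ∂μ, v x = c x + ∫ y, K x y * v y ∂μ := by
  obtain ⟨T, hT⟩ := exists_kernel_operator (μ := μ) hK hM
  have hint : ∀ v : Lp ℂ 2 μ, Integrable v μ := fun v => (Lp.memLp v).integrable one_le_two
  -- Exchanging the order of integration and using skewness, the inner product equals minus its
  -- conjugate.
  have hre : ∀ v : Lp ℂ 2 μ, (inner ℂ v (T v)).re = 0 := by
    intro v
    have h1 : inner ℂ v (T v) = ∫ x, ∫ y, conj (v x) * (K x y * v y) ∂μ ∂μ := by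
      rw [L2.inner_def]
      refine integral_congr_ae ?_
      filter_upwards [hT v] with x hx
      rw [hx, integral_const_mul]
      simp [mul_comm]
    have hprod : Integrable (Function.uncurry fun x y => conj (v x) * (K x y * v y)) (μ.prod μ) := by
      have h2 : Integrable (fun p : X × X => conj (v p.1) * v p.2) (μ.prod μ) :=
        ((conjCLE : ℂ →L[ℝ] ℂ).integrable_comp (hint v)).mul_prod (hint v)
      have h3 : Integrable (fun p : X × X => Function.uncurry K p * (conj (v p.1) * v p.2))
          (μ.prod μ) := by
        refine Integrable.bdd_mul (c := M) h2 hK.aestronglyMeasurable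
          (ae_of_all _ fun p => hM p.1 p.2)
      refine h3.congr (ae_of_all _ fun p => ?_)
      simp only [Function.uncurry]
      ring
    have h4 : inner ℂ v (T v) = -conj (inner ℂ v (T v)) := by
      conv_lhs => rw [h1, integral_integral_swap hprod]
      rw [h1, ← integral_conj, ← integral_neg]
      refine integral_congr_ae (ae_of_all _ fun x => ?_)
      simp only
      rw [← integral_conj, ← integral_neg]
      refine integral_congr_ae (ae_of_all _ fun y => ?_)
      simp only [map_mul, conj_conj]
      rw [hskew y x]
      ring
    have h5 := congrArg re h4
    rw [neg_re, conj_re] at h5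
    linarith
  -- Hence `Re ⟨(1 - T) v, v⟩ = ‖v‖²`: the operator `1 - T` is coercive, and no compactness is
  -- needed to invert it.
  have hunit : IsUnit (ContinuousLinearMap.id ℂ (Lp ℂ 2 μ) - T) := by
    refine ContinuousLinearMap.isUnit_of_forall_le_norm_inner_map _ (c := 1) one_pos fun v => ?_
    have h1 : (inner ℂ ((ContinuousLinearMap.id ℂ (Lp ℂ 2 μ) - T) v) v).re = ‖v‖ ^ 2 := by
      have h2 := hre v
      rw [← inner_conj_symm, conj_re] at h2
      rw [sub_apply, ContinuousLinearMap.id_apply, inner_sub_left, sub_re, h2,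
        sub_zero]
      exact inner_self_eq_norm_sq (𝕜 := ℂ) v
    rw [NNReal.coe_one, mul_one, ← h1]
    exact (le_abs_self _).trans (abs_re_le_norm _)
  obtain ⟨u, hu⟩ := hunit
  set v : Lp ℂ 2 μ := (↑u⁻¹ : Lp ℂ 2 μ →L[ℂ] Lp ℂ 2 μ) (hc.toLp c) with hv
  have h1 : v - T v = hc.toLp c := by
    have h2 : (u : Lp ℂ 2 μ →L[ℂ] Lp ℂ 2 μ) ((↑u⁻¹ : Lp ℂ 2 μ →L[ℂ] Lp ℂ 2 μ) (hc.toLp c)) =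
        hc.toLp c := by
      rw [← mul_apply_eq_comp, Units.mul_inv, one_apply_eq_self]
    rw [hu] at h2
    exact h2
  refine ⟨v, Lp.memLp v, ?_⟩
  filter_upwards [Lp.coeFn_sub v (T v), hc.coeFn_toLp, hT v] with x h2 h3 h4
  rw [h1, h3, Pi.sub_apply, h4] at h2
  rw [h2]; ring

end SkewOperator

/-! ### Removable singularities of bounded holomorphic functions. -/

theorem isLittleO_of_tendsto_mul {f : ℂ → ℂ} {c : ℂ}
    (h : Tendsto (fun z => (z - c) * f z) (𝓝[≠] c) (𝓝 0)) :
    (fun z => f z - f c) =o[𝓝[≠] c] fun z => (z - c)⁻¹ := by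
  refine (Asymptotics.isLittleO_iff_tendsto' ?_).2 ?_
  · filter_upwards [self_mem_nhdsWithin] with z hz h0
    exact absurd (inv_eq_zero.1 h0) (sub_ne_zero.2 hz)
  · have h1 : Tendsto (fun z => (z - c) * f c) (𝓝[≠] c) (𝓝 0) := by
      have : Continuous fun z => (z - c) * f c := by fun_prop
      simpa using (this.tendsto c).mono_left nhdsWithin_le_nhds
    have h2 := h.sub h1
    rw [sub_zero] at h2
    refine h2.congr fun z => ?_
    rw [div_inv_eq_mul]; ring

/-- The maximum principle on a punctured disc with a removable singularity. -/
theorem norm_le_of_punctured {f : ℂ → ℂ} {c : ℂ} {r M : ℝ} {U : Set ℂ}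
    (hU : IsOpen U) (hsub : Metric.closedBall c r ⊆ U) (hd : DifferentiableOn ℂ f (U \ {c}))
    (h0 : Tendsto (fun z => (z - c) * f z) (𝓝[≠] c) (𝓝 0))
    (hM : ∀ z, ‖z - c‖ = r → ‖f z‖ ≤ M) {z : ℂ} (hz : ‖z - c‖ < r) (hzc : z ≠ c) : ‖f z‖ ≤ M := by
  have hr : 0 < r := (norm_nonneg _).trans_lt hz
  set g := Function.update f c (limUnder (𝓝[≠] c) f) with hgdef
  have hc : c ∈ U := hsub (Metric.mem_closedBall_self hr.le)
  have hg : DifferentiableOn ℂ g U :=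
    differentiableOn_update_limUnder_of_isLittleO (hU.mem_nhds hc) hd (isLittleO_of_tendsto_mul h0)
  have h1 := norm_le_of_forall_mem_frontier_norm_le (f := g) (U := Metric.ball c r) (C := M)
    Metric.isBounded_ball (hg.diffContOnCl_ball hsub) ?_ (z := z)
    (subset_closure (by rwa [Metric.mem_ball, dist_eq_norm]))
  · rwa [hgdef, Function.update_of_ne hzc] at h1
  · intro w hw
    rw [frontier_ball c hr.ne', Metric.mem_sphere, dist_eq_norm] at hw
    have : w ≠ c := by rintro rfl; simp at hw; linarith
    rw [hgdef, Function.update_of_ne this]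
    exact hM w hw

theorem tendsto_limUnder_of_bound {f : ℂ → ℂ} {U : Set ℂ} (hU : IsOpen U) {M : ℝ}
    (hM : ∀ ζ ∈ U, ‖f ζ‖ ≤ M) (hd : ∀ ζ ∈ U, ∀ᶠ ξ in 𝓝[≠] ζ, DifferentiableAt ℂ f ξ) {ζ : ℂ}
    (hζ : ζ ∈ U) : Tendsto f (𝓝[≠] ζ) (𝓝 (limUnder (𝓝[≠] ζ) f)) := by
  refine tendsto_limUnder_of_differentiable_on_punctured_nhds_of_bounded_under (hd ζ hζ) ?_
  refine ⟨M + ‖f ζ‖, ?_⟩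
  rw [eventually_map]
  filter_upwards [nhdsWithin_le_nhds (hU.mem_nhds hζ)] with ξ hξ
  exact (norm_sub_le _ _).trans (by linarith [hM ξ hξ])

/-- Removing the isolated singularities of a bounded function. -/
theorem differentiableOn_limUnder {f : ℂ → ℂ} {U : Set ℂ} (hU : IsOpen U) {M : ℝ}
    (hM : ∀ ζ ∈ U, ‖f ζ‖ ≤ M) (hd : ∀ ζ ∈ U, ∀ᶠ ξ in 𝓝[≠] ζ, DifferentiableAt ℂ f ξ) :
    DifferentiableOn ℂ (fun ζ => limUnder (𝓝[≠] ζ) f) U := by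
  intro ζ hζ
  have h1 := hd ζ hζ
  rw [eventually_nhdsWithin_iff, Metric.eventually_nhds_iff] at h1
  obtain ⟨ε, hε, hball⟩ := h1
  set s := Metric.ball ζ ε ∩ U
  have hs : s ∈ 𝓝 ζ := inter_mem (Metric.ball_mem_nhds _ hε) (hU.mem_nhds hζ)
  have hso : IsOpen s := Metric.isOpen_ball.inter hU
  have h2 : DifferentiableOn ℂ (Function.update f ζ (limUnder (𝓝[≠] ζ) f)) s := by
    refine differentiableOn_update_limUnder_of_bddAbove hs ?_ ?_
    · intro ξ hξ
      exact (hball hξ.1.1 hξ.2).differentiableWithinAt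
    · refine ⟨M, ?_⟩
      rintro _ ⟨ξ, hξ, rfl⟩
      exact hM ξ hξ.1.2
  refine ((h2.differentiableAt hs).congr_of_eventuallyEq ?_).differentiableWithinAt
  filter_upwards [hs] with ξ hξ
  by_cases h : ξ = ζ
  · rw [h, Function.update_self]
  · rw [Function.update_of_ne h]
    exact ((hball hξ.1 h).continuousAt.tendsto.mono_left nhdsWithin_le_nhds).limUnder_eq

/-! ### The Kerzman–Stein kernel: regularity, bounds and symmetry. -/

/-- The Kerzman–Stein kernel in tubular coordinates. -/
noncomputable def ksKernel (Γ σ : Fin n → ℂ → ℂ) (j : Fin n) (ζ : ℂ) (k : Fin n) (s : ℝ) : ℂ :=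
  (2 * Real.pi * I)⁻¹ * (deriv (Γ k) s / σ k s / (Γ k s - Γ j ζ) -
    σ j ζ / deriv (Γ j) ζ / (conj (Γ k s) - conj (Γ j (conj ζ))))

theorem differentiableOn_conj_comp_conj {f : ℂ → ℂ} {r : ℝ}
    (hf : DifferentiableOn ℂ f (horizStrip r)) :
    DifferentiableOn ℂ (fun ζ => conj (f (conj ζ))) (horizStrip r) := by
  intro ζ hζ
  have h1 : DifferentiableAt ℂ f (conj ζ) :=
    hf.differentiableAt ((isOpen_horizStrip r).mem_nhds (conj_mem_horizStrip.2 hζ))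
  have h2 := h1.conj_conj
  rw [conj_conj] at h2
  exact h2.differentiableWithinAt

namespace IsTube

theorem deriv_ofReal (hT : IsTube Ω γ δ Γ σ) (j : Fin n) (t : ℝ) :
    deriv (Γ j) t = deriv (γ j) t :=
  deriv_eq_of_eq_ofReal (hT.apply_ofReal j)
    (hT.analyticAt j (ofReal_mem_horizStrip hT.pos t)).differentiableAt

theorem speed_eq (hT : IsTube Ω γ δ Γ σ) (j : Fin n) (t : ℝ) :
    σ j t = ‖deriv (Γ j) t‖ := by rw [hT.speed_ofReal, hT.deriv_ofReal]

theorem conj_speed (hT : IsTube Ω γ δ Γ σ) (j : Fin n) (t : ℝ) :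
    conj (σ j t) = σ j t := by rw [hT.speed_eq, conj_ofReal]

theorem speed_sq (hT : IsTube Ω γ δ Γ σ) (j : Fin n) (t : ℝ) :
    σ j t * σ j t = deriv (Γ j) t * conj (deriv (Γ j) t) := by
  rw [hT.speed_eq, mul_conj, normSq_eq_norm_sq]
  push_cast
  ring

theorem eq_conj_iff (hT : IsTube Ω γ δ Γ σ) {j k : Fin n} {ζ : ℂ} (hζ : ζ ∈ horizStrip δ) (s : ℝ) :
    Γ k s = Γ j ζ ↔ k = j ∧ ∃ m : ℤ, ζ = s + m := by
  refine ⟨fun h => hT.inj k j s (ofReal_mem_horizStrip hT.pos s) ζ hζ h, ?_⟩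
  rintro ⟨rfl, m, rfl⟩
  rw [hT.apply_add_int]

/-- The second denominator of the kernel vanishes only where `conj ζ` is a real parameter modulo an
integer. Then `ζ` equals `conj ζ` and the first denominator vanishes too. -/
theorem conj_sub_ne (hT : IsTube Ω γ δ Γ σ) {j k : Fin n} {ζ : ℂ} (hζ : ζ ∈ horizStrip δ) {s : ℝ}
    (h : Γ k s ≠ Γ j ζ) : conj (Γ k s) - conj (Γ j (conj ζ)) ≠ 0 := by
  rw [← map_sub, Ne, map_eq_zero, sub_eq_zero]
  intro h'
  obtain ⟨rfl, m, hm⟩ := (hT.eq_conj_iff (conj_mem_horizStrip.2 hζ) s).1 h'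
  refine h ((hT.eq_conj_iff hζ s).2 ⟨rfl, m, ?_⟩)
  rw [← conj_conj ζ, hm]
  simp

theorem ksKernel_add_int (hT : IsTube Ω γ δ Γ σ) (j k : Fin n) (ζ : ℂ) (s : ℝ) (l m : ℤ) :
    ksKernel Γ σ j (ζ + l) k (s + m) = ksKernel Γ σ j ζ k s := by
  unfold ksKernel
  have h1 : ((s + m : ℝ) : ℂ) = s + m := by push_cast; rfl
  have h2 : conj (ζ + l) = conj ζ + l := by simp
  rw [h1, h2, hT.apply_add_int, hT.apply_add_int, hT.apply_add_int,
    ((hT.per k).deriv_complex).apply_add_int, ((hT.per j).deriv_complex).apply_add_int,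
    (hT.speed_per k).apply_add_int, (hT.speed_per j).apply_add_int]

/-- On the diagonal both denominators are zero, and division by zero returns zero. This value is not
the continuous one, but it respects the bound. -/
theorem ksKernel_of_eq (hT : IsTube Ω γ δ Γ σ) {j k : Fin n} {ζ : ℂ} (hζ : ζ ∈ horizStrip δ) {s : ℝ}
    (h : Γ k s = Γ j ζ) : ksKernel Γ σ j ζ k s = 0 := by
  obtain ⟨rfl, m, rfl⟩ := (hT.eq_conj_iff hζ s).1 h
  have h2 : conj ((s : ℂ) + m) = s + m := by simp
  simp [ksKernel, h2, hT.apply_add_int]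

theorem differentiableAt_ksKernel (hT : IsTube Ω γ δ Γ σ) {j k : Fin n} {ζ : ℂ}
    (hζ : ζ ∈ horizStrip δ) {s : ℝ} (h : Γ k s ≠ Γ j ζ) :
    DifferentiableAt ℂ (fun ζ => ksKernel Γ σ j ζ k s) ζ := by
  have hn := (isOpen_horizStrip δ).mem_nhds hζ
  refine DifferentiableAt.const_mul (DifferentiableAt.sub ?_ ?_) _
  · exact (differentiableAt_const _).div (((hT.diff j).differentiableAt hn).const_sub _)
      (sub_ne_zero.2 h)
  · refine DifferentiableAt.div (DifferentiableAt.div ((hT.speed_diff j).differentiableAt hn)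
      ((hT.diff_deriv j).differentiableAt hn) (hT.deriv_ne j ζ hζ)) ?_ (hT.conj_sub_ne hζ h)
    exact ((differentiableOn_conj_comp_conj (hT.diff j)).differentiableAt hn).const_sub _

/-- The two terms have simple poles at `ζ = s` with residues proportional to `-1 / σ` and `σ / (Γ'
conj Γ')`. They cancel because `σ² = Γ' conj Γ'` on the real axis, so the diagonal singularity is
removable. -/
theorem tendsto_ksKernel (hT : IsTube Ω γ δ Γ σ) (j : Fin n) (s : ℝ) :
    Tendsto (fun ζ => (ζ - s) * ksKernel Γ σ j ζ j s) (𝓝[≠] (s : ℂ)) (𝓝 0) := by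
  have hs := ofReal_mem_horizStrip hT.pos s
  have hn := (isOpen_horizStrip δ).mem_nhds hs
  have hΓ' := hT.deriv_ne j s hs
  have hσ := hT.speed_ne j s hs
  have h1 : Tendsto (fun ζ => (slope (Γ j) s ζ)⁻¹) (𝓝[≠] (s : ℂ)) (𝓝 (deriv (Γ j) s)⁻¹) :=
    (hasDerivAt_iff_tendsto_slope.1 ((hT.diff j).differentiableAt hn).hasDerivAt).inv₀ hΓ'
  have hdc : HasDerivAt (fun ζ => conj (Γ j (conj ζ))) (conj (deriv (Γ j) s)) s := by
    have h2 := ((hT.diff j).differentiableAt hn).hasDerivAt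
    have h3 : HasDerivAt (Γ j) (deriv (Γ j) s) (conj (s : ℂ)) := by rwa [conj_ofReal]
    have := h3.conj_conj
    rw [conj_conj] at this
    exact this
  have h2 : Tendsto (fun ζ => (slope (fun ζ => conj (Γ j (conj ζ))) s ζ)⁻¹) (𝓝[≠] (s : ℂ))
      (𝓝 (conj (deriv (Γ j) s))⁻¹) :=
    (hasDerivAt_iff_tendsto_slope.1 hdc).inv₀ (by simpa using hΓ')
  have h3 : Tendsto (fun ζ => σ j ζ / deriv (Γ j) ζ) (𝓝[≠] (s : ℂ))
      (𝓝 (σ j s / deriv (Γ j) s)) := by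
    have : ContinuousAt (fun ζ => σ j ζ / deriv (Γ j) ζ) s :=
      (((hT.speed_diff j).differentiableAt hn).continuousAt).div
        (((hT.diff_deriv j).differentiableAt hn).continuousAt) hΓ'
    exact this.tendsto.mono_left nhdsWithin_le_nhds
  have h4 := ((h1.const_mul (deriv (Γ j) s / σ j s)).neg.add (h3.mul h2)).const_mul
    (2 * Real.pi * I : ℂ)⁻¹
  have h5 : (2 * Real.pi * I : ℂ)⁻¹ * (-(deriv (Γ j) s / σ j s * (deriv (Γ j) s)⁻¹) +
      σ j s / deriv (Γ j) s * (conj (deriv (Γ j) s))⁻¹) = 0 := by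
    have h6 := hT.speed_sq j s
    have h7 : conj (deriv (Γ j) s) ≠ 0 := by simpa using hΓ'
    have : -(deriv (Γ j) s / σ j s * (deriv (Γ j) s)⁻¹) +
      σ j s / deriv (Γ j) s * (conj (deriv (Γ j) s))⁻¹ = 0 := by
      field_simp
      rw [sq, h6]
      ring
    rw [this, mul_zero]
  rw [h5] at h4
  refine h4.congr' ?_
  filter_upwards [self_mem_nhdsWithin] with ζ hζ
  have hζ' : ζ - s ≠ 0 := sub_ne_zero.2 hζ
  rw [slope_def_field, slope_def_field, conj_ofReal]
  unfold ksKernel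
  rw [inv_div, inv_div]
  have e1 : (ζ - s) / (Γ j ζ - Γ j s) = -((ζ - s) / (Γ j s - Γ j ζ)) := by
    rw [← neg_sub (Γ j s), div_neg]
  have e2 : (ζ - s) / (conj (Γ j (conj ζ)) - conj (Γ j s)) =
      -((ζ - s) / (conj (Γ j s) - conj (Γ j (conj ζ)))) := by
    rw [← neg_sub (conj (Γ j s)), div_neg]
  rw [e1, e2]
  ring

/-- Away from the diagonal the kernel is continuous on a compact set of parameters. Near it the
maximum principle on the disc of radius `ρ` about `s` carries the bound from the circle to the
interior; `ρ < 1 / 2` keeps the integer translates of `s` out of that disc. -/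
theorem exists_ksKernel_bound (hT : IsTube Ω γ δ Γ σ) {ρ : ℝ} (hρ : 0 < ρ) (hρδ : ρ < δ)
    (hρ2 : ρ < 1 / 2) :
    ∃ M, ∀ j k, ∀ ζ ∈ horizStrip ρ, ∀ s : ℝ, ‖ksKernel Γ σ j ζ k s‖ ≤ M := by
  have hstrip : ∀ ζ : ℂ, |ζ.im| ≤ ρ → ζ ∈ horizStrip δ := fun ζ h => lt_of_le_of_lt h hρδ
  -- The parameter ranges exceed one period so that the circles about `s` used in the maximum
  -- principle stay inside.
  set Q : Fin n → Fin n → Set (ℂ × ℝ) := fun j k =>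
    {p | p.1 ∈ Icc (-1 : ℝ) 2 ×ℂ Icc (-ρ) ρ ∧ p.2 ∈ Icc (-2 : ℝ) 3 ∧ |p.1.re - p.2| ≤ 1 / 2 ∧
      (j = k → ρ ≤ ‖p.1 - p.2‖)} with hQ
  have hQc : ∀ j k, IsCompact (Q j k) := by
    intro j k
    have hK : IsCompact ((Icc (-1 : ℝ) 2 ×ℂ Icc (-ρ) ρ) ×ˢ Icc (-2 : ℝ) 3) :=
      (isCompact_Icc.reProdIm isCompact_Icc).prod isCompact_Icc
    have hC : IsClosed {p : ℂ × ℝ | |p.1.re - p.2| ≤ 1 / 2 ∧ (j = k → ρ ≤ ‖p.1 - p.2‖)} := by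
      refine IsClosed.inter (isClosed_le (f := fun p : ℂ × ℝ => |p.1.re - p.2|)
        (by fun_prop) continuous_const) ?_
      by_cases h : j = k
      · simp only [h, true_imp_iff]
        exact isClosed_le (g := fun p : ℂ × ℝ => ‖p.1 - p.2‖) continuous_const (by fun_prop)
      · simp only [h, false_imp_iff]
        exact isClosed_univ
    convert hK.inter_right hC using 1
    ext p
    simp only [hQ, mem_ofPred_eq, mem_inter_iff, mem_prod]
    tauto
  have hQm : ∀ j k, ∀ p ∈ Q j k, p.1 ∈ horizStrip δ := fun j k p hp =>
    hstrip _ (abs_le.2 ⟨hp.1.2.1, hp.1.2.2⟩)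
  have hQne : ∀ j k, ∀ p ∈ Q j k, Γ k p.2 ≠ Γ j p.1 := by
    intro j k p hp h
    obtain ⟨rfl, m, hm⟩ := (hT.eq_conj_iff (hQm j k p hp) p.2).1 h
    have h1 := hp.2.2.1
    have h2 := hp.2.2.2 rfl
    rw [hm] at h1 h2
    simp only [add_re, ofReal_re, intCast_re, add_sub_cancel_left] at h1 h2
    have h3 : |m| < 1 := by
      have : (|m| : ℝ) < 1 := by linarith
      exact_mod_cast this
    rw [Int.abs_lt_one_iff] at h3
    simp [h3] at h2
    linarith
  have hbound : ∀ j k, ∃ M, ∀ p ∈ Q j k, ‖ksKernel Γ σ j p.1 k p.2‖ ≤ M := by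
    intro j k
    refine (hQc j k).exists_bound_of_continuousOn (f := fun p : ℂ × ℝ => ksKernel Γ σ j p.1 k p.2) ?_
    have c1 : ContinuousOn (fun p : ℂ × ℝ => p.1) (Q j k) := continuousOn_fst
    have c2 : ContinuousOn (fun p : ℂ × ℝ => (p.2 : ℂ)) (Q j k) := by fun_prop
    have m1 : MapsTo (fun p : ℂ × ℝ => p.1) (Q j k) (horizStrip δ) := hQm j k
    have m2 : MapsTo (fun p : ℂ × ℝ => (p.2 : ℂ)) (Q j k) (horizStrip δ) := fun p _ =>
      ofReal_mem_horizStrip hT.pos _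
    unfold ksKernel
    refine continuousOn_const.mul (ContinuousOn.sub ?_ ?_)
    · refine ContinuousOn.div (ContinuousOn.div ?_ ?_ fun p _ => hT.speed_ne k _ (m2 ‹_›))
        (ContinuousOn.sub ?_ ?_) fun p hp => sub_ne_zero.2 (hQne j k p hp)
      · exact (hT.diff_deriv k).continuousOn.comp c2 m2
      · exact (hT.speed_diff k).continuousOn.comp c2 m2
      · exact (hT.diff k).continuousOn.comp c2 m2
      · exact (hT.diff j).continuousOn.comp c1 m1
    · refine ContinuousOn.div (ContinuousOn.div ?_ ?_ fun p hp => hT.deriv_ne j _ (m1 hp))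
        (ContinuousOn.sub ?_ ?_) fun p hp => hT.conj_sub_ne (m1 hp) (hQne j k p hp)
      · exact (hT.speed_diff j).continuousOn.comp c1 m1
      · exact (hT.diff_deriv j).continuousOn.comp c1 m1
      · exact continuous_conj.comp_continuousOn ((hT.diff k).continuousOn.comp c2 m2)
      · exact (differentiableOn_conj_comp_conj (hT.diff j)).continuousOn.comp c1 m1
  choose B hB using hbound
  set M := ∑ j, ∑ k, |B j k| with hM
  have hBM : ∀ j k, ∀ p ∈ Q j k, ‖ksKernel Γ σ j p.1 k p.2‖ ≤ M := by
    intro j k p hp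
    refine (hB j k p hp).trans ((le_abs_self _).trans ?_)
    refine (Finset.single_le_sum (f := fun k => |B j k|) (fun _ _ => abs_nonneg _)
      (Finset.mem_univ k)).trans ?_
    exact Finset.single_le_sum (f := fun j => ∑ k, |B j k|)
      (fun _ _ => Finset.sum_nonneg fun _ _ => abs_nonneg _) (Finset.mem_univ j)
  have hM0 : 0 ≤ M := Finset.sum_nonneg fun _ _ => Finset.sum_nonneg fun _ _ => abs_nonneg _
  have main : ∀ j k, ∀ ζ ∈ horizStrip ρ, ∀ s : ℝ, ζ.re ∈ Icc (0 : ℝ) 1 → |ζ.re - s| ≤ 1 / 2 →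
      ‖ksKernel Γ σ j ζ k s‖ ≤ M := by
    intro j k ζ hζ s hre hs
    have hζ' : |ζ.im| < ρ := hζ
    have hs' := abs_le.1 hs
    by_cases hq : j = k → ρ ≤ ‖ζ - s‖
    · refine hBM j k (ζ, s) ⟨⟨⟨by linarith [hre.1], by linarith [hre.2]⟩,
        ⟨(abs_lt.1 hζ').1.le, (abs_lt.1 hζ').2.le⟩⟩, ⟨by linarith [hre.1], by linarith [hre.2]⟩,
        hs, hq⟩
    · push Not at hq
      obtain ⟨rfl, hlt⟩ := hq
      by_cases hne : ζ = s
      · rw [hT.ksKernel_of_eq (hstrip ζ hζ'.le) (by rw [hne]), norm_zero]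
        exact hM0
      have hre_le : ∀ w : ℂ, ‖w - s‖ ≤ ρ → |w.re - s| ≤ ρ ∧ |w.im| ≤ ρ := by
        intro w hw
        have h1 := (abs_re_le_norm (w - s)).trans hw
        have h2 := (abs_im_le_norm (w - s)).trans hw
        simp at h1 h2
        exact ⟨h1, h2⟩
      refine norm_le_of_punctured (U := horizStrip δ ∩ {w | |w.re - s| < 1 / 2}) (c := s) (r := ρ)
        (f := fun w => ksKernel Γ σ j w j s) ?_ ?_ ?_ (hT.tendsto_ksKernel j s) ?_ hlt hne
      · exact (isOpen_horizStrip δ).inter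
          (isOpen_lt (f := fun w : ℂ => |w.re - s|) (by fun_prop) continuous_const)
      · intro w hw
        rw [Metric.mem_closedBall, dist_eq_norm] at hw
        exact ⟨hstrip w (hre_le w hw).2, lt_of_le_of_lt (hre_le w hw).1 hρ2⟩
      · rintro w ⟨⟨hw1, hw2⟩, hw3⟩
        refine (hT.differentiableAt_ksKernel hw1 fun heq => hw3 ?_).differentiableWithinAt
        obtain ⟨-, m, hm⟩ := (hT.eq_conj_iff hw1 s).1 heq
        rw [mem_ofPred_eq, hm] at hw2
        simp only [add_re, ofReal_re, intCast_re, add_sub_cancel_left] at hw2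
        have h3 : |m| < 1 := by
          have : (|m| : ℝ) < 1 := by linarith
          exact_mod_cast this
        rw [Int.abs_lt_one_iff] at h3
        simp [hm, h3]
      · intro w hw
        have h1 := hre_le w hw.le
        have h2 := abs_le.1 h1.1
        refine hBM j j (w, s) ⟨⟨⟨?_, ?_⟩, abs_le.1 h1.2⟩, ⟨by linarith [hre.1], by linarith [hre.2]⟩,
          h1.1.trans hρ2.le, fun _ => hw.ge⟩
        · linarith [hre.1]
        · linarith [hre.2]
  refine ⟨M, fun j k ζ hζ s => ?_⟩
  -- The two variables may be shifted by different integers: `ζ` into the basic period, `s` to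
  -- within `1 / 2` of `Re ζ`.
  set m := round (ζ.re - s) with hm
  have h1 : ksKernel Γ σ j ζ k s =
      ksKernel Γ σ j (ζ + (-⌊ζ.re⌋ : ℤ)) k (s + (m - ⌊ζ.re⌋ : ℤ)) :=
    (hT.ksKernel_add_int j k ζ s _ _).symm
  rw [h1]
  refine main j k _ ((add_int_mem_horizStrip _).2 hζ) _ ?_ ?_
  · simpa [← sub_eq_add_neg] using
      And.intro (Int.fract_nonneg ζ.re) (Int.fract_lt_one ζ.re).le
  · have h2 := abs_sub_round (ζ.re - s)
    rw [← hm] at h2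
    have h3 : (ζ + ((-⌊ζ.re⌋ : ℤ) : ℂ)).re - (s + ((m - ⌊ζ.re⌋ : ℤ) : ℝ)) = ζ.re - s - m := by
      rw [add_re, intCast_re]
      push_cast
      ring
    rw [h3]
    exact h2

end IsTube

/-! ### Solution of the Kerzman–Stein equation. -/

/-- The measure on the parameter space of the boundary. -/
noncomputable def paramMeasure (n : ℕ) : Measure (Fin n × ℝ) :=
  (Measure.count : Measure (Fin n)).prod (volume.restrict (Ioc (0 : ℝ) 1))

instance : IsFiniteMeasure (paramMeasure n) := by unfold paramMeasure; infer_instance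

theorem integral_paramMeasure {F : Fin n × ℝ → ℂ} (hF : Integrable F (paramMeasure n)) :
    ∫ y, F y ∂(paramMeasure n) = ∑ k, ∫ s in (0 : ℝ)..1, F (k, s) := by
  unfold paramMeasure at hF ⊢
  rw [integral_prod _ hF, integral_fintype (by exact Integrable.of_finite)]
  refine Finset.sum_congr rfl fun k _ => ?_
  rw [intervalIntegral.integral_of_le zero_le_one]
  simp [Measure.real]

theorem ae_paramMeasure_of_countable {C : Set ℝ} (hC : C.Countable) :
    ∀ᵐ y ∂(paramMeasure n), y.2 ∉ C := by
  have h : paramMeasure n (univ ×ˢ C) = 0 := by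
    unfold paramMeasure
    rw [Measure.prod_prod, hC.measure_zero, mul_zero]
  rw [ae_iff]
  refine measure_mono_null ?_ h
  intro y hy
  simpa using hy

theorem measurable_of_continuous_slices {f : Fin n × ℝ → ℂ} (h : ∀ j, Continuous fun t => f (j, t)) :
    Measurable f :=
  measurable_from_prod_countable_right fun j => (h j).measurable

theorem exists_bound_of_periodic {f : ℝ → ℂ} (hf : Continuous f) (hp : Function.Periodic f 1) :
    ∃ B, ∀ t, ‖f t‖ ≤ B := by
  obtain ⟨B, hB⟩ := (isCompact_Icc (a := (0 : ℝ)) (b := 1)).exists_bound_of_continuousOn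
    hf.continuousOn
  refine ⟨B, fun t => ?_⟩
  have h := hp.sub_int_mul_eq (x := t) ⌊t⌋
  rw [mul_one] at h
  rw [← h]
  exact hB _ ⟨Int.fract_nonneg t, (Int.fract_lt_one t).le⟩

namespace IsTube

theorem continuous_real (hT : IsTube Ω γ δ Γ σ) {f : ℂ → ℂ} (hf : ContinuousOn f (horizStrip δ)) :
    Continuous fun t : ℝ => f t :=
  hf.comp_continuous continuous_ofReal (ofReal_mem_horizStrip hT.pos)

theorem measurable_ksKernel (hT : IsTube Ω γ δ Γ σ) (j : Fin n) (ζ : ℂ) :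
    Measurable fun y : Fin n × ℝ => ksKernel Γ σ j ζ y.1 y.2 := by
  have h1 : Measurable fun y : Fin n × ℝ => Γ y.1 y.2 :=
    measurable_of_continuous_slices fun k => hT.continuous_real (hT.diff k).continuousOn
  have h2 : Measurable fun y : Fin n × ℝ => deriv (Γ y.1) y.2 :=
    measurable_of_continuous_slices fun k => hT.continuous_real (hT.diff_deriv k).continuousOn
  have h3 : Measurable fun y : Fin n × ℝ => σ y.1 y.2 :=
    measurable_of_continuous_slices fun k => hT.continuous_real (hT.speed_diff k).continuousOn
  unfold ksKernel
  have h4 : Measurable fun y : Fin n × ℝ => conj (Γ y.1 y.2) := continuous_conj.measurable.comp h1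
  exact (((h2.div h3).div (h1.sub_const _)).sub ((h4.sub_const _).const_div _)).const_mul _

theorem measurable_ksKernel_real (hT : IsTube Ω γ δ Γ σ) :
    Measurable fun p : (Fin n × ℝ) × Fin n × ℝ => ksKernel Γ σ p.1.1 p.1.2 p.2.1 p.2.2 := by
  have h1 : Measurable fun y : Fin n × ℝ => Γ y.1 y.2 :=
    measurable_of_continuous_slices fun k => hT.continuous_real (hT.diff k).continuousOn
  have h2 : Measurable fun y : Fin n × ℝ => deriv (Γ y.1) y.2 :=
    measurable_of_continuous_slices fun k => hT.continuous_real (hT.diff_deriv k).continuousOn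
  have h3 : Measurable fun y : Fin n × ℝ => σ y.1 y.2 :=
    measurable_of_continuous_slices fun k => hT.continuous_real (hT.speed_diff k).continuousOn
  have h4 : Measurable fun y : Fin n × ℝ => conj (Γ y.1 y.2) := continuous_conj.measurable.comp h1
  unfold ksKernel
  simp only [conj_ofReal]
  exact ((((h2.div h3).comp measurable_snd).div
    ((h1.comp measurable_snd).sub (h1.comp measurable_fst))).sub
    (((h3.div h2).comp measurable_fst).div
      ((h4.comp measurable_snd).sub (h4.comp measurable_fst)))).const_mul _

/-- For real parameters `σ / Γ'` is the conjugate of `Γ' / σ`, so the second term is the conjugate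
of the first with the variables exchanged, and `(2 π i)⁻¹` is purely imaginary. -/
theorem ksKernel_skew (hT : IsTube Ω γ δ Γ σ) (j k : Fin n) (t s : ℝ) :
    ksKernel Γ σ j t k s = -conj (ksKernel Γ σ k s j t) := by
  have e : ∀ (l : Fin n) (x : ℝ), σ l x / deriv (Γ l) x = conj (deriv (Γ l) x / σ l x) := by
    intro l x
    have h1 := hT.speed_sq l x
    have h2 := hT.speed_ne l x (ofReal_mem_horizStrip hT.pos x)
    have h3 := hT.deriv_ne l x (ofReal_mem_horizStrip hT.pos x)
    rw [map_div₀, hT.conj_speed, div_eq_div_iff h3 h2, h1]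
    ring
  have e' : ∀ (l : Fin n) (x : ℝ), conj (σ l x / deriv (Γ l) x) = deriv (Γ l) x / σ l x := by
    intro l x
    rw [e, conj_conj]
  unfold ksKernel
  simp only [conj_ofReal, map_mul, map_sub, map_div₀ _ (deriv (Γ j) t / σ j t), map_inv₀, conj_I,
    map_div₀ _ (σ k s / deriv (Γ k) s), conj_conj, map_ofNat, e']
  rw [← e j t]
  rw [← neg_sub (conj (Γ j t)) (conj (Γ k s)), ← neg_sub (Γ j t) (Γ k s), div_neg, div_neg,
    mul_neg, inv_neg]
  ring

theorem differentiable_ksKernel_eventually (hT : IsTube Ω γ δ Γ σ) (j k : Fin n) (s : ℝ) {ζ : ℂ}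
    (hζ : ζ ∈ horizStrip δ) :
    ∀ᶠ ξ in 𝓝[≠] ζ, DifferentiableAt ℂ (fun ξ => ksKernel Γ σ j ξ k s) ξ := by
  have h1 := ((hT.analyticAt j hζ).differentiableAt.hasDerivAt).eventually_ne (c := Γ k s)
    (hT.deriv_ne j ζ hζ)
  filter_upwards [h1, nhdsWithin_le_nhds ((isOpen_horizStrip δ).mem_nhds hζ)] with ξ hξ hξ'
  exact hT.differentiableAt_ksKernel hξ' (Ne.symm hξ)

theorem ae_ne (hT : IsTube Ω γ δ Γ σ) (j : Fin n) {ζ : ℂ} (hζ : ζ ∈ horizStrip δ) :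
    ∀ᵐ y ∂(paramMeasure n), Γ y.1 y.2 ≠ Γ j ζ := by
  have hC : (range fun m : ℤ => ζ.re - m).Countable := countable_range _
  filter_upwards [ae_paramMeasure_of_countable hC] with y hy h
  obtain ⟨-, m, hm⟩ := (hT.eq_conj_iff hζ y.2).1 h
  refine hy ⟨m, ?_⟩
  simp [hm]

/-- The Kerzman–Stein integral equation has holomorphic solutions. -/
theorem exists_ks_solution (hT : IsTube Ω γ δ Γ σ) {c : Fin n → ℂ → ℂ} {r₀ : ℝ} (hr₀ : 0 < r₀)
    (hc : ∀ j, DifferentiableOn ℂ (c j) (horizStrip r₀)) (hcp : ∀ j, Function.Periodic (c j) 1) :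
    ∃ r > 0, r ≤ r₀ ∧ r ≤ δ ∧ ∃ S : Fin n → ℂ → ℂ, (∀ j, DifferentiableOn ℂ (S j) (horizStrip r)) ∧
      (∀ j, Function.Periodic (S j) 1) ∧ ∀ j, ∀ ζ ∈ horizStrip r, ζ.im ≠ 0 →
        S j ζ = c j ζ + ∑ k, ∫ s in (0 : ℝ)..1, ksKernel Γ σ j ζ k s * (σ k s * S k s) := by
  obtain ⟨ρ, hρ, hρmin⟩ := exists_between (lt_min (lt_min hr₀ hT.pos) (by norm_num : (0 : ℝ) < 1 / 2))
  have hρr : ρ < r₀ := hρmin.trans_le ((min_le_left _ _).trans (min_le_left _ _))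
  have hρδ : ρ < δ := hρmin.trans_le ((min_le_left _ _).trans (min_le_right _ _))
  have hρ2 : ρ < 1 / 2 := hρmin.trans_le (min_le_right _ _)
  obtain ⟨M, hM⟩ := hT.exists_ksKernel_bound hρ hρδ hρ2
  have hsub : horizStrip ρ ⊆ horizStrip δ := horizStrip_mono hρδ.le
  set μ := paramMeasure n
  -- The equation integrates against `σ k s ds`. Splitting the speed into square roots on both sides
  -- makes the kernel skew for the unweighted measure.
  set w : Fin n × ℝ → ℂ := fun x => (Real.sqrt ‖deriv (Γ x.1) x.2‖ : ℝ) with hw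
  have hww : ∀ x : Fin n × ℝ, w x * w x = σ x.1 x.2 := by
    intro x
    rw [hT.speed_eq, hw, ← ofReal_mul, Real.mul_self_sqrt (norm_nonneg _)]
  have hwconj : ∀ x, conj (w x) = w x := fun x => conj_ofReal _
  have hwc : ∀ j, Continuous fun t : ℝ => w (j, t) := fun j =>
    continuous_ofReal.comp (Real.continuous_sqrt.comp
      (hT.continuous_real (hT.diff_deriv j).continuousOn).norm)
  have hwm : Measurable w := measurable_of_continuous_slices hwc
  have hperR : ∀ {f : ℂ → ℂ}, Function.Periodic f 1 → Function.Periodic (fun t : ℝ => f t) 1 := by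
    intro f hf t
    have := hf t
    simp only [ofReal_add, ofReal_one]
    exact this
  have hwp : ∀ j, Function.Periodic (fun t : ℝ => w (j, t)) 1 := by
    intro j t
    have := hperR (hT.per j).deriv_complex t
    simp only at this
    simp only [hw, this]
  choose B hB using fun j => exists_bound_of_periodic (hwc j) (hwp j)
  set W := ∑ j, |B j| with hW
  have hW0 : 0 ≤ W := Finset.sum_nonneg fun _ _ => abs_nonneg _
  have hwW : ∀ x, ‖w x‖ ≤ W := fun x => (hB x.1 x.2).trans ((le_abs_self _).trans
    (Finset.single_le_sum (f := fun j => |B j|) (fun _ _ => abs_nonneg _) (Finset.mem_univ _)))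
  set K : Fin n × ℝ → Fin n × ℝ → ℂ := fun x y => w x * ksKernel Γ σ x.1 x.2 y.1 y.2 * w y with hK
  have hKm : StronglyMeasurable (Function.uncurry K) :=
    (((hwm.comp measurable_fst).mul hT.measurable_ksKernel_real).mul
      (hwm.comp measurable_snd)).stronglyMeasurable
  have hKb : ∀ x y, ‖K x y‖ ≤ W * M * W := by
    intro x y
    rw [hK, norm_mul, norm_mul]
    have h1 := hM x.1 y.1 x.2 (ofReal_mem_horizStrip hρ _) y.2
    have h0 : 0 ≤ M := (norm_nonneg _).trans h1
    have h2 := hwW x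
    have h3 := hwW y
    gcongr
  have hKs : ∀ x y, K x y = -conj (K y x) := by
    intro x y
    simp only [hK, map_mul, hwconj]
    rw [hT.ksKernel_skew]
    ring
  have hcc : ∀ j, Continuous fun t : ℝ => c j t := fun j =>
    (hc j).continuousOn.comp_continuous continuous_ofReal (ofReal_mem_horizStrip hr₀)
  choose B' hB' using fun j => exists_bound_of_periodic (hcc j) (hperR (hcp j))
  have hrhs : MemLp (fun x : Fin n × ℝ => w x * c x.1 x.2) 2 μ := by
    refine MemLp.of_bound (C := W * ∑ j, |B' j|) ?_ (ae_of_all _ fun x => ?_)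
    · exact (hwm.mul (measurable_of_continuous_slices hcc)).aestronglyMeasurable
    · rw [norm_mul]
      refine mul_le_mul (hwW x) ?_ (norm_nonneg _) hW0
      exact (hB' x.1 x.2).trans ((le_abs_self _).trans
        (Finset.single_le_sum (f := fun j => |B' j|) (fun _ _ => abs_nonneg _) (Finset.mem_univ _)))
  obtain ⟨v, hv, hveq⟩ := exists_solution_of_skew hKm hKb hKs hrhs
  set gv : Fin n × ℝ → ℂ := fun y => w y * v y with hgv
  have hgvi : Integrable gv μ :=
    Integrable.bdd_mul (c := W) (hv.integrable one_le_two) hwm.aestronglyMeasurable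
      (ae_of_all _ hwW)
  -- For every `y` the punctured limit makes the kernel holomorphic in `ζ` on the whole strip. It
  -- differs from the kernel only for a null set of `y`.
  set A : Fin n → ℂ → Fin n × ℝ → ℂ :=
    fun j ζ y => limUnder (𝓝[≠] ζ) fun ξ => ksKernel Γ σ j ξ y.1 y.2 with hA
  have hAeq : ∀ j, ∀ ζ ∈ horizStrip ρ, ∀ y : Fin n × ℝ, Γ y.1 y.2 ≠ Γ j ζ →
      A j ζ y = ksKernel Γ σ j ζ y.1 y.2 := by
    intro j ζ hζ y hy
    exact ((hT.differentiableAt_ksKernel (hsub hζ) hy).continuousAt.tendsto.mono_left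
      nhdsWithin_le_nhds).limUnder_eq
  have hAae : ∀ j, ∀ ζ ∈ horizStrip ρ, ∀ᵐ y ∂μ, A j ζ y = ksKernel Γ σ j ζ y.1 y.2 := by
    intro j ζ hζ
    filter_upwards [hT.ae_ne j (hsub hζ)] with y hy using hAeq j ζ hζ y hy
  have hAb : ∀ j, ∀ ζ ∈ horizStrip ρ, ∀ y, ‖A j ζ y‖ ≤ M := by
    intro j ζ hζ y
    have h1 := tendsto_limUnder_of_bound (isOpen_horizStrip ρ) (fun ξ hξ => hM j y.1 ξ hξ y.2)
      (fun ξ hξ => hT.differentiable_ksKernel_eventually j y.1 y.2 (hsub hξ)) hζ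
    refine le_of_tendsto h1.norm ?_
    filter_upwards [nhdsWithin_le_nhds ((isOpen_horizStrip ρ).mem_nhds hζ)] with ξ hξ
    exact hM j y.1 ξ hξ y.2
  have hAd : ∀ j y, DifferentiableOn ℂ (fun ζ => A j ζ y) (horizStrip ρ) := fun j y =>
    differentiableOn_limUnder (isOpen_horizStrip ρ) (fun ξ hξ => hM j y.1 ξ hξ y.2)
      (fun ξ hξ => hT.differentiable_ksKernel_eventually j y.1 y.2 (hsub hξ))
  -- The right-hand side of the equation makes sense for complex `ζ`; it defines the holomorphic
  -- continuation of the square integrable solution.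
  set S : Fin n → ℂ → ℂ := fun j ζ => c j ζ + ∫ y, A j ζ y * gv y ∂μ with hS
  have hSv : ∀ᵐ x ∂μ, gv x = σ x.1 x.2 * S x.1 x.2 := by
    filter_upwards [hveq] with x hx
    have h1 : ∫ y, K x y * v y ∂μ = w x * ∫ y, A x.1 x.2 y * gv y ∂μ := by
      rw [← integral_const_mul]
      refine integral_congr_ae ?_
      filter_upwards [hAae x.1 x.2 (ofReal_mem_horizStrip hρ _)] with y hy
      rw [hy]
      simp only [hK, hgv]
      ring
    rw [h1] at hx
    simp only [hgv, hS]
    rw [hx, ← hww x]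
    ring
  have hSint : ∀ j, ∀ ζ ∈ horizStrip ρ, S j ζ = c j ζ +
      ∑ k, ∫ s in (0 : ℝ)..1, ksKernel Γ σ j ζ k s * (σ k s * S k s) := by
    intro j ζ hζ
    have h1 : ∫ y, A j ζ y * gv y ∂μ =
        ∫ y, ksKernel Γ σ j ζ y.1 y.2 * (σ y.1 y.2 * S y.1 y.2) ∂μ := by
      refine integral_congr_ae ?_
      filter_upwards [hAae j ζ hζ, hSv] with y h2 h3
      rw [h2, h3]
    have h2 : Integrable (fun y : Fin n × ℝ =>
        ksKernel Γ σ j ζ y.1 y.2 * (σ y.1 y.2 * S y.1 y.2)) μ := by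
      refine (Integrable.bdd_mul (c := M) hgvi (hT.measurable_ksKernel j ζ).aestronglyMeasurable
        (ae_of_all _ fun y => hM j y.1 ζ hζ y.2)).congr ?_
      filter_upwards [hSv] with y h3
      rw [h3]
    rw [← integral_paramMeasure h2]
    simp only [hS] at h1 ⊢
    rw [h1]
  refine ⟨ρ, hρ, hρr.le, hρδ.le, S, fun j => ?_, fun j ζ => ?_, fun j ζ hζ _ => hSint j ζ hζ⟩
  · refine ((hc j).mono (horizStrip_mono hρr.le)).add ?_
    refine differentiableOn_integral_of_norm_le (f := fun ζ y => A j ζ y * gv y)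
      (b := fun y => M * ‖gv y‖) (isOpen_horizStrip ρ) (hgvi.norm.const_mul M) ?_ ?_ ?_
    · exact fun y => (hAd j y).mul_const _
    · intro ζ hζ
      refine AEStronglyMeasurable.congr
        (((hT.measurable_ksKernel j ζ).aestronglyMeasurable).mul hgvi.1) ?_
      filter_upwards [hAae j ζ hζ] with y hy
      rw [Pi.mul_apply, hy]
    · intro y ζ hζ
      rw [norm_mul]
      exact mul_le_mul_of_nonneg_right (hAb j ζ hζ y) (norm_nonneg _)
  · have h1 : ∀ y, A j (ζ + 1) y = A j ζ y := by
      intro y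
      have h2 := (Homeomorph.addRight (1 : ℂ)).map_punctured_nhds_eq ζ
      simp only [Homeomorph.coe_addRight] at h2
      simp only [hA, limUnder]
      rw [← h2, map_map]
      congr 2
      funext ξ
      have := hT.ksKernel_add_int j y.1 ξ y.2 1 0
      simpa using this
    simp only [hS, h1, hcp j ζ]

end IsTube

/-! ### Functions on the tube and their Cauchy integrals on both sides. -/

theorem eqOn_zero_of_ofReal_eq_zero {f : ℂ → ℂ} {r : ℝ} (hr : 0 < r)
    (hf : DifferentiableOn ℂ f (horizStrip r)) (h0 : ∀ t : ℝ, f t = 0) :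
    ∀ ζ ∈ horizStrip r, f ζ = 0 := by
  have h1 : AnalyticOnNhd ℂ f (horizStrip r) := hf.analyticOnNhd (isOpen_horizStrip r)
  refine h1.eqOn_zero_of_preconnected_of_frequently_eq_zero (convex_horizStrip r).isPreconnected
    (ofReal_mem_horizStrip hr 0) ?_
  have h2 : Tendsto (fun t : ℝ => (t : ℂ)) (𝓝[≠] 0) (𝓝[≠] ((0 : ℝ) : ℂ)) := by
    refine (Complex.continuous_ofReal.tendsto 0).inf ?_
    refine tendsto_principal_principal.2 fun t ht => ?_
    simpa using ht
  exact h2.frequently (Eventually.of_forall fun t => h0 t).frequently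

open Classical in
/-- The function on a tube whose composition with each chart is a given function on a strip. -/
noncomputable def tubeLift (Γ : Fin n → ℂ → ℂ) (δ : ℝ) (φ : Fin n → ℂ → ℂ) (z : ℂ) : ℂ :=
  if h : ∃ p : Fin n × ℂ, p.2 ∈ horizStrip δ ∧ Γ p.1 p.2 = z then φ h.choose.1 h.choose.2 else 0

namespace IsTube

theorem tubeLift_apply (hT : IsTube Ω γ δ Γ σ) {η : ℝ} (hη : η ≤ δ) {φ : Fin n → ℂ → ℂ}
    (hφ : ∀ j, Function.Periodic (φ j) 1) (j : Fin n) {ζ : ℂ} (hζ : ζ ∈ horizStrip η) :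
    tubeLift Γ η φ (Γ j ζ) = φ j ζ := by
  have h : ∃ p : Fin n × ℂ, p.2 ∈ horizStrip η ∧ Γ p.1 p.2 = Γ j ζ := ⟨(j, ζ), hζ, rfl⟩
  unfold tubeLift
  rw [dif_pos h]
  obtain ⟨h1, h2⟩ := h.choose_spec
  obtain ⟨h3, m, h4⟩ := hT.inj _ _ _ (horizStrip_mono hη h1) _ (horizStrip_mono hη hζ) h2
  generalize h.choose = p at *
  obtain ⟨k, ξ⟩ := p
  simp only at h3 h4
  subst h3
  rw [h4, (hφ k).apply_add_int]

theorem differentiableAt_tube (hT : IsTube Ω γ δ Γ σ) {X : ℂ → ℂ} {j : Fin n} {ζ : ℂ}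
    (hζ : ζ ∈ horizStrip δ) (hX : DifferentiableAt ℂ (fun ζ => X (Γ j ζ)) ζ) :
    DifferentiableAt ℂ X (Γ j ζ) := by
  obtain ⟨ψ, h1, h2, -, -, h3⟩ := (hT.analyticAt j hζ).exists_analytic_inverse (hT.deriv_ne j ζ hζ)
  have h4 : DifferentiableAt ℂ (fun w => X (Γ j (ψ w))) (Γ j ζ) :=
    DifferentiableAt.comp (g := fun ζ => X (Γ j ζ)) _ (by rwa [h2]) h1.differentiableAt
  refine h4.congr_of_eventuallyEq ?_
  filter_upwards [h3] with w hw
  rw [hw]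

theorem differentiableOn_tube (hT : IsTube Ω γ δ Γ σ) {η : ℝ} (hη : η ≤ δ) {X : ℂ → ℂ}
    (hX : ∀ j, DifferentiableOn ℂ (fun ζ => X (Γ j ζ)) (horizStrip η)) :
    DifferentiableOn ℂ X (tube Γ η) := by
  rintro _ ⟨j, ζ, hζ, rfl⟩
  exact (hT.differentiableAt_tube (horizStrip_mono hη hζ)
    ((hX j).differentiableAt ((isOpen_horizStrip η).mem_nhds hζ))).differentiableWithinAt

theorem differentiableOn_tubeLift (hT : IsTube Ω γ δ Γ σ) {η : ℝ} (hη : η ≤ δ)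
    {φ : Fin n → ℂ → ℂ} (hφ : ∀ j, Function.Periodic (φ j) 1)
    (hd : ∀ j, DifferentiableOn ℂ (φ j) (horizStrip η)) :
    DifferentiableOn ℂ (tubeLift Γ η φ) (tube Γ η) :=
  hT.differentiableOn_tube hη fun j => (hd j).congr fun _ hζ => hT.tubeLift_apply hη hφ j hζ

theorem comp_strip (hT : IsTube Ω γ δ Γ σ) {η : ℝ} (hη : η ≤ δ) {X : ℂ → ℂ}
    (hX : DifferentiableOn ℂ X (tube Γ η)) (j : Fin n) :
    DifferentiableOn ℂ (fun ζ => X (Γ j ζ)) (horizStrip η) :=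
  hX.comp ((hT.diff j).mono (horizStrip_mono hη)) fun ζ hζ => ⟨j, ζ, hζ, rfl⟩

theorem shift_of_tube (hT : IsTube Ω γ δ Γ σ) {y₁ y₂ : ℝ} (h₁ : -δ < y₁) (h : y₁ ≤ y₂)
    (h₂ : y₂ < δ) {F : ℂ → ℂ} (hF : DifferentiableOn ℂ F (tube Γ δ)) {z : ℂ}
    (hz : ∀ j, ∀ ξ ∈ {ξ : ℂ | y₁ ≤ ξ.im ∧ ξ.im ≤ y₂}, Γ j ξ ≠ z) :
    cauchyT Γ y₁ F z = cauchyT Γ y₂ F z :=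
  hT.cauchyT_shift h₁ h h₂
    (fun j => ((hT.comp_strip le_rfl hF j).mono (strip_subset h₁ h₂)).continuousOn)
    (fun j => (hT.comp_strip le_rfl hF j).mono (open_strip_subset h₁ h₂)) hz

theorem jump_of_tube (hT : IsTube Ω γ δ Γ σ) {y₁ y₂ : ℝ} (h₁ : -δ < y₁) (h₂ : y₂ < δ)
    {F : ℂ → ℂ} (hF : DifferentiableOn ℂ F (tube Γ δ)) (k : Fin n) {ζ : ℂ} (hζ₁ : y₁ < ζ.im)
    (hζ₂ : ζ.im < y₂) :
    cauchyT Γ y₁ F (Γ k ζ) = cauchyT Γ y₂ F (Γ k ζ) + F (Γ k ζ) :=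
  hT.cauchyT_jump h₁ h₂ k hζ₁ hζ₂
    (fun j => ((hT.comp_strip le_rfl hF j).mono (strip_subset h₁ h₂)).continuousOn)
    (fun j => (hT.comp_strip le_rfl hF j).mono (open_strip_subset h₁ h₂))

theorem continuous_line_of_tube (hT : IsTube Ω γ δ Γ σ) {y : ℝ} (hy : |y| < δ) {F : ℂ → ℂ}
    (hF : DifferentiableOn ℂ F (tube Γ δ)) (j : Fin n) :
    Continuous fun t : ℝ => F (Γ j (t + y * I)) :=
  continuous_line (f := fun ζ => F (Γ j ζ)) hy (hT.comp_strip le_rfl hF j).continuousOn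

theorem line_ne_of_im_ne (hT : IsTube Ω γ δ Γ σ) {y : ℝ} (hy : |y| < δ) {j k : Fin n} {ζ : ℂ}
    (hζ : ζ ∈ horizStrip δ) (h : ζ.im ≠ y) (t : ℝ) : Γ j (t + y * I) ≠ Γ k ζ := by
  refine hT.ne_of_im_lt (line_mem_horizStrip hy t) hζ ?_
  simpa using h.symm

theorem line_ne_of_notMem (hT : IsTube Ω γ δ Γ σ) {y : ℝ} (hy0 : 0 ≤ y) (hy : y < δ) {j : Fin n}
    {z : ℂ} (hz : z ∉ closure Ω) (t : ℝ) : Γ j (t + y * I) ≠ z := by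
  rintro rfl
  refine hz ((hT.apply_mem_closure_iff j (line_mem_horizStrip ?_ t)).2 (by simpa using hy0))
  rwa [abs_of_nonneg hy0]

theorem differentiable_cauchyT_strip (hT : IsTube Ω γ δ Γ σ) {y : ℝ} (hy : 0 ≤ y) (hyδ : y < δ)
    {g : ℂ → ℂ} (hg : ∀ j, Continuous fun t : ℝ => g (Γ j (t + y * I))) (k : Fin n) {ζ : ℂ}
    (hζ : ζ ∈ horizStrip δ) (h : ζ.im ≠ y) :
    DifferentiableAt ℂ (fun ζ => cauchyT Γ y g (Γ k ζ)) ζ := by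
  have hy' : |y| < δ := by rwa [abs_of_nonneg hy]
  exact DifferentiableAt.comp (g := cauchyT Γ y g) ζ (hT.differentiableAt_cauchyT hy' hg
    fun j t => hT.line_ne_of_im_ne hy' hζ h t) (hT.analyticAt k hζ).differentiableAt

/-- From `(w - a) / (ξ - w) = (ξ - a) / (ξ - w) - 1`. It shows that `(w - a)` times a Cauchy
integral stays bounded at infinity. -/
theorem sub_mul_cauchyT (hT : IsTube Ω γ δ Γ σ) {y : ℝ} (hy : |y| < δ)
    {g : ℂ → ℂ} (hg : ∀ j, Continuous fun t : ℝ => g (Γ j (t + y * I))) (a : ℂ) {w : ℂ}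
    (hw : ∀ j (t : ℝ), Γ j (t + y * I) ≠ w) :
    (w - a) * cauchyT Γ y g w = cauchyT Γ y (fun ξ => (ξ - a) * g ξ) w -
      (2 * Real.pi * I : ℂ)⁻¹ * heightIntegral Γ y g := by
  unfold cauchyT heightIntegral
  rw [← mul_sub, ← Finset.sum_sub_distrib, ← mul_assoc, mul_comm (w - a), mul_assoc,
    Finset.mul_sum]
  congr 1
  refine Finset.sum_congr rfl fun j _ => ?_
  have hΓ : Continuous fun t : ℝ => Γ j (t + y * I) := continuous_line hy (hT.diff j).continuousOn
  have hΓ' : Continuous fun t : ℝ => deriv (Γ j) (t + y * I) :=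
    continuous_line hy (hT.diff_deriv j).continuousOn
  have hne : ∀ t : ℝ, Γ j (t + y * I) - w ≠ 0 := fun t => sub_ne_zero.2 (hw j t)
  rw [← intervalIntegral.integral_const_mul, ← intervalIntegral.integral_sub]
  · refine intervalIntegral.integral_congr fun t _ => ?_
    have := hne t
    simp only
    field_simp
    ring
  · exact (((((hΓ.sub continuous_const).mul (hg j))).div (hΓ.sub continuous_const) hne).mul
      hΓ').intervalIntegrable _ _
  · exact ((hg j).mul hΓ').intervalIntegrable _ _

/-- The exterior version of Cauchy's theorem for a product of two Cauchy integrals. -/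
theorem heightIntegral_mul_cauchyT (hT : IsTube Ω γ δ Γ σ) {y : ℝ} (hy : 0 < y) (hyδ : y < δ)
    {g₁ g₂ : ℂ → ℂ} (hg₁ : ∀ j, Continuous fun t : ℝ => g₁ (Γ j (t + y * I)))
    (hg₂ : ∀ j, Continuous fun t : ℝ => g₂ (Γ j (t + y * I))) :
    heightIntegral Γ 0 (fun w => cauchyT Γ y g₁ w * cauchyT Γ y g₂ w) = 0 := by
  obtain ⟨a, ha⟩ := hT.dom.isConnected.nonempty
  have hy' : |y| < δ := by rwa [abs_of_pos hy]
  have hΓ : ∀ j, Continuous fun t : ℝ => Γ j (t + y * I) := fun j =>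
    continuous_line hy' (hT.diff j).continuousOn
  -- The product of two Cauchy integrals decays quadratically, so it still tends to zero after
  -- multiplication by `w - a`. At the point `a` this factor cancels the Cauchy denominator.
  set h : ℂ → ℂ := fun w => (w - a) * (cauchyT Γ y g₁ w * cauchyT Γ y g₂ w) with hh
  have hd1 : ∀ {z}, (∀ j (t : ℝ), Γ j (t + y * I) ≠ z) → DifferentiableAt ℂ h z := fun hz =>
    (differentiableAt_id.sub_const a).mul ((hT.differentiableAt_cauchyT hy' hg₁ hz).mul
      (hT.differentiableAt_cauchyT hy' hg₂ hz))
  have hstrip : ∀ k ζ, ζ ∈ horizStrip y → DifferentiableAt ℂ h (Γ k ζ) := fun k ζ hζ =>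
    hd1 fun j t => hT.line_ne_of_im_ne hy' (horizStrip_mono hyδ.le hζ) (mem_horizStrip.1 hζ).2.ne t
  have hT' := hT.mono hy hyδ.le
  have hht : DifferentiableOn ℂ h (tube Γ y) := by
    rintro _ ⟨k, ζ, hζ, rfl⟩
    exact (hstrip k ζ hζ).differentiableWithinAt
  set η := y / 2 with hη
  have hηy : η < y := by rw [hη]; linarith
  have hη0 : 0 < η := by positivity
  have hline0 : ∀ j, Continuous fun t : ℝ => h (Γ j (t + (0 : ℝ) * I)) :=
    hT'.continuous_line_of_tube (by simpa using hy) hht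
  have hηm : |(-η)| < y := by rwa [abs_neg, abs_of_pos hη0]
  -- Here the roles of the sides are reversed: `h` is holomorphic outside and near the boundary, the
  -- inner correction is zero and the glued function is the transform from a contour outside `Ω`.
  have key := hT'.eq_zero_of_glue (y := 0) le_rfl hη0 hηy.le (h := h) (Fi := fun _ => 0) (Fo := h)
    (X := cauchyT Γ (-η) h) hline0 (differentiableOn_const 0) ?_ ?_ ?_ ?_ ?_
  · have h1 := key.1 a ha ?_
    · rw [add_zero, cauchyT] at h1
      replace h1 := (mul_eq_zero.1 h1).resolve_left (inv_ne_zero two_pi_I_ne)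
      rw [← h1]
      unfold heightIntegral
      refine Finset.sum_congr rfl fun j _ => intervalIntegral.integral_congr fun t _ => ?_
      have : Γ j (t + (0 : ℝ) * I) - a ≠ 0 := by
        intro h2
        rw [sub_eq_zero] at h2
        have h3 := (hT.apply_mem_iff j (line_mem_horizStrip (by simpa using hT.pos) t)).1 (h2 ▸ ha)
        simp at h3
      simp only [hh]
      rw [mul_div_cancel_left₀ _ this]
    · rintro ⟨j, ζ, hζ1, hζ2, rfl⟩
      have hs : ζ ∈ horizStrip δ := mem_horizStrip.2 ⟨by linarith [hT.pos], by linarith [hT.pos]⟩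
      have := (hT.apply_mem_iff j hs).1 ha
      linarith
  · intro z hz
    exact (hd1 fun j t => hT.line_ne_of_notMem hy.le hyδ hz t).differentiableWithinAt
  · have e : h =ᶠ[cocompact ℂ] fun w => (cauchyT Γ y (fun ξ => (ξ - a) * g₁ ξ) w -
      (2 * Real.pi * I : ℂ)⁻¹ * heightIntegral Γ y g₁) * cauchyT Γ y g₂ w := by
      have hc : IsCompact (slab Γ y y) := hT.isCompact_slab (by linarith) hyδ
      filter_upwards [hc.compl_mem_cocompact] with w hw
      rw [← hT.sub_mul_cauchyT hy' hg₁ a]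
      · simp only [hh]
        ring
      · rintro j t rfl
        exact hw ⟨j, _, by simp, by simp, rfl⟩
    refine Tendsto.congr' e.symm ?_
    have h1 := hT.tendsto_cauchyT hy' (g := fun ξ => (ξ - a) * g₁ ξ)
      fun j => ((hΓ j).sub continuous_const).mul (hg₁ j)
    have h2 := (h1.sub_const ((2 * Real.pi * I : ℂ)⁻¹ * heightIntegral Γ y g₁)).mul
      (hT.tendsto_cauchyT hy' hg₂)
    simpa using h2
  · rintro _ ⟨k, ζ, hζ, rfl⟩
    refine (hT'.differentiableAt_cauchyT hηm (hT'.continuous_line_of_tube hηm hht)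
      fun j t => ?_).differentiableWithinAt
    exact hT'.line_ne_of_im_ne hηm (horizStrip_mono hηy.le hζ) (mem_horizStrip.1 hζ).1.ne' t
  · intro j ζ h1 h2
    rw [add_zero]
    symm
    refine hT'.shift_of_tube (by linarith) (by linarith) hy hht fun k ξ hξ => ?_
    have h3 : ζ ∈ horizStrip y := mem_horizStrip.2 ⟨by linarith, by linarith⟩
    exact hT'.ne_of_im_lt (mem_horizStrip.2 ⟨by linarith [hξ.1], by linarith [hξ.2]⟩) h3
      (by linarith [hξ.2] : ξ.im < ζ.im).ne
  · intro j ζ h1 h2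
    exact (hT'.jump_of_tube (by linarith) hy hht j h1 h2).symm

/-- A function near the boundary whose Cauchy integral vanishes outside the domain is the boundary
value of a holomorphic function. -/
theorem exists_extension_of_cauchyT_eq_zero (hT : IsTube Ω γ δ Γ σ) {η : ℝ} (hη : 0 < η)
    (hηδ : η < δ) {F : ℂ → ℂ} (hF : DifferentiableOn ℂ F (tube Γ δ))
    (h0 : ∀ j, ∀ ζ ∈ horizStrip η, cauchyT Γ η F (Γ j ζ) = 0) :
    ∃ H : ℂ → ℂ, AnalyticOnNhd ℂ H (closure Ω) ∧ ∀ z ∈ frontier Ω, H z = F z := by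
  classical
  have hline := hT.continuous_line_of_tube (y := 0) (by simpa using hT.pos) hF
  have hΩd : DifferentiableOn ℂ (cauchyT Γ 0 F) Ω := fun z hz =>
    (hT.differentiableAt_cauchyT (by simpa using hT.pos) hline (by
      rintro j t rfl
      have := (hT.apply_mem_iff j (line_mem_horizStrip (by simpa using hT.pos) t)).1 hz
      simp at this)).differentiableWithinAt
  -- Such a point lies between the heights `0` and `η`, so its transform jumps by `F` from the
  -- transform at height `η`, which vanishes.
  have hagree : ∀ z ∈ Ω, z ∈ tube Γ η → cauchyT Γ 0 F z = F z := by
    rintro _ hz ⟨j, ζ, hζ, rfl⟩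
    have h1 := (hT.apply_mem_iff j (horizStrip_mono hηδ.le hζ)).1 hz
    rw [hT.jump_of_tube (by linarith) hηδ hF j h1 (mem_horizStrip.1 hζ).2, h0 j ζ hζ, zero_add]
  have htube := hT.isOpen_tube hηδ.le
  set H : ℂ → ℂ := fun z => if z ∈ tube Γ η then F z else cauchyT Γ 0 F z with hH
  have hHt : EqOn H F (tube Γ η) := fun z hz => if_pos hz
  have hHΩ : EqOn H (cauchyT Γ 0 F) Ω := fun z hz => by
    by_cases h : z ∈ tube Γ η
    · rw [hHt h, hagree z hz h]
    · exact if_neg h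
  refine ⟨H, ?_, fun z hz => hHt (hT.frontier_subset_tube hη hz)⟩
  have hd : DifferentiableOn ℂ H (tube Γ η ∪ Ω) := by
    refine DifferentiableOn.union_of_isOpen ?_ ?_ htube hT.dom.isOpen
    · exact (hF.mono (tube_mono hηδ.le)).congr hHt
    · exact hΩd.congr hHΩ
  refine (hd.analyticOnNhd (htube.union hT.dom.isOpen)).mono fun z hz => ?_
  by_cases h : z ∈ Ω
  · exact Or.inr h
  · refine Or.inl (hT.frontier_subset_tube hη ?_)
    rw [hT.dom.isOpen.frontier_eq]
    exact ⟨hz, h⟩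

end IsTube

/-! ### Decomposition of boundary functions as `h + conj (k T)`. -/

theorem eq_zero_of_sum_integral_eq_zero {F : Fin n → ℝ → ℝ} (hF : ∀ j, Continuous (F j))
    (hp : ∀ j, Function.Periodic (F j) 1) (h0 : ∀ j t, 0 ≤ F j t)
    (h : ∑ j, ∫ t in (0 : ℝ)..1, F j t = 0) (j : Fin n) (t : ℝ) : F j t = 0 := by
  have h1 := (Finset.sum_eq_zero_iff_of_nonneg (fun j _ =>
    intervalIntegral.integral_nonneg zero_le_one fun t _ => h0 j t)).1 h j (Finset.mem_univ j)
  have h2 : ∀ s ∈ Icc (0 : ℝ) 1, F j s = 0 := by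
    by_contra! hcon
    obtain ⟨s, hs, hs'⟩ := hcon
    have := intervalIntegral.integral_pos zero_lt_one (hF j).continuousOn (fun x _ => h0 j x)
      ⟨s, hs, lt_of_le_of_ne (h0 j s) hs'.symm⟩
    linarith
  have h3 := (hp j).sub_int_mul_eq (x := t) ⌊t⌋
  rw [mul_one] at h3
  rw [← h3]
  exact h2 _ ⟨Int.fract_nonneg t, (Int.fract_lt_one t).le⟩

theorem cauchyT_zero_apply (Γ : Fin n → ℂ → ℂ) (h : ℂ → ℂ) (z : ℂ) :
    cauchyT Γ 0 h z = (2 * Real.pi * I : ℂ)⁻¹ *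
      ∑ j, ∫ t in (0 : ℝ)..1, h (Γ j t) / (Γ j t - z) * deriv (Γ j) t := by
  simp [cauchyT, heightIntegral]

theorem conj_intervalIntegral (f : ℝ → ℂ) (a b : ℝ) :
    conj (∫ t in a..b, f t) = ∫ t in a..b, conj (f t) := by
  simp only [intervalIntegral, map_sub, integral_conj]

namespace IsTube

theorem deriv_periodic (hT : IsTube Ω γ δ Γ σ) (j : Fin n) : Function.Periodic (deriv (Γ j)) 1 :=
  (hT.per j).deriv_complex

theorem cauchyT_add (hT : IsTube Ω γ δ Γ σ) {y : ℝ} (hy : |y| < δ) {g₁ g₂ : ℂ → ℂ}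
    (hg₁ : ∀ j, Continuous fun t : ℝ => g₁ (Γ j (t + y * I)))
    (hg₂ : ∀ j, Continuous fun t : ℝ => g₂ (Γ j (t + y * I))) {z : ℂ}
    (hz : ∀ j (t : ℝ), Γ j (t + y * I) ≠ z) :
    cauchyT Γ y (fun w => g₁ w + g₂ w) z = cauchyT Γ y g₁ z + cauchyT Γ y g₂ z := by
  unfold cauchyT heightIntegral
  rw [← mul_add, ← Finset.sum_add_distrib]
  congr 1
  refine Finset.sum_congr rfl fun j _ => ?_
  have hΓ : Continuous fun t : ℝ => Γ j (t + y * I) := continuous_line hy (hT.diff j).continuousOn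
  have hΓ' : Continuous fun t : ℝ => deriv (Γ j) (t + y * I) :=
    continuous_line hy (hT.diff_deriv j).continuousOn
  have hne : ∀ t : ℝ, Γ j (t + y * I) - z ≠ 0 := fun t => sub_ne_zero.2 (hz j t)
  rw [← intervalIntegral.integral_add]
  · refine intervalIntegral.integral_congr fun t _ => ?_
    simp only
    ring
  · exact ((((hg₁ j)).div (hΓ.sub continuous_const) hne).mul hΓ').intervalIntegrable _ _
  · exact ((((hg₂ j)).div (hΓ.sub continuous_const) hne).mul hΓ').intervalIntegrable _ _

/-- Off the real axis the two terms of the kernel can be integrated separately. With `f = S` and `g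
= conj (S T)` on the boundary they become a Cauchy integral of `f` and a conjugated Cauchy integral
of `g` at the reflected point. -/
theorem sum_integral_ksKernel (hT : IsTube Ω γ δ Γ σ) {S : Fin n → ℂ → ℂ} {f g : ℂ → ℂ}
    (hSc : ∀ k, Continuous fun t : ℝ => S k t)
    (hf : ∀ k (t : ℝ), f (Γ k t) = S k t)
    (hg : ∀ k (t : ℝ), g (Γ k t) * deriv (Γ k) t = conj (S k t) * σ k t)
    (j : Fin n) {ζ : ℂ} (hζ : ζ ∈ horizStrip δ) (hζ0 : ζ.im ≠ 0) :
    ∑ k, ∫ s in (0 : ℝ)..1, ksKernel Γ σ j ζ k s * (σ k s * S k s) =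
      cauchyT Γ 0 f (Γ j ζ) + σ j ζ / deriv (Γ j) ζ * conj (cauchyT Γ 0 g (Γ j (conj ζ))) := by
  have hζ' : conj ζ ∈ horizStrip δ := conj_mem_horizStrip.2 hζ
  rw [cauchyT_zero_apply, cauchyT_zero_apply, map_mul, map_sum, Finset.mul_sum, Finset.mul_sum,
    Finset.mul_sum, ← Finset.sum_add_distrib]
  refine Finset.sum_congr rfl fun k _ => ?_
  have hne : ∀ s : ℝ, Γ k s - Γ j ζ ≠ 0 := fun s => by
    refine sub_ne_zero.2 (hT.ne_of_im_lt (ofReal_mem_horizStrip hT.pos s) hζ ?_)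
    simpa using hζ0.symm
  have hne' : ∀ s : ℝ, conj (Γ k s) - conj (Γ j (conj ζ)) ≠ 0 := fun s =>
    hT.conj_sub_ne hζ (sub_ne_zero.1 (hne s))
  have hσ0 : ∀ s : ℝ, σ k s ≠ 0 := fun s => hT.speed_ne k _ (ofReal_mem_horizStrip hT.pos s)
  have hΓ : Continuous fun t : ℝ => Γ k t := hT.continuous_real (hT.diff k).continuousOn
  have hσc : Continuous fun t : ℝ => σ k t := hT.continuous_real (hT.speed_diff k).continuousOn
  have hΓ' : Continuous fun t : ℝ => deriv (Γ k) t := hT.continuous_real (hT.diff_deriv k).continuousOn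
  rw [conj_intervalIntegral, ← intervalIntegral.integral_const_mul,
    ← intervalIntegral.integral_const_mul, ← intervalIntegral.integral_const_mul,
    ← intervalIntegral.integral_add]
  · refine intervalIntegral.integral_congr fun s _ => ?_
    have h1 := hne s
    have h2 := hne' s
    have h3 := hσ0 s
    have h4 : conj (g (Γ k s) / (Γ k s - Γ j (conj ζ)) * deriv (Γ k) s) =
        S k s * σ k s / (conj (Γ k s) - conj (Γ j (conj ζ))) := by
      rw [div_mul_eq_mul_div, hg, map_div₀, map_mul, conj_conj, hT.conj_speed, map_sub]
    simp only [ksKernel]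
    rw [h4, hf]
    have h5 : conj (2 * Real.pi * I : ℂ)⁻¹ = -(2 * Real.pi * I : ℂ)⁻¹ := by
      rw [map_inv₀]
      simp [inv_neg, map_ofNat]
    rw [h5]
    field_simp
    ring
  · have : (fun s : ℝ => (2 * Real.pi * I : ℂ)⁻¹ *
        (f (Γ k s) / (Γ k s - Γ j ζ) * deriv (Γ k) s)) = fun s : ℝ => (2 * Real.pi * I : ℂ)⁻¹ *
        (S k s / (Γ k s - Γ j ζ) * deriv (Γ k) s) := by
      funext s
      rw [hf]
    rw [this]
    exact (continuous_const.mul (((hSc k).div (hΓ.sub continuous_const) hne).mul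
      hΓ')).intervalIntegrable _ _
  · have : (fun s : ℝ => conj (g (Γ k s) / (Γ k s - Γ j (conj ζ)) * deriv (Γ k) s)) = fun s : ℝ =>
        S k s * σ k s / (conj (Γ k s) - conj (Γ j (conj ζ))) := by
      funext s
      rw [div_mul_eq_mul_div, hg, map_div₀, map_mul, conj_conj, hT.conj_speed, map_sub]
    refine Continuous.intervalIntegrable ?_ _ _
    refine continuous_const.mul (continuous_const.mul ?_)
    rw [this]
    exact ((hSc k).mul hσc).div ((continuous_conj.comp hΓ).sub continuous_const) hne'

/-- Two Cauchy integrals `p`, `q` with `p + conj (q T) = 0` on the boundary vanish there. -/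
theorem cauchyT_eq_zero_of_skew (hT : IsTube Ω γ δ Γ σ) {y : ℝ} (hy : 0 < y) (hyδ : y < δ)
    {g₁ g₂ : ℂ → ℂ} (hg₁ : ∀ j, Continuous fun t : ℝ => g₁ (Γ j (t + y * I)))
    (hg₂ : ∀ j, Continuous fun t : ℝ => g₂ (Γ j (t + y * I)))
    (h : ∀ j (t : ℝ), cauchyT Γ y g₁ (Γ j t) +
      σ j t / deriv (Γ j) t * conj (cauchyT Γ y g₂ (Γ j t)) = 0) :
    (∀ j, ∀ ζ ∈ horizStrip y, cauchyT Γ y g₁ (Γ j ζ) = 0) ∧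
      ∀ j, ∀ ζ ∈ horizStrip y, cauchyT Γ y g₂ (Γ j ζ) = 0 := by
  have hd : ∀ {g : ℂ → ℂ}, (∀ j, Continuous fun t : ℝ => g (Γ j (t + y * I))) → ∀ j,
      DifferentiableOn ℂ (fun ζ => cauchyT Γ y g (Γ j ζ)) (horizStrip y) := fun hg j ζ hζ =>
    (hT.differentiable_cauchyT_strip hy.le hyδ hg j (horizStrip_mono hyδ.le hζ)
      (mem_horizStrip.1 hζ).2.ne).differentiableWithinAt
  have hT' := hT.mono hy hyδ.le
  have hΓ0 : ∀ j (t : ℝ), deriv (Γ j) t ≠ 0 := fun j t =>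
    hT.deriv_ne j _ (ofReal_mem_horizStrip hT.pos t)
  have hσ0 : ∀ j (t : ℝ), σ j t ≠ 0 := fun j t => hT.speed_ne j _ (ofReal_mem_horizStrip hT.pos t)
  have hp0 : ∀ j (t : ℝ), cauchyT Γ y g₁ (Γ j t) = 0 := by
    have h1 := hT.heightIntegral_mul_cauchyT hy hyδ hg₁ hg₂
    -- With `p` and `q` the two transforms, the hypothesis says `q T = -conj p`, whence `p q dw =
    -- -|p|² ds`. The integral of the left side vanishes by the exterior Cauchy theorem.
    have h2 : ∀ j (t : ℝ), cauchyT Γ y g₁ (Γ j t) * cauchyT Γ y g₂ (Γ j t) * deriv (Γ j) t =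
        ((-(‖deriv (Γ j) t‖ * ‖cauchyT Γ y g₁ (Γ j t)‖ ^ 2) : ℝ) : ℂ) := by
      intro j t
      have h3 := h j t
      have h4 := hT.speed_sq j t
      have h5 := hΓ0 j t
      have h6 := hσ0 j t
      have h7 := congrArg conj h3
      simp only [map_add, map_mul, map_div₀, conj_conj, hT.conj_speed, map_zero] at h7
      have h8 : conj (deriv (Γ j) t) ≠ 0 := by simpa using h5
      push_cast
      rw [← Complex.mul_conj', ← hT.speed_eq]
      generalize cauchyT Γ y g₁ (Γ j t) = p at *
      generalize cauchyT Γ y g₂ (Γ j t) = q at *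
      field_simp at h7
      have h9 : q * σ j t * deriv (Γ j) t = - conj p * (σ j t * σ j t) := by
        rw [h4]
        linear_combination deriv (Γ j) t * h7
      have h10 : q * deriv (Γ j) t = - conj p * σ j t := by
        apply mul_right_cancel₀ h6
        linear_combination h9
      linear_combination p * h10
    have h3 : ∑ j, ∫ t in (0 : ℝ)..1, ‖deriv (Γ j) t‖ * ‖cauchyT Γ y g₁ (Γ j t)‖ ^ 2 = 0 := by
      unfold heightIntegral at h1
      simp only [ofReal_zero, zero_mul, add_zero, h2, intervalIntegral.integral_ofReal,
        intervalIntegral.integral_neg] at h1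
      have h4 := congrArg re h1
      simpa using h4
    intro j t
    have h4 := eq_zero_of_sum_integral_eq_zero
      (F := fun j t => ‖deriv (Γ j) t‖ * ‖cauchyT Γ y g₁ (Γ j t)‖ ^ 2) (fun j => ?_)
      (fun j t => ?_) (fun j t => by positivity) h3 j t
    · simpa [hΓ0 j t] using h4
    · exact (hT.continuous_real (hT.diff_deriv j).continuousOn).norm.mul
        ((hT'.continuous_real (hd hg₁ j).continuousOn).norm.pow 2)
    · have h5 := hT.deriv_periodic j t
      have h6 := hT.per j t
      simp only
      push_cast
      rw [h5, h6]
  refine ⟨fun j => eqOn_zero_of_ofReal_eq_zero hy (hd hg₁ j) (hp0 j),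
    fun j => eqOn_zero_of_ofReal_eq_zero hy (hd hg₂ j) fun t => ?_⟩
  have := h j t
  rw [hp0, zero_add] at this
  simpa [hσ0 j t, hΓ0 j t] using this

theorem unitTangent_apply (hT : IsTube Ω γ δ Γ σ) (j : Fin n) (t : ℝ) :
    unitTangent γ (Γ j t) = deriv (Γ j) t / σ j t := by
  rw [hT.apply_ofReal, _root_.unitTangent_apply hT.dom, hT.speed_ofReal, hT.deriv_ofReal]

/-- Every function holomorphic near the boundary decomposes there as `h + conj (k T)` with `h`, `k`
holomorphic on the closed domain. -/
theorem exists_decomposition (hT : IsTube Ω γ δ Γ σ) {u : ℂ → ℂ}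
    (hu : DifferentiableOn ℂ u (tube Γ δ)) :
    ∃ h k : ℂ → ℂ, AnalyticOnNhd ℂ h (closure Ω) ∧ AnalyticOnNhd ℂ k (closure Ω) ∧
      ∀ z ∈ frontier Ω, u z = h z + conj (k z * unitTangent γ z) := by
  set η := δ / 2 with hη
  have hδ := hT.pos
  have hη0 : 0 < η := by positivity
  have hηδ : η < δ := by rw [hη]; linarith
  have hηa : |η| < δ := by rwa [abs_of_pos hη0]
  -- The inhomogeneous term is the exterior boundary value of the Cauchy integral of `u`; moving the
  -- contour inwards to height `η` continues it across the boundary.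
  obtain ⟨r, hr, hrη, hrδ, S, hSd, hSp, hS⟩ := hT.exists_ks_solution hη0
    (c := fun j ζ => cauchyT Γ η u (Γ j ζ))
    (fun j ζ hζ => (hT.differentiable_cauchyT_strip hη0.le hηδ (hT.continuous_line_of_tube hηa hu) j
      (horizStrip_mono hηδ.le hζ) (mem_horizStrip.1 hζ).2.ne).differentiableWithinAt)
    fun j ζ => by simp only [hT.per j ζ]
  have hT' := hT.mono hr hrδ
  set η' := r / 2 with hη'
  have hη'0 : 0 < η' := by positivity
  have hη'r : η' < r := by rw [hη']; linarith
  have hη'a : |η'| < r := by rwa [abs_of_pos hη'0]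
  have hΓ0 : ∀ j (t : ℝ), deriv (Γ j) t ≠ 0 := fun j t =>
    hT.deriv_ne j _ (ofReal_mem_horizStrip hT.pos t)
  have hσ0 : ∀ j (t : ℝ), σ j t ≠ 0 := fun j t => hT.speed_ne j _ (ofReal_mem_horizStrip hT.pos t)
  -- On the real axis `σ / Γ'` is `conj T`, so this continues `conj (S T)` holomorphically.
  set G : Fin n → ℂ → ℂ := fun j ζ => conj (S j (conj ζ)) * σ j ζ / deriv (Γ j) ζ with hG
  have hGp : ∀ j, Function.Periodic (G j) 1 := fun j ζ => by
    simp only [hG, map_add, map_one, hSp j (conj ζ), hT.speed_per j ζ, hT.deriv_periodic j ζ]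
  have hGd : ∀ j, DifferentiableOn ℂ (G j) (horizStrip r) := fun j =>
    ((differentiableOn_conj_comp_conj (hSd j)).mul (hT'.speed_diff j)).div (hT'.diff_deriv j)
      (hT'.deriv_ne j)
  set f := tubeLift Γ r S with hf
  set g := tubeLift Γ r G with hg
  have hfd : DifferentiableOn ℂ f (tube Γ r) := hT'.differentiableOn_tubeLift le_rfl hSp hSd
  have hgd : DifferentiableOn ℂ g (tube Γ r) := hT'.differentiableOn_tubeLift le_rfl hGp hGd
  have hfΓ : ∀ j (t : ℝ), f (Γ j t) = S j t := fun j t =>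
    hT'.tubeLift_apply le_rfl hSp j (ofReal_mem_horizStrip hr t)
  have hgΓ : ∀ j (t : ℝ), g (Γ j t) = conj (S j t) * σ j t / deriv (Γ j) t := fun j t => by
    rw [hg, hT'.tubeLift_apply le_rfl hGp j (ofReal_mem_horizStrip hr t), hG]
    simp
  have hud : DifferentiableOn ℂ u (tube Γ r) := hu.mono (tube_mono hrδ)
  -- For `Im ζ < 0` the contours move inwards without crossing `Γ j ζ`, but the reflected point
  -- `conj ζ` is crossed and contributes the jump `g`.
  have hlt : ∀ j ζ, ζ ∈ horizStrip η' → ζ.im < 0 →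
      f (Γ j ζ) = cauchyT Γ η' u (Γ j ζ) + (cauchyT Γ η' f (Γ j ζ) + σ j ζ / deriv (Γ j) ζ *
        conj (cauchyT Γ η' g (Γ j (conj ζ)) + g (Γ j (conj ζ)))) := by
    intro j ζ hζ hζ0
    have hζr := horizStrip_mono hη'r.le hζ
    have hζδ := horizStrip_mono hrδ hζr
    obtain ⟨h1, h2⟩ := mem_horizStrip.1 hζ
    have hne : ∀ {y₂ : ℝ}, y₂ < δ → ∀ k, ∀ ξ ∈ {ξ : ℂ | 0 ≤ ξ.im ∧ ξ.im ≤ y₂}, Γ k ξ ≠ Γ j ζ := by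
      intro y₂ hy₂ k ξ hξ
      exact hT.ne_of_im_lt (mem_horizStrip.2 ⟨by linarith [hξ.1], by linarith [hξ.2]⟩) hζδ
        (by linarith [hξ.1] : ζ.im < ξ.im).ne'
    have h3 := hS j ζ hζr hζ0.ne
    rw [hT'.sum_integral_ksKernel (f := f) (g := g) (fun k => hT'.continuous_real (hSd k).continuousOn) hfΓ
      (fun k t => by rw [hgΓ, div_mul_cancel₀ _ (hΓ0 k t)]) j hζr hζ0.ne] at h3
    rw [hf, hT'.tubeLift_apply le_rfl hSp j hζr, h3, ← hf]
    congr 1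
    · rw [← hT.shift_of_tube (by linarith) hη0.le hηδ hu (hne hηδ),
        ← hT'.shift_of_tube (by linarith) hη'0.le hη'r hud (hne (hη'r.trans_le hrδ))]
    · congr 1
      · exact hT'.shift_of_tube (by linarith) hη'0.le hη'r hfd (hne (hη'r.trans_le hrδ))
      · congr 2
        refine hT'.jump_of_tube (by linarith) hη'r hgd j ?_ ?_
        · simpa using hζ0
        · simp only [conj_im]
          linarith
  have huf : DifferentiableOn ℂ (fun z => u z + f z) (tube Γ r) := hud.add hfd
  -- As `Im ζ` increases to zero the jump term tends to `conj (g T) = S`, which cancels the left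
  -- side of the equation. What remains is a skew relation between exterior transforms.
  have hskew : ∀ j (t : ℝ), cauchyT Γ η' (fun z => u z + f z) (Γ j t) +
      σ j t / deriv (Γ j) t * conj (cauchyT Γ η' g (Γ j t)) = 0 := by
    intro j t
    have hc : ∀ {F : ℂ → ℂ}, DifferentiableOn ℂ F (tube Γ r) →
        ContinuousAt (fun ζ => cauchyT Γ η' F (Γ j ζ)) t := fun hF =>
      (hT'.differentiable_cauchyT_strip hη'0.le hη'r (hT'.continuous_line_of_tube hη'a hF) j
        (ofReal_mem_horizStrip hr t) (by simpa using hη'0.ne)).continuousAt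
    have hs : ∀ {φ : ℂ → ℂ}, DifferentiableOn ℂ φ (horizStrip r) → ContinuousAt φ t := fun hφ =>
      (hφ.differentiableAt ((isOpen_horizStrip r).mem_nhds
        (ofReal_mem_horizStrip hr t))).continuousAt
    have hcj : ContinuousAt (fun ζ : ℂ => conj ζ) (t : ℂ) := continuous_conj.continuousAt
    have hct : conj (t : ℂ) = t := conj_ofReal t
    have e1 : ContinuousAt (fun ζ => cauchyT Γ η' u (Γ j ζ) + (cauchyT Γ η' f (Γ j ζ) +
        σ j ζ / deriv (Γ j) ζ *
          conj (cauchyT Γ η' g (Γ j (conj ζ)) + g (Γ j (conj ζ)))) - f (Γ j ζ)) t := by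
      refine ((hc hud).add ((hc hfd).add (((hs (hT'.speed_diff j)).div
        (hs (hT'.diff_deriv j)) (hΓ0 j t)).mul ?_))).sub (hs (hT'.comp_strip le_rfl hfd j))
      refine continuous_conj.continuousAt.comp ?_
      refine ContinuousAt.add ?_ ?_
      · exact ContinuousAt.comp' (f := fun ζ : ℂ => conj ζ) (g := fun ζ => cauchyT Γ η' g (Γ j ζ))
          (by rw [hct]; exact hc hgd) hcj
      · exact ContinuousAt.comp' (f := fun ζ : ℂ => conj ζ) (g := fun ζ => g (Γ j ζ))
          (by rw [hct]; exact hs (hT'.comp_strip le_rfl hgd j)) hcj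
    have e2 : Tendsto (fun ε : ℝ => (t : ℂ) - ε * I) (𝓝[>] 0) (𝓝 t) := by
      have : ContinuousAt (fun ε : ℝ => (t : ℂ) - ε * I) 0 := by fun_prop
      have h4 := this.tendsto
      simp only [ofReal_zero, zero_mul, sub_zero] at h4
      exact h4.mono_left nhdsWithin_le_nhds
    have e3 := e1.tendsto.comp e2
    have e4 : Tendsto (fun _ : ℝ => (0 : ℂ)) (𝓝[>] (0 : ℝ)) (𝓝 0) := tendsto_const_nhds
    have e5 : ∀ᶠ ε : ℝ in 𝓝[>] 0, ε < η' := 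
      mem_nhdsWithin_of_mem_nhds (Iio_mem_nhds hη'0)
    have e6 := tendsto_nhds_unique (e3.congr' (by
      filter_upwards [e5, self_mem_nhdsWithin] with ε hε hε0
      rw [Function.comp_apply, ← hlt j (t - ε * I) ?_ ?_, sub_self]
      · refine mem_horizStrip.2 ⟨?_, ?_⟩
        · simp
          linarith
        · simp
          linarith [mem_Ioi.1 hε0]
      · simpa using hε0)) e4
    simp only [hct] at e6
    rw [hfΓ, hgΓ] at e6
    rw [hT'.cauchyT_add hη'a (hT'.continuous_line_of_tube hη'a hud)
      (hT'.continuous_line_of_tube hη'a hfd)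
      (fun k s => hT'.line_ne_of_im_ne hη'a (ofReal_mem_horizStrip hr t)
        (by simpa using hη'0.ne) s)]
    have h4 := hT.speed_sq j t
    have h5 := hΓ0 j t
    have h8 : conj (deriv (Γ j) t) ≠ 0 := by simpa using h5
    have h9 : σ j t / deriv (Γ j) t * conj (conj (S j t) * σ j t / deriv (Γ j) t) = S j t := by
      rw [map_div₀, map_mul, conj_conj, hT.conj_speed]
      field_simp
      linear_combination S j t * h4
    rw [map_add, mul_add, h9] at e6
    linear_combination e6
  -- Both exterior transforms vanish, so `u + f` and `g` extend holomorphically to the closed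
  -- domain. They serve as `h` and `-k`, since `conj (g T) = f` on the boundary.
  obtain ⟨h1, h2⟩ := hT'.cauchyT_eq_zero_of_skew hη'0 hη'r
    (hT'.continuous_line_of_tube hη'a huf) (hT'.continuous_line_of_tube hη'a hgd) hskew
  obtain ⟨h, hh, hh'⟩ := hT'.exists_extension_of_cauchyT_eq_zero hη'0 hη'r huf h1
  obtain ⟨k, hk, hk'⟩ := hT'.exists_extension_of_cauchyT_eq_zero hη'0 hη'r hgd h2
  refine ⟨h, fun z => -k z, hh, hk.neg, fun z hz => ?_⟩
  simp only [hh' z hz, hk' z hz]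
  obtain ⟨j, t, rfl⟩ := hT.mem_frontier_iff.1 hz
  rw [hT.unitTangent_apply, hfΓ, hgΓ]
  have h3 : -(conj (S j t) * σ j t / deriv (Γ j) t) * (deriv (Γ j) t / σ j t) = - conj (S j t) := by
    have h4 := hΓ0 j t
    have h5 := hσ0 j t
    field_simp
  rw [h3]
  simp

end IsTube

/-! ### Principal parts, reflection, and contours outside the domain. -/

/-- The principal part of a function at a pole. -/
theorem AnalyticAt.exists_principal_part {g : ℂ → ℂ} {a : ℂ} (hg : AnalyticAt ℂ g a) (N : ℕ) :
    ∃ c : ℕ → ℂ, ∃ k : ℂ → ℂ, AnalyticAt ℂ k a ∧ ∀ᶠ w in 𝓝[≠] a,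
      g w / (w - a) ^ N = ∑ m ∈ Finset.range N, c m / (w - a) ^ (m + 1) + k w := by
  induction N generalizing g with
  | zero => exact ⟨0, g, hg, by simp⟩
  | succ N ih =>
    obtain ⟨p, hp⟩ := hg
    have h1 : AnalyticAt ℂ (dslope g a) a := ⟨_, hp.has_fpower_series_dslope_fslope⟩
    obtain ⟨c, k, hk, h⟩ := ih h1
    refine ⟨Function.update c N (g a), k, hk, ?_⟩
    filter_upwards [h, self_mem_nhdsWithin] with w hw hwa
    have h2 : w - a ≠ 0 := sub_ne_zero.2 hwa
    have h3 : g w = g a + (w - a) * dslope g a w := by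
      have := sub_smul_dslope g a w
      rw [smul_eq_mul] at this
      rw [this]
      ring
    rw [Finset.sum_range_succ, Function.update_self]
    have h4 : ∑ m ∈ Finset.range N, Function.update c N (g a) m / (w - a) ^ (m + 1) =
        ∑ m ∈ Finset.range N, c m / (w - a) ^ (m + 1) :=
      Finset.sum_congr rfl fun m hm => by
        rw [Function.update_of_ne (Finset.mem_range.1 hm).ne]
    rw [h4, add_right_comm, ← hw, h3, pow_succ]
    field_simp
    ring

theorem MeromorphicAt.exists_principal_part {f : ℂ → ℂ} {a : ℂ} (hf : MeromorphicAt f a) :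
    ∃ N : ℕ, ∃ c : ℕ → ℂ, ∃ k : ℂ → ℂ, AnalyticAt ℂ k a ∧ ∀ᶠ w in 𝓝[≠] a,
      f w = ∑ m ∈ Finset.range N, c m / (w - a) ^ (m + 1) + k w := by
  obtain ⟨N, hN⟩ := hf
  obtain ⟨c, k, hk, h⟩ := hN.exists_principal_part N
  refine ⟨N, c, k, hk, ?_⟩
  filter_upwards [h, self_mem_nhdsWithin] with w hw hwa
  have h2 : w - a ≠ 0 := sub_ne_zero.2 hwa
  rw [← hw, smul_eq_mul, mul_div_cancel_left₀ _ (pow_ne_zero _ h2)]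

namespace IsTube

theorem eventually_tube_subset (hT : IsTube Ω γ δ Γ σ) {U : Set ℂ} (hU : ∀ z ∈ frontier Ω, U ∈ 𝓝 z) :
    ∀ᶠ r in 𝓝[>] (0 : ℝ), tube Γ r ⊆ U := by
  have h1 : ∀ j, ∀ᶠ r in 𝓝[>] (0 : ℝ), horizStrip r ⊆ horizStrip δ ∩ (fun ζ => Γ j ζ) ⁻¹' interior U :=
    fun j => eventually_horizStrip_subset
      ((hT.diff j).continuousOn.isOpen_inter_preimage (isOpen_horizStrip _) isOpen_interior)
      (fun t => ⟨ofReal_mem_horizStrip hT.pos t,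
        mem_interior_iff_mem_nhds.2 (hU _ (hT.apply_mem_frontier j t))⟩)
      (fun ζ m h => by
        rw [mem_inter_iff, add_int_mem_horizStrip, mem_preimage, hT.apply_add_int] at h
        exact h)
  filter_upwards [eventually_all.2 h1] with r hr
  rintro _ ⟨j, ζ, hζ, rfl⟩
  exact interior_subset (hr j hζ).2

theorem heightIntegral_add (hT : IsTube Ω γ δ Γ σ) {y : ℝ} (hy : |y| < δ) {g₁ g₂ : ℂ → ℂ}
    (hg₁ : ∀ j, Continuous fun t : ℝ => g₁ (Γ j (t + y * I)))
    (hg₂ : ∀ j, Continuous fun t : ℝ => g₂ (Γ j (t + y * I))) :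
    heightIntegral Γ y (fun w => g₁ w + g₂ w) = heightIntegral Γ y g₁ + heightIntegral Γ y g₂ := by
  unfold heightIntegral
  rw [← Finset.sum_add_distrib]
  refine Finset.sum_congr rfl fun j _ => ?_
  have hΓ' : Continuous fun t : ℝ => deriv (Γ j) (t + y * I) :=
    continuous_line hy (hT.diff_deriv j).continuousOn
  rw [← intervalIntegral.integral_add]
  · simp only [add_mul]
  · exact ((hg₁ j).mul hΓ').intervalIntegrable _ _
  · exact ((hg₂ j).mul hΓ').intervalIntegrable _ _

theorem isOpen_compl_line (hT : IsTube Ω γ δ Γ σ) {y : ℝ} (hy : |y| < δ) :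
    IsOpen {a : ℂ | ∀ j (t : ℝ), Γ j (t + y * I) ≠ a} := by
  have h : {a : ℂ | ∀ j (t : ℝ), Γ j (t + y * I) ≠ a} = (slab Γ y y)ᶜ := by
    ext a
    simp only [mem_ofPred_eq, slab, mem_compl_iff, not_exists, not_and]
    refine ⟨fun h j ζ h1 h2 h3 => h j ζ.re ?_, fun h j t => h j _ (by simp) (by simp)⟩
    rw [← h3, ← le_antisymm h2 h1, re_add_im]
  rw [h]
  exact (hT.isCompact_slab (abs_lt.1 hy).1 (abs_lt.1 hy).2).isClosed.isOpen_compl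

theorem iteratedDeriv_cauchyT (hT : IsTube Ω γ δ Γ σ) {y : ℝ} (hy : |y| < δ) {g : ℂ → ℂ}
    (hg : ∀ j, Continuous fun t : ℝ => g (Γ j (t + y * I))) (m : ℕ) {a : ℂ}
    (ha : ∀ j (t : ℝ), Γ j (t + y * I) ≠ a) :
    iteratedDeriv m (cauchyT Γ y g) a = m.factorial * (2 * Real.pi * I : ℂ)⁻¹ *
      heightIntegral Γ y (fun w => g w / (w - a) ^ (m + 1)) := by
  induction m generalizing a with
  | zero => simp [cauchyT]
  | succ m ih =>
    rw [iteratedDeriv_succ]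
    have h1 : iteratedDeriv m (cauchyT Γ y g) =ᶠ[𝓝 a] fun a => m.factorial *
        (2 * Real.pi * I : ℂ)⁻¹ * heightIntegral Γ y (fun w => g w / (w - a) ^ (m + 1)) := by
      filter_upwards [(hT.isOpen_compl_line hy).mem_nhds ha] with b hb using ih hb
    rw [h1.deriv_eq, ((hT.hasDerivAt_heightIntegral hy hg ha m).const_mul _).deriv]
    push_cast [Nat.factorial_succ]
    ring

/-- The reflection principle for contour integrals. -/
theorem heightIntegral_neg_eq_conj (hT : IsTube Ω γ δ Γ σ) {a : ℂ} {M N : ℂ → ℂ}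
    (ha : ∀ j, ∀ ζ ∈ horizStrip δ, Γ j ζ = a → ζ.im = 0)
    (hM : ∀ w ∈ tube Γ δ, w ≠ a → AnalyticAt ℂ M w) (hN : ∀ w ∈ tube Γ δ, w ≠ a → AnalyticAt ℂ N w)
    (h : ∀ w ∈ frontier Ω, w ≠ a → M w * unitTangent γ w = conj (N w * unitTangent γ w))
    {y : ℝ} (hy : 0 < y) (hyδ : y < δ) :
    heightIntegral Γ (-y) M = conj (heightIntegral Γ y N) := by
  unfold heightIntegral
  rw [map_sum]
  refine Finset.sum_congr rfl fun j _ => ?_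
  rw [conj_intervalIntegral]
  have hδ := hT.pos
  -- If the curve passes through `a`, it does so once per period; `t₁` is taken half a period away
  -- from that parameter.
  obtain ⟨t₁, ht₁⟩ : ∃ t₁ : ℝ, ∀ t : ℝ, |t - t₁| < 1 / 2 → Γ j t ≠ a := by
    by_cases h0 : ∃ t₀ : ℝ, Γ j t₀ = a
    · obtain ⟨t₀, rfl⟩ := h0
      refine ⟨t₀ + 1 / 2, fun t ht heq => ?_⟩
      obtain ⟨-, m, hm⟩ := hT.inj j j _ (ofReal_mem_horizStrip hδ t₀) _
        (ofReal_mem_horizStrip hδ t) heq.symm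
      have hm' : t = t₀ + m := by exact_mod_cast hm
      rw [hm', abs_lt] at ht
      have h1 : (0 : ℝ) < m := by linarith [ht.1]
      have h2 : (m : ℝ) < 1 := by linarith [ht.2]
      have h3 : (0 : ℤ) < m := by exact_mod_cast h1
      have h4 : m < (1 : ℤ) := by exact_mod_cast h2
      omega
    · exact ⟨0, fun t _ ht => h0 ⟨t, ht⟩⟩
  set A : ℂ → ℂ := fun ζ => M (Γ j ζ) * deriv (Γ j) ζ with hA
  set B : ℂ → ℂ := fun ζ => conj (N (Γ j (conj ζ)) * deriv (Γ j) (conj ζ)) with hB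
  set ρ := min δ (1 / 2) with hρ
  have hρ0 : 0 < ρ := lt_min hδ (by norm_num)
  -- The pole `a` has only real preimages, so the lower half strip avoids it. Adding a disc about
  -- `t₁` keeps the set connected and reaches real points, where the two integrands agree; the
  -- identity theorem carries this to height `-y`.
  set U : Set ℂ := {ζ | -δ < ζ.im ∧ ζ.im < 0} ∪ Metric.ball (t₁ : ℂ) ρ with hU
  have hbs : Metric.ball (t₁ : ℂ) ρ ⊆ horizStrip δ := by
    intro ζ hζ
    have h1 : |ζ.im| < ρ := by
      refine lt_of_le_of_lt ?_ (mem_ball_iff_norm.1 hζ)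
      simpa using abs_im_le_norm (ζ - t₁)
    exact lt_of_lt_of_le h1 (min_le_left _ _)
  have hUs : U ⊆ horizStrip δ := by
    rintro ζ (hζ | hζ)
    · exact mem_horizStrip.2 ⟨hζ.1, by linarith [hζ.2]⟩
    · exact hbs hζ
  have hUo : IsOpen U := by
    refine IsOpen.union ?_ Metric.isOpen_ball
    exact (isOpen_lt continuous_const continuous_im).inter (isOpen_lt continuous_im continuous_const)
  have hUa : ∀ ζ ∈ U, Γ j ζ ≠ a := by
    rintro ζ hζ heq
    have h0 := ha j ζ (hUs hζ) heq
    rcases hζ with hζ | hζ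
    · exact hζ.2.ne h0
    · have h1 : ζ = (ζ.re : ℂ) := Complex.ext rfl (by simp [h0])
      refine ht₁ ζ.re ?_ (by rwa [← h1])
      refine lt_of_lt_of_le (lt_of_le_of_lt ?_ (mem_ball_iff_norm.1 hζ)) (min_le_right δ _)
      simpa using abs_re_le_norm (ζ - t₁)
  have hUa' : ∀ ζ ∈ U, Γ j (conj ζ) ≠ a := by
    intro ζ hζ heq
    have h0 := ha j _ (conj_mem_horizStrip.2 (hUs hζ)) heq
    have h1 : conj ζ = ζ := conj_eq_iff_im.2 (by simpa using h0)
    exact hUa ζ hζ (by rwa [h1] at heq)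
  have hAd : DifferentiableOn ℂ A U := fun ζ hζ => by
    refine DifferentiableAt.differentiableWithinAt (DifferentiableAt.mul ?_
      ((hT.analyticAt j (hUs hζ)).deriv.differentiableAt))
    exact DifferentiableAt.comp ζ (hM _ ⟨j, ζ, hUs hζ, rfl⟩ (hUa ζ hζ)).differentiableAt
      (hT.analyticAt j (hUs hζ)).differentiableAt
  have hBd : DifferentiableOn ℂ B U := fun ζ hζ => by
    have hζ' := conj_mem_horizStrip.2 (hUs hζ)
    refine DifferentiableAt.differentiableWithinAt ?_
    have h1 : DifferentiableAt ℂ (fun ζ => N (Γ j ζ) * deriv (Γ j) ζ) (conj ζ) := by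
      refine DifferentiableAt.mul ?_ ((hT.analyticAt j hζ').deriv.differentiableAt)
      exact DifferentiableAt.comp _ (hN _ ⟨j, _, hζ', rfl⟩ (hUa' ζ hζ)).differentiableAt
        (hT.analyticAt j hζ').differentiableAt
    have h2 := h1.conj_conj
    rw [conj_conj] at h2
    exact h2
  have hAB : EqOn A B U := by
    have hpc : IsPreconnected U := by
      refine IsPreconnected.union' ?_ ?_ ?_
      · refine ⟨t₁ - (ρ / 2) * I, ⟨?_, ?_⟩, ?_⟩
        · have := min_le_left δ (1 / 2)
          simp
          linarith
        · simp [hρ0]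
        · rw [mem_ball_iff_norm]
          have : (t₁ : ℂ) - (ρ / 2) * I - t₁ = ((-(ρ / 2) : ℝ) : ℂ) * I := by push_cast; ring
          rw [this, norm_mul, norm_I, mul_one, norm_real, norm_neg, Real.norm_of_nonneg (by positivity)]
          linarith
      · exact ((convex_halfSpace_im_gt (-δ)).inter (convex_halfSpace_im_lt 0)).isPreconnected
      · exact (convex_ball _ _).isPreconnected
    refine (hAd.analyticOnNhd hUo).eqOn_of_preconnected_of_frequently_eq (hBd.analyticOnNhd hUo)
      hpc (Or.inr (Metric.mem_ball_self hρ0)) ?_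
    have h2 : Tendsto (fun t : ℝ => (t : ℂ)) (𝓝[≠] t₁) (𝓝[≠] ((t₁ : ℝ) : ℂ)) := by
      refine (Complex.continuous_ofReal.tendsto t₁).inf ?_
      refine tendsto_principal_principal.2 fun t ht => ?_
      simpa using ht
    refine h2.frequently (Eventually.frequently ?_)
    have h3 : ∀ᶠ t : ℝ in 𝓝[≠] t₁, |t - t₁| < 1 / 2 :=
      mem_nhdsWithin_of_mem_nhds (Metric.ball_mem_nhds t₁ (by norm_num))
    filter_upwards [h3] with t ht
    have h4 := h _ (hT.apply_mem_frontier j t) (ht₁ t ht)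
    rw [hT.unitTangent_apply, map_mul, map_div₀, hT.conj_speed] at h4
    have h5 := hT.speed_ne j _ (ofReal_mem_horizStrip hδ t)
    simp only [hA, hB, conj_ofReal, map_mul]
    field_simp at h4
    exact h4
  refine intervalIntegral.integral_congr fun t _ => ?_
  have h1 : (t : ℂ) + ((-y : ℝ) : ℂ) * I ∈ U := Or.inl ⟨by simpa using hyδ, by simpa using hy⟩
  have h2 : conj ((t : ℂ) + ((-y : ℝ) : ℂ) * I) = t + y * I := by
    simp
  have h3 := hAB h1
  simp only [hA, hB, h2] at h3
  exact h3

/-- A function holomorphic across the boundary allows the contour to be moved outside the closed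
domain. -/
theorem cauchyT_neg_eq (hT : IsTube Ω γ δ Γ σ) {y : ℝ} (hy : 0 < y) (hyδ : y < δ) {F : ℂ → ℂ}
    (hF : DifferentiableOn ℂ F (tube Γ δ)) (hFΩ : DifferentiableOn ℂ F Ω) {z : ℂ} (hz : z ∈ Ω) :
    cauchyT Γ (-y) F z = F z := by
  have hδ := hT.pos
  rw [hT.shift_of_tube (y₂ := 0) (by linarith) (by linarith) hδ hF]
  · refine (hT.cauchyT_eq le_rfl hδ hFΩ fun j => (hT.comp_strip le_rfl hF j).continuousOn.mono
      fun ξ hξ => mem_horizStrip.2 ⟨by linarith [hξ.1], hξ.2⟩).1 z hz ?_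
    rintro ⟨j, ζ, h1, h2, rfl⟩
    have := (hT.apply_mem_iff j (mem_horizStrip.2 ⟨by linarith, by linarith⟩)).1 hz
    linarith
  · rintro j ξ ⟨h1, h2⟩ rfl
    have := (hT.apply_mem_iff j (mem_horizStrip.2 ⟨by linarith, by linarith⟩)).1 hz
    linarith

theorem heightIntegral_neg_eq_zero (hT : IsTube Ω γ δ Γ σ) {y : ℝ} (hy : 0 < y) (hyδ : y < δ)
    {F : ℂ → ℂ} (hF : DifferentiableOn ℂ F (tube Γ δ)) (hFΩ : DifferentiableOn ℂ F Ω) :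
    heightIntegral Γ (-y) F = 0 := by
  have hδ := hT.pos
  rw [hT.heightIntegral_shift (y₂ := 0) (by linarith) (by linarith) hδ
    (fun j => ((hT.comp_strip le_rfl hF j).mono (strip_subset (by linarith) hδ)).continuousOn)
    (fun j => (hT.comp_strip le_rfl hF j).mono (open_strip_subset (by linarith) hδ))]
  exact hT.heightIntegral_eq_zero le_rfl hδ hFΩ fun j =>
    (hT.comp_strip le_rfl hF j).continuousOn.mono
      fun ξ hξ => mem_horizStrip.2 ⟨by linarith [hξ.1], hξ.2⟩

theorem line_ne_of_mem_closure (hT : IsTube Ω γ δ Γ σ) {y : ℝ} (hy : 0 < y) (hyδ : y < δ) {a : ℂ}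
    (ha : a ∈ closure Ω) (j : Fin n) (t : ℝ) : Γ j (t + ((-y : ℝ) : ℂ) * I) ≠ a := by
  rintro rfl
  have := (hT.apply_mem_closure_iff j (line_mem_horizStrip (by rwa [abs_neg, abs_of_pos hy]) t)).1 ha
  simp at this
  linarith

/-- The integral form of the derivatives on the closed domain. -/
theorem heightIntegral_div_pow (hT : IsTube Ω γ δ Γ σ) {y : ℝ} (hy : 0 < y) (hyδ : y < δ)
    {P ψ : ℂ → ℂ} (hP : ∀ j, Continuous fun t : ℝ => P (Γ j (t + ((-y : ℝ) : ℂ) * I))) {z a : ℂ}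
    (hψ : ∀ w ∈ Ω, w ≠ z → cauchyT Γ (-y) P w = ψ w) (ha : a ∈ closure Ω)
    (hψa : AnalyticAt ℂ ψ a) (m : ℕ) :
    heightIntegral Γ (-y) (fun w => P w / (w - a) ^ (m + 1)) =
      2 * Real.pi * I * iteratedDeriv m ψ a / m.factorial := by
  have hy' : |(-y)| < δ := by rwa [abs_neg, abs_of_pos hy]
  have hline := hT.line_ne_of_mem_closure hy hyδ ha
  have h1 : AnalyticAt ℂ (cauchyT Γ (-y) P) a := by
    refine DifferentiableOn.analyticAt (s := {a : ℂ | ∀ j (t : ℝ), Γ j (t + ((-y : ℝ) : ℂ) * I) ≠ a})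
      (fun b hb => (hT.differentiableAt_cauchyT hy' hP hb).differentiableWithinAt)
      ((hT.isOpen_compl_line hy').mem_nhds hline)
  -- `a` is an accumulation point of `Ω`, where the two functions agree off `z`. Both are analytic
  -- at `a`, even when it lies on the boundary, so they coincide near `a`.
  have h2 : cauchyT Γ (-y) P =ᶠ[𝓝 a] ψ := by
    refine (h1.frequently_eq_iff_eventually_eq hψa).1 ?_
    have h3 : ∃ᶠ w in 𝓝[≠] a, w ∈ Ω := by
      by_cases h : a ∈ Ω
      · exact (Eventually.frequently (mem_nhdsWithin_of_mem_nhds (hT.dom.isOpen.mem_nhds h)))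
      · rw [frequently_nhdsWithin_iff]
        exact (mem_closure_iff_frequently.1 ha).mono fun w hw =>
          ⟨hw, fun hwa => h (by rw [← mem_singleton_iff.1 hwa]; exact hw)⟩
    have h5 : ∀ᶠ w in 𝓝[≠] a, w ≠ z := by
      by_cases haz : a = z
      · rw [haz]; exact self_mem_nhdsWithin
      · exact mem_nhdsWithin_of_mem_nhds (isOpen_ne.mem_nhds haz)
    exact (h3.and_eventually h5).mono fun w hw => hψ w hw.1 hw.2
  have h3 := hT.iteratedDeriv_cauchyT hy' hP m hline
  rw [h2.iteratedDeriv_eq] at h3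
  rw [h3]
  have h4 := two_pi_I_ne
  have h5 : (m.factorial : ℂ) ≠ 0 := by exact_mod_cast m.factorial_ne_zero
  field_simp

end IsTube

/-! ### Boundary pairs with one prescribed pole. -/

theorem IsAnalyticDomain.unitTangent_mul_conj (hΩ : IsAnalyticDomain Ω γ) {w : ℂ}
    (hw : w ∈ frontier Ω) : unitTangent γ w * conj (unitTangent γ w) = 1 := by
  rw [hΩ.frontier_eq] at hw
  obtain ⟨j, t, rfl⟩ := mem_iUnion.1 hw
  rw [unitTangent_apply hΩ, Complex.mul_conj, ← Complex.sq_norm, norm_div, norm_real, norm_norm,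
    div_self (norm_ne_zero_iff.2 (hΩ.deriv_ne_zero j t))]
  simp

theorem IsAnalyticDomain.notMem_of_mem_frontier (hΩ : IsAnalyticDomain Ω γ) {w : ℂ}
    (hw : w ∈ frontier Ω) : w ∉ Ω := by
  rw [hΩ.isOpen.frontier_eq] at hw
  exact hw.2

/-- A function `(w - a) ^ (-(m + 1)) + k w` with a pole at `a` and no other singularity on the closed
domain, which agrees with `conj (H T)` on the boundary. -/
structure IsPolePair (Ω : Set ℂ) (γ : Fin n → ℝ → ℂ) (a : ℂ) (m : ℕ) (k H : ℂ → ℂ) : Prop where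
  analytic : AnalyticOnNhd ℂ k (closure Ω)
  mero : MeromorphicAt H a
  analyticAt : ∀ w ∈ closure Ω, (w = a → a ∈ Ω) → AnalyticAt ℂ H w
  rel : ∀ w ∈ frontier Ω, w ≠ a → ((w - a) ^ (m + 1))⁻¹ + k w = conj (H w * unitTangent γ w)

/-- The function `conj ((w - a)^(-(m+1)) T)` on the boundary continues to a function `W` on the
tube, to which the decomposition is applied. If `a` is a boundary point, `W` itself is singular at
`a`; its principal part is split off beforehand and given to `H`. -/
theorem exists_isPolePair (hΩ : IsAnalyticDomain Ω γ) {a : ℂ} (ha : a ∈ closure Ω) (m : ℕ) :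
    ∃ k H, IsPolePair Ω γ a m k H := by
  classical
  obtain ⟨δ₀, Γ, σ, hT₀⟩ := exists_tube hΩ
  -- The tube is kept away from an interior `a`, so that a point of the tube equal to `a` must have
  -- real parameter.
  have hev := hT₀.eventually_tube_subset (U := {w | a ∈ Ω → w ≠ a}) fun z hz => by
    by_cases haΩ : a ∈ Ω
    · filter_upwards [isOpen_ne.mem_nhds fun h : z = a => hΩ.notMem_of_mem_frontier hz (h ▸ haΩ)]
        with w hw _ using hw
    · filter_upwards with w h using absurd h haΩ
  obtain ⟨δ, hδ, hδ'⟩ := (hev.and (Ioc_mem_nhdsGT hT₀.pos)).exists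
  have hT := hT₀.mono hδ'.1 hδ'.2
  have hreal : ∀ j, ∀ ζ ∈ horizStrip δ, Γ j ζ = a → conj ζ = ζ := by
    intro j ζ hζ h
    have h1 : a ∉ Ω := fun haΩ => hδ ⟨j, ζ, hζ, h⟩ haΩ rfl
    rw [← h, hT.apply_mem_iff j hζ] at h1
    rw [← h, hT.apply_mem_closure_iff j hζ] at ha
    exact conj_eq_iff_im.2 (by linarith)
  set B : Fin n → ℂ → ℂ := fun j ζ => conj (Γ j (conj ζ)) - conj a with hB
  set φ : Fin n → ℂ → ℂ := fun j ζ => ((B j ζ) ^ (m + 1))⁻¹ * σ j ζ / deriv (Γ j) ζ with hφ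
  have hBd : ∀ j, DifferentiableOn ℂ (B j) (horizStrip δ) := fun j =>
    (differentiableOn_conj_comp_conj (hT.diff j)).sub_const _
  have hB0 : ∀ j, ∀ ζ ∈ horizStrip δ, Γ j ζ ≠ a → B j ζ ≠ 0 := by
    intro j ζ hζ h h0
    have h1 : Γ j (conj ζ) = a := by
      have := sub_eq_zero.1 h0
      exact (starRingEnd ℂ).injective this
    have h2 := hreal j _ (conj_mem_horizStrip.2 hζ) h1
    rw [conj_conj] at h2
    exact h (by rwa [← h2] at h1)
  have hφp : ∀ j, Function.Periodic (φ j) 1 := fun j ζ => by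
    simp only [hφ, hB, map_add, map_one, hT.per j (conj ζ), hT.speed_per j ζ, hT.deriv_periodic j ζ]
  set W := tubeLift Γ δ φ with hW
  have hWΓ : ∀ j, ∀ ζ ∈ horizStrip δ, W (Γ j ζ) = φ j ζ := fun j ζ hζ =>
    hT.tubeLift_apply le_rfl hφp j hζ
  have hat : ∀ {f : ℂ → ℂ} {ζ : ℂ}, DifferentiableOn ℂ f (horizStrip δ) → ζ ∈ horizStrip δ →
      DifferentiableAt ℂ f ζ := fun hf hζ => hf.differentiableAt ((isOpen_horizStrip δ).mem_nhds hζ)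
  have hWd : ∀ w ∈ tube Γ δ, w ≠ a → DifferentiableAt ℂ W w := by
    rintro _ ⟨j, ζ, hζ, rfl⟩ hne
    refine hT.differentiableAt_tube hζ ?_
    have h1 : DifferentiableAt ℂ (φ j) ζ :=
      ((((hat (hBd j) hζ).pow _).inv (pow_ne_zero _ (hB0 j ζ hζ hne))).mul
        (hat (hT.speed_diff j) hζ)).div (hat (hT.diff_deriv j) hζ) (hT.deriv_ne j ζ hζ)
    refine h1.congr_of_eventuallyEq ?_
    filter_upwards [(isOpen_horizStrip δ).mem_nhds hζ] with ξ hξ using hWΓ j ξ hξ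
  -- `R` is the principal part of `W` at a boundary point `a`, and zero for interior `a`; `u` is the
  -- remainder with the value at `a` filled in.
  obtain ⟨R, u, hu, hRm, hRa, hRΩ, huW⟩ : ∃ R u : ℂ → ℂ, DifferentiableOn ℂ u (tube Γ δ) ∧
      MeromorphicAt R a ∧ (∀ w ≠ a, AnalyticAt ℂ R w) ∧ (a ∈ Ω → AnalyticAt ℂ R a) ∧
      ∀ w ≠ a, u w = W w - R w := by
    by_cases haΩ : a ∈ Ω
    · refine ⟨fun _ => 0, W, fun w hw => (hWd w hw (hδ hw haΩ)).differentiableWithinAt,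
        MeromorphicAt.const 0 a, fun w _ => analyticAt_const, fun _ => analyticAt_const, ?_⟩
      simp
    · have hfr : a ∈ frontier Ω := by
        rw [hΩ.isOpen.frontier_eq]
        exact ⟨ha, haΩ⟩
      obtain ⟨j, t, hat'⟩ := hT.mem_frontier_iff.1 hfr
      have ht := ofReal_mem_horizStrip hT.pos t
      have han : ∀ {f : ℂ → ℂ}, DifferentiableOn ℂ f (horizStrip δ) → MeromorphicAt f t :=
        fun hf => (hf.analyticAt_strip ht).meromorphicAt
      have hWm : MeromorphicAt W a := by
        obtain ⟨ψ, h1, h2, -, h3, h4⟩ :=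
          (hT.analyticAt j ht).exists_analytic_inverse (hT.deriv_ne j _ ht)
        rw [hat'] at h1 h2 h4
        have h5 : MeromorphicAt (φ j) (ψ a) := by
          rw [h2]
          exact ((((han (hBd j)).pow _).inv).mul (han (hT.speed_diff j))).div (han (hT.diff_deriv j))
        refine (h5.comp_analyticAt h1).congr ?_
        have h6 : ∀ᶠ w in 𝓝 a, ψ w ∈ horizStrip δ :=
          h1.continuousAt.eventually (by rw [h2]; exact (isOpen_horizStrip δ).mem_nhds ht)
        filter_upwards [mem_nhdsWithin_of_mem_nhds h4, mem_nhdsWithin_of_mem_nhds h6] with w hw hw'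
        rw [Function.comp_apply, ← hWΓ j _ hw', hw]
      obtain ⟨N, c, κ, hκ, hWe⟩ := hWm.exists_principal_part
      set R : ℂ → ℂ := fun w => ∑ m ∈ Finset.range N, c m / (w - a) ^ (m + 1) with hR
      have hRa : ∀ w ≠ a, AnalyticAt ℂ R w := fun w hw => by
        refine Finset.analyticAt_fun_sum _ fun i _ => ?_
        exact analyticAt_const.div ((analyticAt_id.sub analyticAt_const).pow _)
          (pow_ne_zero _ (sub_ne_zero.2 hw))
      refine ⟨R, Function.update (fun w => W w - R w) a (κ a), ?_, ?_, hRa,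
        fun h => absurd h haΩ, fun w hw => Function.update_of_ne hw _ _⟩
      · intro w hw
        by_cases hwa : w = a
        · subst hwa
          refine (hκ.differentiableAt.congr_of_eventuallyEq ?_).differentiableWithinAt
          rw [eventually_nhdsWithin_iff] at hWe
          filter_upwards [hWe] with x hx
          by_cases hxa : x = w
          · rw [hxa, Function.update_self]
          · rw [Function.update_of_ne hxa, hx hxa]
            simp [hR]
        · refine (((hWd w hw hwa).sub (hRa w hwa).differentiableAt).congr_of_eventuallyEq
            ?_).differentiableWithinAt
          filter_upwards [isOpen_ne.mem_nhds hwa] with x hx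
          exact Function.update_of_ne hx _ _
      · refine MeromorphicAt.fun_sum fun i _ => ?_
        exact (MeromorphicAt.const _ _).div (((MeromorphicAt.id a).sub (MeromorphicAt.const _ _)).pow _)
  obtain ⟨h, k, hh, hk, hrel⟩ := hT.exists_decomposition hu
  refine ⟨fun w => -k w, fun w => R w + h w, hk.neg, hRm.add (hh a ha).meromorphicAt,
    fun w hw hwa => ?_, fun w hw hwa => ?_⟩
  · by_cases hwa' : w = a
    · rw [hwa'] at hw ⊢
      exact (hRΩ (hwa hwa')).add (hh a hw)
    · exact (hRa w hwa').add (hh w hw)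
  · have h1 := hrel w hw
    rw [huW w hwa] at h1
    have h2 : R w + h w = W w - conj (k w * unitTangent γ w) := by linear_combination -h1
    rw [h2, sub_mul, map_sub, map_mul, map_mul, map_mul]
    have h3 := hΩ.unitTangent_mul_conj hw
    have h4 : conj (W w) * conj (unitTangent γ w) = ((w - a) ^ (m + 1))⁻¹ := by
      obtain ⟨j, t, rfl⟩ := hT.mem_frontier_iff.1 hw
      have ht := ofReal_mem_horizStrip hT.pos t
      rw [hWΓ j t ht, hT.unitTangent_apply, ← map_mul]
      simp only [hφ, hB, conj_ofReal]
      have h5 := hT.deriv_ne j _ ht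
      have h6 := hT.speed_ne j _ ht
      rw [div_mul_div_comm, mul_assoc, mul_comm (deriv (Γ j) t), mul_div_assoc, div_self
        (mul_ne_zero h6 h5), mul_one]
      simp
    rw [h4]
    simp only [map_mul, conj_conj]
    linear_combination k w * h3

/-! ### Reciprocity between pole pairs. -/

theorem iteratedDeriv_inv_sub (z : ℂ) (m : ℕ) (a : ℂ) :
    iteratedDeriv m (fun w : ℂ => (w - z)⁻¹) a = (-1) ^ m * m.factorial * ((a - z) ^ (m + 1))⁻¹ := by
  rw [iteratedDeriv_comp_sub_const (f := fun w : ℂ => w⁻¹), iteratedDeriv_eq_iterate]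
  simp only
  rw [show (fun w : ℂ => w⁻¹) = Inv.inv from rfl, iter_deriv_inv, show (-1 - (m : ℤ)) = -((m + 1 : ℕ) : ℤ) by push_cast; ring, zpow_neg, zpow_natCast]

theorem heightIntegral_const_mul (Γ : Fin n → ℂ → ℂ) (y : ℝ) (c : ℂ) (M : ℂ → ℂ) :
    heightIntegral Γ y (fun w => c * M w) = c * heightIntegral Γ y M := by
  unfold heightIntegral
  rw [Finset.mul_sum]
  refine Finset.sum_congr rfl fun j _ => ?_
  rw [← intervalIntegral.integral_const_mul]
  simp only [mul_assoc]

/-- By partial fractions, since both `z` and `w` lie inside the contour and the residues of `1 / ((ξ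
- z) (ξ - w))` cancel. The constant function `1` has Cauchy integral `1` at either point. -/
theorem IsTube.cauchyT_neg_inv_sub (hT : IsTube Ω γ δ Γ σ) {y : ℝ} (hy : 0 < y) (hyδ : y < δ)
    {z w : ℂ} (hz : z ∈ Ω) (hw : w ∈ Ω) (hwz : w ≠ z) :
    cauchyT Γ (-y) (fun ξ => (ξ - z)⁻¹) w = 0 := by
  have hy' : |(-y)| < δ := by rwa [abs_neg, abs_of_pos hy]
  have hΓ : ∀ j, Continuous fun t : ℝ => Γ j (t + ((-y : ℝ) : ℂ) * I) := fun j =>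
    IsTube.continuous_line hy' (hT.diff j).continuousOn
  have hne : ∀ {x : ℂ}, x ∈ Ω → ∀ j (t : ℝ), Γ j (t + ((-y : ℝ) : ℂ) * I) - x ≠ 0 := fun hx j t =>
    sub_ne_zero.2 (hT.line_ne_of_mem_closure hy hyδ (subset_closure hx) j t)
  have h1 : ∀ {x : ℂ}, x ∈ Ω → cauchyT Γ (-y) (fun _ => 1) x = 1 := fun hx =>
    hT.cauchyT_neg_eq hy hyδ (differentiableOn_const 1) (differentiableOn_const 1) hx
  have h2 := (h1 hw).trans (h1 hz).symm
  unfold cauchyT at h2 ⊢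
  replace h2 := mul_left_cancel₀ (inv_ne_zero two_pi_I_ne) h2
  have h3 := hT.heightIntegral_add hy' (g₁ := fun ξ => 1 / (ξ - z))
    (g₂ := fun ξ => (w - z) * ((ξ - z)⁻¹ / (ξ - w)))
    (fun j => continuous_const.div ((hΓ j).sub continuous_const) (hne hz j))
    (fun j => continuous_const.mul ((((hΓ j).sub continuous_const).inv₀ (hne hz j)).div
      ((hΓ j).sub continuous_const) (hne hw j)))
  have h4 : heightIntegral Γ (-y) (fun ξ => 1 / (ξ - z) + (w - z) * ((ξ - z)⁻¹ / (ξ - w))) =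
      heightIntegral Γ (-y) (fun ξ => 1 / (ξ - w)) := by
    unfold heightIntegral
    refine Finset.sum_congr rfl fun j _ => intervalIntegral.integral_congr fun t _ => ?_
    have h5 := hne hz j t
    have h6 := hne hw j t
    simp only
    field_simp
    ring
  rw [h4, h2, heightIntegral_const_mul] at h3
  have h5 : (w - z) * heightIntegral Γ (-y) (fun ξ => (ξ - z)⁻¹ / (ξ - w)) = 0 := by
    linear_combination -h3
  rw [(mul_eq_zero.1 h5).resolve_left (sub_ne_zero.2 hwz), mul_zero]

theorem IsTube.continuousOn_comp_of_differentiableOn (hT : IsTube Ω γ δ Γ σ) {y : ℝ} (hy : 0 < y)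
    {F : ℂ → ℂ} (hF : DifferentiableOn ℂ F Ω) (j : Fin n) :
    ContinuousOn (fun ξ => F (Γ j ξ)) {ξ | y ≤ ξ.im ∧ ξ.im < δ} := by
  have hs : {ξ : ℂ | y ≤ ξ.im ∧ ξ.im < δ} ⊆ horizStrip δ := fun ξ hξ =>
    mem_horizStrip.2 ⟨by linarith [hξ.1, hT.pos], hξ.2⟩
  refine hF.continuousOn.comp ((hT.diff j).continuousOn.mono hs) fun ξ hξ => ?_
  exact (hT.apply_mem_iff j (hs hξ)).2 (by linarith [hξ.1])

/-- The symmetry between the poles of pairs: the values of one pair are given by the Taylor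
coefficients of another. -/
theorem IsPolePair.eval_eq (hΩ : IsAnalyticDomain Ω γ) {a z : ℂ} {m : ℕ} {k H l S : ℂ → ℂ}
    (hp : IsPolePair Ω γ a m k H) (hq : IsPolePair Ω γ z 0 l S) (ha : a ∈ closure Ω) (hz : z ∈ Ω) :
    (z ≠ a → ((z - a) ^ (m + 1))⁻¹ + k z =
      -iteratedDeriv m (fun w => (w - z)⁻¹ + l w) a / m.factorial) ∧
    H z = -conj (iteratedDeriv m S a) / m.factorial := by
  obtain ⟨δ₀, Γ, σ, hT₀⟩ := exists_tube hΩ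
  have hS : ∀ w ∈ closure Ω, AnalyticAt ℂ S w := fun w hw => hq.analyticAt w hw fun _ => hz
  -- A thin tube contains no singularity other than a possible pole of the first pair at a boundary
  -- point `a`.
  have hev := hT₀.eventually_tube_subset (U := {w | (w ≠ z ∧ (a ∈ Ω → w ≠ a)) ∧ (AnalyticAt ℂ k w ∧
      AnalyticAt ℂ l w ∧ AnalyticAt ℂ S w) ∧ (w ≠ a → AnalyticAt ℂ H w)}) fun x hx => by
    have hx' := frontier_subset_closure hx
    have hxΩ := hΩ.notMem_of_mem_frontier hx
    refine Filter.inter_mem (Filter.inter_mem ?_ ?_) (Filter.inter_mem (Filter.inter_mem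
      (hp.analytic x hx').eventually_analyticAt (Filter.inter_mem
      (hq.analytic x hx').eventually_analyticAt (hS x hx').eventually_analyticAt)) ?_)
    · exact isOpen_ne.mem_nhds fun h => hxΩ (h ▸ hz)
    · by_cases haΩ : a ∈ Ω
      · filter_upwards [isOpen_ne.mem_nhds fun h : x = a => hxΩ (h ▸ haΩ)] with w hw _ using hw
      · filter_upwards with w h using absurd h haΩ
    · by_cases hxa : x = a
      · rw [hxa]
        exact eventually_nhdsWithin_iff.1 hp.mero.eventually_analyticAt
      · filter_upwards [(hp.analyticAt x hx' fun h => absurd h hxa).eventually_analyticAt]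
          with w hw _ using hw
  obtain ⟨δ, hδ, hδ'⟩ := (hev.and (Ioc_mem_nhdsGT hT₀.pos)).exists
  have hT := hT₀.mono hδ'.1 hδ'.2
  set y := δ / 2 with hy_def
  have hδ0 := hT.pos
  have hy : 0 < y := by positivity
  have hyδ : y < δ := by rw [hy_def]; linarith
  have hya : |y| < δ := by rwa [abs_of_pos hy]
  have hya' : |(-y)| < δ := by rwa [abs_neg]
  have hreal : ∀ j, ∀ ζ ∈ horizStrip δ, Γ j ζ = a → ζ.im = 0 := by
    intro j ζ hζ h
    have h1 : a ∉ Ω := fun haΩ => (hδ ⟨j, ζ, hζ, h⟩).1.2 haΩ rfl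
    rw [← h, hT.apply_mem_iff j hζ] at h1
    rw [← h, hT.apply_mem_closure_iff j hζ] at ha
    linarith
  have hzt : z ∉ slab Γ 0 y := by
    rintro ⟨j, ζ, h1, h2, h3⟩
    exact (hδ ⟨j, ζ, mem_horizStrip.2 ⟨by linarith, by linarith⟩, h3⟩).1.1 rfl
  have hkt : DifferentiableOn ℂ k (tube Γ δ) := fun w hw =>
    (hδ hw).2.1.1.differentiableAt.differentiableWithinAt
  have hlt : DifferentiableOn ℂ l (tube Γ δ) := fun w hw =>
    (hδ hw).2.1.2.1.differentiableAt.differentiableWithinAt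
  have hSt : DifferentiableOn ℂ S (tube Γ δ) := fun w hw =>
    (hδ hw).2.1.2.2.differentiableAt.differentiableWithinAt
  have hkΩ : DifferentiableOn ℂ k Ω := fun w hw =>
    (hp.analytic w (subset_closure hw)).differentiableAt.differentiableWithinAt
  have hlΩ : DifferentiableOn ℂ l Ω := fun w hw =>
    (hq.analytic w (subset_closure hw)).differentiableAt.differentiableWithinAt
  have hSΩ : DifferentiableOn ℂ S Ω := fun w hw =>
    (hS w (subset_closure hw)).differentiableAt.differentiableWithinAt
  have hHΩ : DifferentiableOn ℂ H Ω := fun w hw =>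
    (hp.analyticAt w (subset_closure hw) fun h => h ▸ hw).differentiableAt.differentiableWithinAt
  have hGa : ∀ w ∈ tube Γ δ, w ≠ a → AnalyticAt ℂ (fun w => ((w - a) ^ (m + 1))⁻¹ + k w) w :=
    fun w hw hwa => (((analyticAt_id.sub analyticAt_const).pow _).inv
      (pow_ne_zero _ (sub_ne_zero.2 hwa))).add (hδ hw).2.1.1
  have hLa : ∀ w ∈ tube Γ δ, AnalyticAt ℂ (fun w => (w - z)⁻¹ + l w) w :=
    fun w hw => ((analyticAt_id.sub analyticAt_const).inv (sub_ne_zero.2 (hδ hw).1.1)).add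
      (hδ hw).2.1.2.1
  have hrelq : ∀ w ∈ frontier Ω, (w - z)⁻¹ + l w = conj (S w * unitTangent γ w) := by
    intro w hw
    have := hq.rel w hw fun h => hΩ.notMem_of_mem_frontier hw (h ▸ hz)
    simpa using this
  have hline : ∀ {F : ℂ → ℂ}, DifferentiableOn ℂ F (tube Γ δ) → ∀ j,
      Continuous fun t : ℝ => F (Γ j (t + ((-y : ℝ) : ℂ) * I)) := fun hF =>
    hT.continuous_line_of_tube hya' hF
  have hΓ : ∀ j, Continuous fun t : ℝ => Γ j (t + ((-y : ℝ) : ℂ) * I) := fun j =>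
    IsTube.continuous_line hya' (hT.diff j).continuousOn
  have hΓy : ∀ j, Continuous fun t : ℝ => Γ j (t + y * I) := fun j =>
    IsTube.continuous_line hya (hT.diff j).continuousOn
  have hlineΩ : ∀ {F : ℂ → ℂ}, DifferentiableOn ℂ F Ω → ∀ j,
      Continuous fun t : ℝ => F (Γ j (t + y * I)) := fun hF j =>
    (hT.continuousOn_comp_of_differentiableOn hy hF j).comp_continuous (by fun_prop)
      fun t => ⟨by simp, by simpa using hyδ⟩
  have hnea : ∀ j (t : ℝ), Γ j (t + ((-y : ℝ) : ℂ) * I) - a ≠ 0 := fun j t =>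
    sub_ne_zero.2 (hT.line_ne_of_mem_closure hy hyδ ha j t)
  have hnez : ∀ j (t : ℝ), Γ j (t + ((-y : ℝ) : ℂ) * I) - z ≠ 0 := fun j t =>
    sub_ne_zero.2 (hT.line_ne_of_mem_closure hy hyδ (subset_closure hz) j t)
  have hnezy : ∀ j (t : ℝ), Γ j (t + y * I) - z ≠ 0 := fun j t => by
    refine sub_ne_zero.2 fun h => hzt ⟨j, _, ?_, ?_, h⟩
    · simpa using hy.le
    · simp
  have hinv : ∀ j, Continuous fun t : ℝ => (Γ j (t + ((-y : ℝ) : ℂ) * I) - z)⁻¹ := fun j =>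
    ((hΓ j).sub continuous_const).inv₀ (hnez j)
  have hm0 : (m.factorial : ℂ) ≠ 0 := by exact_mod_cast m.factorial_ne_zero
  have h2pi := two_pi_I_ne
  constructor
  · intro hza
    -- With `G`, `L` the two pole functions, `G L T = conj (H S T)` on the boundary. The reflected
    -- contour lies inside `Ω`, where `H S` is holomorphic, so the right side vanishes by Cauchy's
    -- theorem.
    have hcong := hT.heightIntegral_neg_eq_conj (a := a)
      (M := fun w => (((w - a) ^ (m + 1))⁻¹ + k w) * ((w - z)⁻¹ + l w)) (N := fun w => H w * S w) hreal
      (fun w hw hwa => (hGa w hw hwa).mul (hLa w hw))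
      (fun w hw hwa => ((hδ hw).2.2 hwa).mul (hδ hw).2.1.2.2) (fun w hw hwa => by
        rw [hp.rel w hw hwa, hrelq w hw]
        have h1 := hΩ.unitTangent_mul_conj hw
        simp only [map_mul]
        linear_combination conj (H w) * conj (S w) * conj (unitTangent γ w) * h1) hy hyδ
    rw [hT.heightIntegral_eq_zero hy.le hyδ (hHΩ.fun_mul hSΩ)
      (hT.continuousOn_comp_of_differentiableOn hy (hHΩ.fun_mul hSΩ)), map_zero] at hcong
    have hLc : ∀ j, Continuous fun t : ℝ => (Γ j (t + ((-y : ℝ) : ℂ) * I) - z)⁻¹ +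
        l (Γ j (t + ((-y : ℝ) : ℂ) * I)) := fun j => (hinv j).add (hline hlt j)
    -- The product is split by residues: the pole at `a` yields a Taylor coefficient of `l` alone,
    -- because `(w - z)⁻¹` has zero Cauchy transform inside; the pole at `z` yields `k z`; and `k l`
    -- is holomorphic.
    have e1 : heightIntegral Γ (-y) (fun w => (((w - a) ^ (m + 1))⁻¹ + k w) * ((w - z)⁻¹ + l w)) =
        heightIntegral Γ (-y) (fun w => ((w - z)⁻¹ + l w) / (w - a) ^ (m + 1) +
          (k w / (w - z) + k w * l w)) := by
      congr 1
      funext w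
      simp only [div_eq_mul_inv]
      ring
    rw [e1, hT.heightIntegral_add hya' (fun j => (hLc j).div
        (((hΓ j).sub continuous_const).pow _) fun t => pow_ne_zero _ (hnea j t))
      (fun j => ((hline hkt j).div ((hΓ j).sub continuous_const) (hnez j)).add
        ((hline hkt j).mul (hline hlt j))),
      hT.heightIntegral_add hya' (fun j => (hline hkt j).div ((hΓ j).sub continuous_const) (hnez j))
      (fun j => (hline hkt j).mul (hline hlt j)),
      hT.heightIntegral_neg_eq_zero hy hyδ (hkt.fun_mul hlt) (hkΩ.fun_mul hlΩ),
      hT.heightIntegral_div_pow hy hyδ (P := fun w => (w - z)⁻¹ + l w) hLc (z := z) (ψ := l)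
      (fun w hw hwz => by
        rw [hT.cauchyT_add hya' hinv (hline hlt)
          (hT.line_ne_of_mem_closure hy hyδ (subset_closure hw)),
          hT.cauchyT_neg_inv_sub hy hyδ hz hw hwz, hT.cauchyT_neg_eq hy hyδ hlt hlΩ hw, zero_add])
      ha (hq.analytic a ha)] at hcong
    have e2 := hT.cauchyT_neg_eq hy hyδ hkt hkΩ hz
    unfold cauchyT at e2
    have e3 : heightIntegral Γ (-y) (fun w => k w / (w - z)) = 2 * Real.pi * I * k z := by
      rw [← e2]
      field_simp
    rw [e3, add_zero] at hcong
    have e4 : k z = -iteratedDeriv m l a / m.factorial := by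
      apply mul_left_cancel₀ h2pi
      linear_combination hcong
    have haz : a - z ≠ 0 := sub_ne_zero.2 hza.symm
    rw [e4, iteratedDeriv_fun_add ?_ (hq.analytic a ha).contDiffAt, iteratedDeriv_inv_sub]
    · have e5 : (z - a) ^ (m + 1) = (-1) ^ (m + 1) * (a - z) ^ (m + 1) := by
        rw [← mul_pow]
        ring
      have e6 : ((-1 : ℂ) ^ m) * (-1) ^ m = 1 := by rw [← mul_pow]; simp
      rw [e5, mul_inv, pow_succ (-1 : ℂ) m]
      have e7 : ((-1 : ℂ) ^ m * -1)⁻¹ = -(-1) ^ m := by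
        refine inv_eq_of_mul_eq_one_right ?_
        linear_combination e6
      rw [e7]
      field_simp
      ring
    · exact ((analyticAt_id.sub analyticAt_const).inv haz).contDiffAt
  -- Now `G S T = conj (H L T)`: the outer contour sees a Taylor coefficient of `S` at `a`, the
  -- inner one the simple pole of `L` at `z`.
  · have hcong := hT.heightIntegral_neg_eq_conj (a := a)
      (M := fun w => (((w - a) ^ (m + 1))⁻¹ + k w) * S w) (N := fun w => H w * ((w - z)⁻¹ + l w)) hreal
      (fun w hw hwa => (hGa w hw hwa).mul (hδ hw).2.1.2.2)
      (fun w hw hwa => ((hδ hw).2.2 hwa).mul (hLa w hw)) (fun w hw hwa => by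
        rw [hp.rel w hw hwa, hrelq w hw]
        simp only [map_mul, conj_conj]
        ring) hy hyδ
    have e1 : heightIntegral Γ (-y) (fun w => (((w - a) ^ (m + 1))⁻¹ + k w) * S w) =
        heightIntegral Γ (-y) (fun w => S w / (w - a) ^ (m + 1) + k w * S w) := by
      congr 1
      funext w
      simp only [div_eq_mul_inv]
      ring
    have e2 : heightIntegral Γ y (fun w => H w * ((w - z)⁻¹ + l w)) =
        heightIntegral Γ y (fun w => H w / (w - z) + H w * l w) := by
      congr 1
      funext w
      simp only [div_eq_mul_inv]
      ring
    have e3 := (hT.cauchyT_eq hy.le hyδ hHΩ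
      (hT.continuousOn_comp_of_differentiableOn hy hHΩ)).1 z hz hzt
    unfold cauchyT at e3
    have e4 : heightIntegral Γ y (fun w => H w / (w - z)) = 2 * Real.pi * I * H z := by
      rw [← e3]
      field_simp
    rw [e1, e2, hT.heightIntegral_add hya' (fun j => (hline hSt j).div
        (((hΓ j).sub continuous_const).pow _) fun t => pow_ne_zero _ (hnea j t))
        (fun j => (hline hkt j).mul (hline hSt j)),
      hT.heightIntegral_neg_eq_zero hy hyδ (hkt.fun_mul hSt) (hkΩ.fun_mul hSΩ),
      hT.heightIntegral_div_pow hy hyδ (hline hSt) (z := z) (ψ := S)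
        (fun w hw _ => hT.cauchyT_neg_eq hy hyδ hSt hSΩ hw) ha (hS a ha),
      hT.heightIntegral_add hya (fun j => (hlineΩ hHΩ j).div ((hΓy j).sub continuous_const) (hnezy j))
        (fun j => (hlineΩ hHΩ j).mul (hlineΩ hlΩ j)),
      hT.heightIntegral_eq_zero hy.le hyδ (hHΩ.fun_mul hlΩ)
        (hT.continuousOn_comp_of_differentiableOn hy (hHΩ.fun_mul hlΩ)), e4] at hcong
    have e5 := congrArg conj hcong
    simp only [map_mul, map_div₀, map_neg, neg_neg, conj_conj, conj_ofReal, conj_I, map_natCast,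
      map_ofNat, add_zero] at e5
    apply mul_left_cancel₀ h2pi
    linear_combination -e5

/-! ### Arc length on the boundary. -/

/-- The arc length measure of one boundary curve. -/
noncomputable def curveLength (γ : Fin n → ℝ → ℂ) (j : Fin n) : Measure ℂ :=
  Measure.map (γ j) ((volume.restrict (Ico (0 : ℝ) 1)).withDensity fun t => ‖deriv (γ j) t‖ₑ)

theorem arcLength_eq_sum (γ : Fin n → ℝ → ℂ) : arcLength γ = ∑ j, curveLength γ j := rfl

namespace IsAnalyticDomain

theorem continuous_curve (hΩ : IsAnalyticDomain Ω γ) (j : Fin n) : Continuous (γ j) :=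
  continuous_iff_continuousAt.2 fun t => (hΩ.analytic j t).continuousAt

theorem continuous_deriv (hΩ : IsAnalyticDomain Ω γ) (j : Fin n) : Continuous (deriv (γ j)) :=
  continuous_iff_continuousAt.2 fun t => (hΩ.analytic j t).deriv.continuousAt

theorem curve_mem_frontier (hΩ : IsAnalyticDomain Ω γ) (j : Fin n) (t : ℝ) : γ j t ∈ frontier Ω := by
  rw [hΩ.frontier_eq]
  exact mem_iUnion.2 ⟨j, t, rfl⟩

theorem isCompact_closure (hΩ : IsAnalyticDomain Ω γ) : IsCompact (closure Ω) :=
  hΩ.isBounded.isCompact_closure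

theorem isCompact_frontier (hΩ : IsAnalyticDomain Ω γ) : IsCompact (frontier Ω) :=
  hΩ.isCompact_closure.of_isClosed_subset isClosed_frontier frontier_subset_closure

theorem isFiniteMeasure_curveLength (hΩ : IsAnalyticDomain Ω γ) (j : Fin n) :
    IsFiniteMeasure (curveLength γ j) := by
  obtain ⟨C, hC⟩ := isCompact_Icc.exists_bound_of_continuousOn (s := Icc (0 : ℝ) 1)
    (hΩ.continuous_deriv j).continuousOn
  have : IsFiniteMeasure ((volume.restrict (Ico (0 : ℝ) 1)).withDensity
      fun t => ‖deriv (γ j) t‖ₑ) := by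
    refine isFiniteMeasure_withDensity ?_
    refine (lt_of_le_of_lt (setLIntegral_mono (g := fun _ => ENNReal.ofReal C) measurable_const
      fun t ht => ?_) ?_).ne
    · rw [← ofReal_norm]
      exact ENNReal.ofReal_le_ofReal (hC t (Ico_subset_Icc_self ht))
    · simp
  unfold curveLength
  infer_instance

theorem isFiniteMeasure_arcLength (hΩ : IsAnalyticDomain Ω γ) : IsFiniteMeasure (arcLength γ) := by
  have := hΩ.isFiniteMeasure_curveLength
  rw [arcLength_eq_sum]
  infer_instance

theorem ae_curveLength (hΩ : IsAnalyticDomain Ω γ) (j : Fin n) :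
    ∀ᵐ w ∂(curveLength γ j), w ∈ frontier Ω := by
  unfold curveLength
  refine (ae_map_iff (p := fun w => w ∈ frontier Ω) (hΩ.continuous_curve j).aemeasurable
    isClosed_frontier.measurableSet).2 ?_
  exact ae_of_all _ (hΩ.curve_mem_frontier j)

theorem ae_arcLength (hΩ : IsAnalyticDomain Ω γ) : ∀ᵐ w ∂(arcLength γ), w ∈ frontier Ω := by
  rw [arcLength_eq_sum, ae_iff, Measure.finsetSum_apply]
  exact Finset.sum_eq_zero fun j _ => ae_iff.1 (hΩ.ae_curveLength j)

theorem aestronglyMeasurable_curveLength (hΩ : IsAnalyticDomain Ω γ) {F : ℂ → ℂ}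
    (hF : ContinuousOn F (frontier Ω)) (j : Fin n) : AEStronglyMeasurable F (curveLength γ j) := by
  have h := hF.aestronglyMeasurable (μ := curveLength γ j) isClosed_frontier.measurableSet
  rwa [Measure.restrict_eq_self_of_ae_mem (hΩ.ae_curveLength j)] at h

theorem memLp_of_continuousOn (hΩ : IsAnalyticDomain Ω γ) {F : ℂ → ℂ}
    (hF : ContinuousOn F (frontier Ω)) {p : ENNReal} : MemLp F p (arcLength γ) := by
  have := hΩ.isFiniteMeasure_arcLength
  obtain ⟨C, hC⟩ := hΩ.isCompact_frontier.exists_bound_of_continuousOn hF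
  have h := hF.aestronglyMeasurable (μ := arcLength γ) isClosed_frontier.measurableSet
  rw [Measure.restrict_eq_self_of_ae_mem hΩ.ae_arcLength] at h
  refine MemLp.of_bound h C ?_
  filter_upwards [hΩ.ae_arcLength] with w hw using hC w hw

theorem integral_arcLength (hΩ : IsAnalyticDomain Ω γ) {F : ℂ → ℂ}
    (hF : ContinuousOn F (frontier Ω)) :
    ∫ w, F w ∂(arcLength γ) = ∑ j, ∫ t in (0 : ℝ)..1, ‖deriv (γ j) t‖ * F (γ j t) := by
  have hfin := hΩ.isFiniteMeasure_curveLength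
  obtain ⟨C, hC⟩ := hΩ.isCompact_frontier.exists_bound_of_continuousOn hF
  rw [arcLength_eq_sum, integral_finsetSum_measure]
  · refine Finset.sum_congr rfl fun j _ => ?_
    have h1 := hΩ.aestronglyMeasurable_curveLength hF j
    unfold curveLength at h1 ⊢
    rw [integral_map (hΩ.continuous_curve j).aemeasurable h1,
      integral_withDensity_eq_integral_toReal_smul (hΩ.continuous_deriv j).measurable.enorm
        (ae_of_all _ fun t => by simp), intervalIntegral.integral_of_le zero_le_one,
      integral_Ico_eq_integral_Ioc]
    simp
  · intro j _
    refine Integrable.of_bound (hΩ.aestronglyMeasurable_curveLength hF j) C ?_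
    filter_upwards [hΩ.ae_curveLength j] with w hw using hC w hw

end IsAnalyticDomain

/-! ### Identification of the Szegő and Garabedian kernels. -/

/-- The Szegő kernel `S(·, z)` in terms of a pair with a simple pole at `z`. -/
noncomputable def szegoFun (S : ℂ → ℂ) (w : ℂ) : ℂ := I / (2 * Real.pi) * S w

/-- The Garabedian kernel `L(·, z)` in terms of a pair with a simple pole at `z`. -/
noncomputable def garabedianFun (z : ℂ) (l : ℂ → ℂ) (w : ℂ) : ℂ :=
  (2 * Real.pi : ℂ)⁻¹ * ((w - z)⁻¹ + l w)

theorem two_pi_ne : (2 * Real.pi : ℂ) ≠ 0 := by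
  simp [Real.pi_ne_zero]

theorem mem_AInfty_of_analyticOnNhd {S : ℂ → ℂ} (hS : AnalyticOnNhd ℂ S (closure Ω)) :
    S ∈ AInfty Ω :=
  ⟨fun w hw => (hS w (subset_closure hw)).differentiableAt.differentiableWithinAt,
    fun w hw => ((hS w hw).contDiffAt (n := ∞)).restrict_scalars ℝ |>.contDiffWithinAt⟩

theorem AInfty.continuousOn {h : ℂ → ℂ} (hh : h ∈ AInfty Ω) : ContinuousOn h (closure Ω) :=
  hh.2.continuousOn

namespace IsPolePair

variable {z : ℂ} {l S : ℂ → ℂ}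

theorem analyticOnNhd_right (hq : IsPolePair Ω γ z 0 l S) (hz : z ∈ Ω) :
    AnalyticOnNhd ℂ S (closure Ω) := fun w hw => hq.analyticAt w hw fun _ => hz

theorem analyticOnNhd_szegoFun (hq : IsPolePair Ω γ z 0 l S) (hz : z ∈ Ω) :
    AnalyticOnNhd ℂ (szegoFun S) (closure Ω) := fun w hw =>
  analyticAt_const.mul (hq.analyticOnNhd_right hz w hw)

theorem analyticAt_garabedianFun (hq : IsPolePair Ω γ z 0 l S) {w : ℂ} (hw : w ∈ closure Ω)
    (hwz : w ≠ z) : AnalyticAt ℂ (garabedianFun z l) w :=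
  analyticAt_const.mul (((analyticAt_id.sub analyticAt_const).inv (sub_ne_zero.2 hwz)).add
    (hq.analytic w hw))

theorem conj_szegoFun (hΩ : IsAnalyticDomain Ω γ) (hq : IsPolePair Ω γ z 0 l S) (hz : z ∈ Ω) {w : ℂ}
    (hw : w ∈ frontier Ω) : conj (szegoFun S w) = 1 / I * garabedianFun z l w * unitTangent γ w := by
  have h1 := hq.rel w hw fun h => hΩ.notMem_of_mem_frontier hw (h ▸ hz)
  have h2 := hΩ.unitTangent_mul_conj hw
  rw [zero_add, pow_one] at h1
  simp only [szegoFun, garabedianFun]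
  rw [h1]
  simp only [map_mul, map_div₀, conj_I, conj_ofReal, map_ofNat]
  have h3 := two_pi_ne
  have h4 : (1 / I : ℂ) = -I := by simp
  rw [h4]
  field_simp
  linear_combination conj (S w) * h2

/-- The boundary relation turns `conj (szegoFun S) ds` into `((w - z)⁻¹ + l) dw / (2 π i)`. The
first term gives Cauchy's formula for `h`, the second integrates to zero. -/
theorem integral_mul_conj_szegoFun (hΩ : IsAnalyticDomain Ω γ) (hq : IsPolePair Ω γ z 0 l S)
    (hz : z ∈ Ω) {h : ℂ → ℂ} (hh : h ∈ AInfty Ω) :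
    ∫ w, h w * conj (szegoFun S w) ∂(arcLength γ) = h z := by
  obtain ⟨δ, Γ, σ, hT⟩ := exists_tube hΩ
  have hfc : frontier Ω ⊆ closure Ω := frontier_subset_closure
  have hδ := hT.pos
  have hc : ∀ {g : ℂ → ℂ}, ContinuousOn g (closure Ω) → ∀ j,
      ContinuousOn (fun ξ => g (Γ j ξ)) {ξ | 0 ≤ ξ.im ∧ ξ.im < δ} := by
    intro g hg j
    have hs : {ξ : ℂ | 0 ≤ ξ.im ∧ ξ.im < δ} ⊆ horizStrip δ := fun ξ hξ =>
      mem_horizStrip.2 ⟨by linarith [hξ.1], hξ.2⟩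
    exact hg.comp ((hT.diff j).continuousOn.mono hs) fun ξ hξ =>
      (hT.apply_mem_closure_iff j (hs hξ)).2 hξ.1
  have hl : ContinuousOn l (closure Ω) := hq.analytic.continuousOn
  have hlΩ : DifferentiableOn ℂ l Ω := fun w hw =>
    (hq.analytic w (subset_closure hw)).differentiableAt.differentiableWithinAt
  rw [hΩ.integral_arcLength (F := fun w => h w * conj (szegoFun S w))
    ((AInfty.continuousOn hh).mono hfc |>.mul (continuous_conj.comp_continuousOn
    ((hq.analyticOnNhd_szegoFun hz).continuousOn.mono hfc)))]
  have e1 : ∑ j, ∫ t in (0 : ℝ)..1, ‖deriv (γ j) t‖ * (h (γ j t) * conj (szegoFun S (γ j t))) =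
      (2 * Real.pi * I : ℂ)⁻¹ * heightIntegral Γ 0 (fun w => h w / (w - z) + h w * l w) := by
    unfold heightIntegral
    rw [Finset.mul_sum]
    refine Finset.sum_congr rfl fun j _ => ?_
    rw [← intervalIntegral.integral_const_mul]
    refine intervalIntegral.integral_congr fun t _ => ?_
    have e2 := hq.conj_szegoFun hΩ hz (hΩ.curve_mem_frontier j t)
    have e3 := _root_.unitTangent_apply hΩ j t
    have e4 : (‖deriv (γ j) t‖ : ℂ) ≠ 0 := by
      exact_mod_cast norm_ne_zero_iff.2 (hΩ.deriv_ne_zero j t)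
    simp only [ofReal_zero, zero_mul, add_zero, hT.apply_ofReal, hT.deriv_ofReal]
    rw [e2, e3]
    simp only [garabedianFun]
    field_simp
  have hline : ∀ {g : ℂ → ℂ}, ContinuousOn g (closure Ω) → ∀ j,
      Continuous fun t : ℝ => g (Γ j (t + (0 : ℝ) * I)) := fun hg j =>
    (hc hg j).comp_continuous (by fun_prop) fun t => ⟨by simp, by simpa using hδ⟩
  have hzn : ∀ j (t : ℝ), Γ j (t + (0 : ℝ) * I) - z ≠ 0 := by
    intro j t h0
    rw [sub_eq_zero] at h0
    have h3 := (hT.apply_mem_iff j (line_mem_horizStrip (by simpa using hT.pos) t)).1 (h0 ▸ hz)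
    simp at h3
  have e5 := (hT.cauchyT_eq le_rfl hδ hh.1 (hc (AInfty.continuousOn hh))).1 z hz (by
    rintro ⟨j, ζ, h1, h2, rfl⟩
    have := (hT.apply_mem_iff j (mem_horizStrip.2 ⟨by linarith, by linarith⟩)).1 hz
    linarith)
  rw [e1, hT.heightIntegral_add (by simpa using hδ)
    (fun j => (hline (AInfty.continuousOn hh) j).div
      ((hline continuousOn_id j).sub continuous_const) (hzn j))
    (fun j => (hline (AInfty.continuousOn hh) j).mul (hline hl j)),
    hT.heightIntegral_eq_zero le_rfl hδ (hh.1.fun_mul hlΩ) (hc ((AInfty.continuousOn hh).mul hl)),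
    add_zero]
  exact e5

theorem memLp_szegoFun (hΩ : IsAnalyticDomain Ω γ) (hq : IsPolePair Ω γ z 0 l S) (hz : z ∈ Ω) :
    MemLp (szegoFun S) 2 (arcLength γ) :=
  hΩ.memLp_of_continuousOn ((hq.analyticOnNhd_szegoFun hz).continuousOn.mono frontier_subset_closure)

/-- Two elements of the Hardy space with the reproducing property differ by a vector orthogonal to
the boundary values of `AInfty Ω`, hence to their closure, which contains it. -/
theorem szegoBoundary_ae_eq (hΩ : IsAnalyticDomain Ω γ) (hq : IsPolePair Ω γ z 0 l S) (hz : z ∈ Ω) :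
    szegoBoundary Ω γ z =ᵐ[arcLength γ] szegoFun S := by
  set s₀ := (hq.memLp_szegoFun hΩ hz).toLp with hs₀
  have hs₀e : s₀ =ᵐ[arcLength γ] szegoFun S := MemLp.coeFn_toLp _
  have hs₀H : s₀ ∈ hardySpace Ω γ := Submodule.le_topologicalClosure _
    ⟨szegoFun S, mem_AInfty_of_analyticOnNhd (hq.analyticOnNhd_szegoFun hz), hs₀e⟩
  have hs₀r : ∀ h ∈ AInfty Ω, ∫ w, h w * conj (s₀ w) ∂(arcLength γ) = h z := by
    intro h hh
    rw [← hq.integral_mul_conj_szegoFun hΩ hz hh]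
    refine integral_congr_ae ?_
    filter_upwards [hs₀e] with w hw
    rw [hw]
  obtain ⟨h1, h2⟩ : szegoBoundary Ω γ z ∈ hardySpace Ω γ ∧
      ∀ h ∈ AInfty Ω, ∫ w, h w * conj (szegoBoundary Ω γ z w) ∂(arcLength γ) = h z :=
    Classical.epsilon_spec (p := fun s : Lp ℂ 2 (arcLength γ) => s ∈ hardySpace Ω γ ∧
      ∀ h ∈ AInfty Ω, ∫ w, h w * conj (s w) ∂(arcLength γ) = h z) ⟨s₀, hs₀H, hs₀r⟩
  have hin : ∀ s : Lp ℂ 2 (arcLength γ), (∀ h ∈ AInfty Ω,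
      ∫ w, h w * conj (s w) ∂(arcLength γ) = h z) → ∀ u : Lp ℂ 2 (arcLength γ), ∀ h ∈ AInfty Ω,
      u =ᵐ[arcLength γ] h → inner ℂ s u = h z := by
    intro s hs u h hh hu
    rw [L2.inner_def, ← hs h hh]
    refine integral_congr_ae ?_
    filter_upwards [hu] with w hw
    rw [hw]
    simp
  have h3 : szegoBoundary Ω γ z - s₀ ∈ (AInftyBoundary Ω γ)ᗮ := by
    rw [Submodule.mem_orthogonal']
    rintro u ⟨h, hh, hu⟩
    rw [inner_sub_left, hin _ h2 u h hh hu, hin _ hs₀r u h hh hu, sub_self]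
  rw [← Submodule.orthogonal_closure] at h3
  have h4 := (Submodule.mem_orthogonal _ _).1 h3 _ ((hardySpace Ω γ).sub_mem h1 hs₀H)
  rw [inner_self_eq_zero, sub_eq_zero] at h4
  rw [h4]
  exact hs₀e

/-- `szegoFun H` is analytic on the closed domain, so the reproducing property at `z` applies to it.
-/
theorem szego_eq (hΩ : IsAnalyticDomain Ω γ) {a : ℂ} {k H : ℂ → ℂ} (hp : IsPolePair Ω γ a 0 k H)
    (hq : IsPolePair Ω γ z 0 l S) (ha : a ∈ Ω) (hz : z ∈ Ω) : szego Ω γ z a = szegoFun H z := by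
  rw [← hq.integral_mul_conj_szegoFun hΩ hz
    (mem_AInfty_of_analyticOnNhd (hp.analyticOnNhd_szegoFun ha))]
  refine integral_congr_ae ?_
  filter_upwards [hp.szegoBoundary_ae_eq hΩ ha, hq.szegoBoundary_ae_eq hΩ hz] with w h1 h2
  rw [h1, h2]

end IsPolePair

theorem conj_szego (Ω : Set ℂ) (γ : Fin n → ℝ → ℂ) (z a : ℂ) :
    conj (szego Ω γ z a) = szego Ω γ a z := by
  unfold szego
  rw [← integral_conj]
  refine integral_congr_ae (ae_of_all _ fun w => ?_)
  simp [mul_comm]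

theorem IsAnalyticDomain.unitTangent_ne_zero (hΩ : IsAnalyticDomain Ω γ) {w : ℂ}
    (hw : w ∈ frontier Ω) : unitTangent γ w ≠ 0 :=
  left_ne_zero_of_mul (hΩ.unitTangent_mul_conj hw ▸ one_ne_zero)

/-- Equal residues make the difference removable at `a`. Its boundary values vanish because `T ≠ 0`,
and the maximum principle concludes. -/
theorem IsGarabedian.eqOn (hΩ : IsAnalyticDomain Ω γ) {a : ℂ} (ha : a ∈ Ω) {f g : ℂ → ℂ}
    (hf : IsGarabedian Ω γ a f) (hg : IsGarabedian Ω γ a g) {w : ℂ} (hw : w ∈ closure Ω)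
    (hwa : w ≠ a) : f w = g w := by
  set d : ℂ → ℂ := fun w => f w - g w with hd
  have h1 : DifferentiableOn ℂ d (Ω \ {a}) := hf.differentiableOn.sub hg.differentiableOn
  have h2 : Tendsto (fun z => (z - a) * d z) (𝓝[≠] a) (𝓝 0) := by
    have := hf.residue.sub hg.residue
    rw [sub_self] at this
    refine this.congr fun z => ?_
    simp only [hd]
    ring
  have h3 := differentiableOn_update_limUnder_of_isLittleO (hΩ.isOpen.mem_nhds ha) h1
    (isLittleO_of_tendsto_mul h2)
  set D := Function.update d a (limUnder (𝓝[≠] a) d) with hD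
  have hDd : ∀ w, w ≠ a → D w = d w := fun w hw => Function.update_of_ne hw _ _
  have h4 : ContinuousOn D (closure Ω) := by
    intro x hx
    by_cases hxa : x = a
    · rw [hxa]
      exact (h3.differentiableAt (hΩ.isOpen.mem_nhds ha)).continuousAt.continuousWithinAt
    · have h5 : ContinuousWithinAt d (closure Ω \ {a}) x :=
        (hf.continuousOn.sub hg.continuousOn) x ⟨hx, hxa⟩
      have h6 : ContinuousWithinAt d (closure Ω) x :=
        h5.mono_of_mem_nhdsWithin (inter_mem self_mem_nhdsWithin
          (mem_nhdsWithin_of_mem_nhds (isOpen_ne.mem_nhds hxa)))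
      refine h6.congr_of_eventuallyEq ?_ (hDd x hxa)
      filter_upwards [mem_nhdsWithin_of_mem_nhds (isOpen_ne.mem_nhds hxa)] with y hy using hDd y hy
  have h5 : EqOn D 0 (frontier Ω) := by
    intro x hx
    have hxa : x ≠ a := fun h => hΩ.notMem_of_mem_frontier hx (h ▸ ha)
    rw [hDd x hxa]
    have h6 := (hf.boundary x hx).trans (hg.boundary x hx).symm
    have h7 := mul_left_cancel₀ (by simp) (mul_right_cancel₀ (hΩ.unitTangent_ne_zero hx) h6)
    simp [hd, h7]
  have h6 := eqOn_closure_of_eqOn_frontier hΩ.isBounded ⟨h3, h4⟩ diffContOnCl_const h5 hw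
  rw [hDd w hwa] at h6
  exact sub_eq_zero.1 h6

namespace IsPolePair

variable {z a : ℂ} {l S k H : ℂ → ℂ}

/-- Hermitian symmetry transfers the dependence on the second variable to one function analytic on
the closed domain, which gives the continuous extension to boundary values of `a`. -/
theorem szego_eq_conj (hΩ : IsAnalyticDomain Ω γ) (hq : IsPolePair Ω γ z 0 l S) (ha : a ∈ Ω)
    (hz : z ∈ Ω) : szego Ω γ z a = conj (szegoFun S a) := by
  obtain ⟨k, H, hp⟩ := exists_isPolePair hΩ (subset_closure ha) 0
  rw [← conj_szego, hq.szego_eq hΩ hp hz ha]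

theorem isGarabedian (hΩ : IsAnalyticDomain Ω γ) (hq : IsPolePair Ω γ z 0 l S) (hz : z ∈ Ω) :
    IsGarabedian Ω γ z (garabedianFun z l) where
  differentiableOn w hw := (hq.analyticAt_garabedianFun (subset_closure hw.1)
    hw.2).differentiableAt.differentiableWithinAt
  continuousOn w hw := (hq.analyticAt_garabedianFun hw.1 hw.2).continuousAt.continuousWithinAt
  residue := by
    have h1 : Tendsto (fun w => (2 * Real.pi : ℂ)⁻¹ * (1 + (w - z) * l w)) (𝓝[≠] z)
        (𝓝 ((2 * Real.pi : ℂ)⁻¹ * (1 + (z - z) * l z))) := by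
      have h2 : ContinuousAt (fun w => (2 * Real.pi : ℂ)⁻¹ * (1 + (w - z) * l w)) z :=
        continuousAt_const.mul (continuousAt_const.add ((continuousAt_id.sub continuousAt_const).mul
          (hq.analytic z (subset_closure hz)).continuousAt))
      exact h2.tendsto.mono_left nhdsWithin_le_nhds
    have h3 : (2 * Real.pi : ℂ)⁻¹ * (1 + (z - z) * l z) = 1 / (2 * Real.pi) := by
      simp
    rw [h3] at h1
    refine h1.congr' ?_
    filter_upwards [self_mem_nhdsWithin] with w hw
    have h4 : w - z ≠ 0 := sub_ne_zero.2 hw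
    simp only [garabedianFun]
    field_simp
  boundary w hw := by
    rw [← hq.conj_szegoFun hΩ hz hw]
    symm
    refine extendFrom_eq (frontier_subset_closure hw) ?_
    have h1 : Tendsto (fun u => conj (szegoFun S u)) (𝓝[Ω] w) (𝓝 (conj (szegoFun S w))) :=
      (continuous_conj.continuousAt.comp (hq.analyticOnNhd_szegoFun hz w
        (frontier_subset_closure hw)).continuousAt).tendsto.mono_left nhdsWithin_le_nhds
    refine h1.congr' ?_
    filter_upwards [self_mem_nhdsWithin] with u hu
    exact (hq.szego_eq_conj hΩ hu hz).symm

theorem garabedian_eq (hΩ : IsAnalyticDomain Ω γ) (hq : IsPolePair Ω γ z 0 l S) (hz : z ∈ Ω)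
    {w : ℂ} (hw : w ∈ closure Ω) (hwz : w ≠ z) : garabedian Ω γ w z = garabedianFun z l w :=
  (Classical.epsilon_spec (p := fun ℓ : ℂ → ℂ => IsGarabedian Ω γ z ℓ)
    ⟨_, hq.isGarabedian hΩ hz⟩).eqOn hΩ hz (hq.isGarabedian hΩ hz) hw hwz

/-- The antisymmetry `L(z, a) = -L(a, z)` of the Garabedian kernel. -/
theorem garabedian_eq_neg (hΩ : IsAnalyticDomain Ω γ) (hq : IsPolePair Ω γ z 0 l S) (hz : z ∈ Ω)
    (ha : a ∈ Ω) (hza : z ≠ a) : garabedian Ω γ z a = -garabedianFun z l a := by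
  obtain ⟨k, H, hp⟩ := exists_isPolePair hΩ (subset_closure ha) 0
  rw [hp.garabedian_eq hΩ ha (subset_closure hz) hza]
  have h1 := (hp.eval_eq hΩ hq (subset_closure ha) hz).1 hza
  simp only [zero_add, pow_one, iteratedDeriv_zero, Nat.factorial_zero, Nat.cast_one, div_one] at h1
  simp only [garabedianFun]
  rw [h1]
  ring

theorem szegoDeriv_eq (hΩ : IsAnalyticDomain Ω γ) (hq : IsPolePair Ω γ z 0 l S) (hz : z ∈ Ω)
    (ha : a ∈ closure Ω) (m : ℕ) :
    szegoDeriv Ω γ m z a = conj (iteratedDeriv m (szegoFun S) a) := by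
  refine extendFrom_eq ha ?_
  have h0 := (hq.analyticOnNhd_szegoFun hz a ha).iterated_deriv m
  rw [← iteratedDeriv_eq_iterate] at h0
  have h1 : Tendsto (fun w => conj (iteratedDeriv m (szegoFun S) w)) (𝓝[Ω] a)
      (𝓝 (conj (iteratedDeriv m (szegoFun S) a))) :=
    (continuous_conj.continuousAt.comp h0.continuousAt).tendsto.mono_left nhdsWithin_le_nhds
  refine h1.congr' ?_
  filter_upwards [self_mem_nhdsWithin] with w hw
  have h2 : (fun u => conj (szego Ω γ z u)) =ᶠ[𝓝 w] szegoFun S := by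
    filter_upwards [hΩ.isOpen.mem_nhds hw] with u hu
    rw [hq.szego_eq_conj hΩ hu hz, conj_conj]
  rw [h2.iteratedDeriv_eq]

/-- By antisymmetry the second variable becomes the argument of a single function, analytic up to
the boundary off `z`. -/
theorem garabedianDeriv_eq (hΩ : IsAnalyticDomain Ω γ) (hq : IsPolePair Ω γ z 0 l S) (hz : z ∈ Ω)
    (ha : a ∈ closure Ω) (hza : z ≠ a) (m : ℕ) :
    garabedianDeriv Ω γ m z a = -iteratedDeriv m (garabedianFun z l) a := by
  refine extendFrom_eq ha ?_
  have h0 := (hq.analyticAt_garabedianFun ha hza.symm).iterated_deriv m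
  rw [← iteratedDeriv_eq_iterate] at h0
  have h1 : Tendsto (fun w => -iteratedDeriv m (garabedianFun z l) w) (𝓝[Ω] a)
      (𝓝 (-iteratedDeriv m (garabedianFun z l) a)) :=
    h0.continuousAt.neg.tendsto.mono_left nhdsWithin_le_nhds
  refine h1.congr' ?_
  filter_upwards [self_mem_nhdsWithin, mem_nhdsWithin_of_mem_nhds (isOpen_ne.mem_nhds hza.symm)]
    with w hw hwz
  have h2 : (fun u => garabedian Ω γ z u) =ᶠ[𝓝 w] fun u => -garabedianFun z l u := by
    filter_upwards [hΩ.isOpen.mem_nhds hw, isOpen_ne.mem_nhds hwz] with u hu huz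
    exact hq.garabedian_eq_neg hΩ hz hu (Ne.symm huz)
  rw [h2.iteratedDeriv_eq, iteratedDeriv_fun_neg]

/-- The generators in terms of pairs. -/
theorem szegoDeriv_eq_mul (hΩ : IsAnalyticDomain Ω γ) {m : ℕ} (hp : IsPolePair Ω γ a m k H)
    (ha : a ∈ closure Ω) (hz : z ∈ Ω) :
    szegoDeriv Ω γ m z a = I / (2 * Real.pi) * m.factorial * H z := by
  obtain ⟨l, S, hq⟩ := exists_isPolePair hΩ (subset_closure hz) 0
  rw [hq.szegoDeriv_eq hΩ hz ha, (hp.eval_eq hΩ hq ha hz).2]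
  have h1 : iteratedDeriv m (szegoFun S) a = I / (2 * Real.pi) * iteratedDeriv m S a :=
    iteratedDeriv_const_mul_field _ _
  have h2 : (m.factorial : ℂ) ≠ 0 := by exact_mod_cast m.factorial_ne_zero
  rw [h1]
  simp only [map_mul, map_div₀, conj_I, conj_ofReal, map_ofNat]
  field_simp

/-- Reciprocity: differentiating the pair with simple pole at `z` at the point `a` gives the value
at `z` of the pair with a higher pole at `a`. -/
theorem garabedianDeriv_eq_mul (hΩ : IsAnalyticDomain Ω γ) {m : ℕ} (hp : IsPolePair Ω γ a m k H)
    (ha : a ∈ closure Ω) (hz : z ∈ Ω) (hza : z ≠ a) :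
    garabedianDeriv Ω γ m z a =
      (2 * Real.pi : ℂ)⁻¹ * m.factorial * (((z - a) ^ (m + 1))⁻¹ + k z) := by
  obtain ⟨l, S, hq⟩ := exists_isPolePair hΩ (subset_closure hz) 0
  rw [hq.garabedianDeriv_eq hΩ hz ha hza, (hp.eval_eq hΩ hq ha hz).1 hza]
  have h1 : iteratedDeriv m (garabedianFun z l) a =
      (2 * Real.pi : ℂ)⁻¹ * iteratedDeriv m (fun w => (w - z)⁻¹ + l w) a :=
    iteratedDeriv_const_mul_field _ _
  have h2 : (m.factorial : ℂ) ≠ 0 := by exact_mod_cast m.factorial_ne_zero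
  rw [h1]
  field_simp

end IsPolePair

/-! ### Removal of finitely many poles. -/

/-- A function with a removable singularity at `a`. -/
def IsRemovableAt (F : ℂ → ℂ) (a : ℂ) : Prop := ∃ k : ℂ → ℂ, AnalyticAt ℂ k a ∧ F =ᶠ[𝓝[≠] a] k

theorem AnalyticAt.isRemovableAt {F : ℂ → ℂ} {a : ℂ} (h : AnalyticAt ℂ F a) : IsRemovableAt F a :=
  ⟨F, h, EventuallyEq.rfl⟩

namespace IsRemovableAt

variable {F G : ℂ → ℂ} {a : ℂ}

theorem sub (hF : IsRemovableAt F a) (hG : IsRemovableAt G a) :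
    IsRemovableAt (fun w => F w - G w) a := by
  obtain ⟨f, hf, hf'⟩ := hF
  obtain ⟨g, hg, hg'⟩ := hG
  exact ⟨_, hf.sub hg, hf'.sub hg'⟩

theorem tendsto (hF : IsRemovableAt F a) : ∃ c, Tendsto F (𝓝[≠] a) (𝓝 c) := by
  obtain ⟨f, hf, hf'⟩ := hF
  exact ⟨f a, (hf.continuousAt.tendsto.mono_left nhdsWithin_le_nhds).congr' hf'.symm⟩

/-- Taking the punctured limit at every point fills all removable singularities at once and changes
nothing where the function is already continuous. -/
theorem limUnder_eventuallyEq {k : ℂ → ℂ} (hk : AnalyticAt ℂ k a) (h : F =ᶠ[𝓝[≠] a] k) :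
    (fun z => limUnder (𝓝[≠] z) F) =ᶠ[𝓝 a] k := by
  have h1 : ∀ᶠ z in 𝓝 a, F =ᶠ[𝓝[≠] z] k := by
    have h2 := eventually_nhdsNE_eventually_nhds_iff.2 h
    rw [eventually_nhdsWithin_iff] at h2
    filter_upwards [h2] with z hz
    by_cases hza : z = a
    · rw [hza]
      exact h
    · exact (hz hza).filter_mono nhdsWithin_le_nhds
  filter_upwards [h1, hk.eventually_analyticAt] with z hz hkz
  exact ((hkz.continuousAt.tendsto.mono_left nhdsWithin_le_nhds).congr' hz.symm).limUnder_eq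

theorem analyticAt_limUnder (hF : IsRemovableAt F a) :
    AnalyticAt ℂ (fun z => limUnder (𝓝[≠] z) F) a := by
  obtain ⟨f, hf, hf'⟩ := hF
  exact hf.congr (limUnder_eventuallyEq hf hf').symm

theorem eventuallyEq_limUnder (hF : IsRemovableAt F a) :
    F =ᶠ[𝓝[≠] a] fun z => limUnder (𝓝[≠] z) F := by
  obtain ⟨f, hf, hf'⟩ := hF
  exact hf'.trans ((limUnder_eventuallyEq hf hf').filter_mono nhdsWithin_le_nhds).symm

theorem of_nonneg (hF : MeromorphicAt F a) (h : 0 ≤ meromorphicOrderAt F a) : IsRemovableAt F a :=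
  ⟨_, hF.meromorphicOrderAt_nonneg_iff_analyticAt_toMeromorphicNFAt.1 h,
    hF.eq_nhdsNE_toMeromorphicNFAt⟩

end IsRemovableAt

/-- Infinitely many such points would accumulate in `K`, but a meromorphic function is analytic on a
punctured neighbourhood of each point of `K`. -/
theorem IsCompact.exists_finset_not_analyticAt {K : Set ℂ} (hK : IsCompact K) {F : ℂ → ℂ}
    (hF : MeromorphicOn F K) : ∃ P : Finset ℂ, ∀ z, z ∈ P ↔ z ∈ K ∧ ¬AnalyticAt ℂ F z := by
  have h : {z | z ∈ K ∧ ¬AnalyticAt ℂ F z}.Finite := by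
    by_contra hinf
    obtain ⟨x, hx, hacc⟩ := Set.Infinite.exists_accPt_of_subset_isCompact hinf hK fun z hz => hz.1
    rw [accPt_iff_frequently] at hacc
    have h1 := eventually_nhdsWithin_iff.1 (hF x hx).eventually_analyticAt
    obtain ⟨y, ⟨hyx, hy⟩, hy'⟩ := (hacc.and_eventually h1).exists
    exact hy.2 (hy' hyx)
  exact ⟨h.toFinset, fun z => h.mem_toFinset⟩

/-- The function `(w - a) ^ (-(m + 1)) + k w`. -/
noncomputable def poleFun (a : ℂ) (m : ℕ) (k : ℂ → ℂ) (w : ℂ) : ℂ := ((w - a) ^ (m + 1))⁻¹ + k w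

theorem analyticAt_poleFun {a w : ℂ} {m : ℕ} {k : ℂ → ℂ} (hk : AnalyticAt ℂ k w) (h : w ≠ a) :
    AnalyticAt ℂ (poleFun a m k) w :=
  (((analyticAt_id.sub analyticAt_const).pow _).inv (pow_ne_zero _ (sub_ne_zero.2 h))).add hk

theorem meromorphicAt_poleFun {a w : ℂ} {m : ℕ} {k : ℂ → ℂ} (hk : AnalyticAt ℂ k w) :
    MeromorphicAt (poleFun a m k) w :=
  (((MeromorphicAt.id w).sub (MeromorphicAt.const _ _)).pow _).inv.add hk.meromorphicAt

/-- Removal of finitely many poles by linear combinations of functions with prescribed poles. -/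
theorem exists_isRemovableAt_sub_sum {K : Set ℂ} {F : ℂ → ℂ} (P : Finset ℂ) {κ : ℂ → ℕ → ℂ → ℂ}
    (hP : ∀ a ∈ K, a ∉ P → IsRemovableAt F a) (hF : ∀ a ∈ P, MeromorphicAt F a)
    (hκ : ∀ a ∈ P, ∀ m, AnalyticOnNhd ℂ (κ a m) K) :
    ∃ N : ℂ → ℕ, ∃ c : ℂ → ℕ → ℂ, ∀ a ∈ K, IsRemovableAt
      (fun w => F w - ∑ b ∈ P, ∑ m ∈ Finset.range (N b), c b m * poleFun b m (κ b m) w) a := by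
  classical
  choose! N c k hk hFk using fun a (ha : a ∈ P) => (hF a ha).exists_principal_part
  refine ⟨N, c, fun a ha => ?_⟩
  have hterm : ∀ b ∈ P, b ≠ a → AnalyticAt ℂ
      (fun w => ∑ m ∈ Finset.range (N b), c b m * poleFun b m (κ b m) w) a := fun b hb hba =>
    Finset.analyticAt_fun_sum _ fun m _ =>
      analyticAt_const.mul (analyticAt_poleFun (hκ b hb m a ha) hba.symm)
  by_cases haP : a ∈ P
  · have h1 : IsRemovableAt
        (fun w => F w - ∑ m ∈ Finset.range (N a), c a m * poleFun a m (κ a m) w) a := by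
      refine ⟨fun w => k a w - ∑ m ∈ Finset.range (N a), c a m * κ a m w, (hk a haP).sub
        (Finset.analyticAt_fun_sum _ fun m _ => analyticAt_const.mul (hκ a haP m a ha)), ?_⟩
      filter_upwards [hFk a haP] with w hw
      simp only [poleFun, mul_add, Finset.sum_add_distrib, hw, div_eq_mul_inv]
      ring
    have h2 : AnalyticAt ℂ (fun w => ∑ b ∈ P.erase a, ∑ m ∈ Finset.range (N b),
        c b m * poleFun b m (κ b m) w) a := Finset.analyticAt_fun_sum _ fun b hb =>
      hterm b (Finset.mem_of_mem_erase hb) (Finset.ne_of_mem_erase hb)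
    obtain ⟨f, hf, hf'⟩ := h1.sub h2.isRemovableAt
    refine ⟨f, hf, ?_⟩
    filter_upwards [hf'] with w hw
    rw [← hw, ← Finset.add_sum_erase P _ haP]
    ring
  · exact (hP a ha haP).sub (Finset.analyticAt_fun_sum _ fun b hb =>
      hterm b hb fun h => haP (h ▸ hb)).isRemovableAt

theorem eventuallyEq_codiscreteWithin {f g : ℂ → ℂ} {U : Set ℂ}
    (h : ∀ x ∈ U, f =ᶠ[𝓝[≠] x] g) : f =ᶠ[codiscreteWithin U] g := by
  refine mem_codiscreteWithin_iff_forall_mem_nhdsNE.2 fun x hx => ?_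
  filter_upwards [h x hx] with y hy using Or.inl hy

/-! ### Boundary pairs and their uniqueness. -/

/-- Two meromorphic functions on the closed domain with `G = conj (H T)` on the boundary, off a
discrete set. -/
structure IsBoundaryPair (Ω : Set ℂ) (γ : Fin n → ℝ → ℂ) (G H : ℂ → ℂ) : Prop where
  left : MeromorphicOn G (closure Ω)
  right : MeromorphicOn H (closure Ω)
  rel : ∀ j t, ∀ᶠ s in 𝓝[≠] t, G (γ j s) = conj (H (γ j s) * unitTangent γ (γ j s))

namespace IsAnalyticDomain

theorem tendsto_curve (hΩ : IsAnalyticDomain Ω γ) (j : Fin n) (t : ℝ) :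
    Tendsto (γ j) (𝓝[≠] t) (𝓝[≠] (γ j t)) :=
  (hΩ.analytic j t).differentiableAt.hasDerivAt.tendsto_nhdsNE (hΩ.deriv_ne_zero j t)

theorem eventually_curve_ne (hΩ : IsAnalyticDomain Ω γ) (j : Fin n) (t : ℝ) (a : ℂ) :
    ∀ᶠ s in 𝓝[≠] t, γ j s ≠ a :=
  (hΩ.analytic j t).differentiableAt.hasDerivAt.eventually_ne (hΩ.deriv_ne_zero j t)

theorem continuous_unitTangent (hΩ : IsAnalyticDomain Ω γ) (j : Fin n) :
    Continuous fun t => unitTangent γ (γ j t) := by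
  simp only [unitTangent_apply hΩ]
  refine (hΩ.continuous_deriv j).div (continuous_ofReal.comp (hΩ.continuous_deriv j).norm) fun t => ?_
  exact_mod_cast norm_ne_zero_iff.2 (hΩ.deriv_ne_zero j t)

theorem exists_curve (hΩ : IsAnalyticDomain Ω γ) {z : ℂ} (hz : z ∈ frontier Ω) :
    ∃ j t, γ j t = z := by
  rw [hΩ.frontier_eq] at hz
  obtain ⟨j, t, h⟩ := mem_iUnion.1 hz
  exact ⟨j, t, h⟩

theorem curve_mem_closure (hΩ : IsAnalyticDomain Ω γ) (j : Fin n) (t : ℝ) : γ j t ∈ closure Ω :=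
  frontier_subset_closure (hΩ.curve_mem_frontier j t)

end IsAnalyticDomain

namespace IsBoundaryPair

variable {G H G₁ H₁ : ℂ → ℂ}

theorem zero : IsBoundaryPair Ω γ 0 0 :=
  ⟨fun x _ => MeromorphicAt.const 0 x, fun x _ => MeromorphicAt.const 0 x, by simp⟩

theorem symm (hΩ : IsAnalyticDomain Ω γ) (h : IsBoundaryPair Ω γ G H) : IsBoundaryPair Ω γ H G := by
  refine ⟨h.right, h.left, fun j t => ?_⟩
  filter_upwards [h.rel j t] with s hs
  have h1 := hΩ.unitTangent_mul_conj (hΩ.curve_mem_frontier j s)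
  rw [hs]
  simp only [map_mul, conj_conj]
  linear_combination -H (γ j s) * h1

theorem add (h : IsBoundaryPair Ω γ G H) (h₁ : IsBoundaryPair Ω γ G₁ H₁) :
    IsBoundaryPair Ω γ (G + G₁) (H + H₁) := by
  refine ⟨h.left.add h₁.left, h.right.add h₁.right, fun j t => ?_⟩
  filter_upwards [h.rel j t, h₁.rel j t] with s hs hs₁
  simp only [Pi.add_apply, hs, hs₁, add_mul, map_add]

theorem smul (c : ℂ) (h : IsBoundaryPair Ω γ G H) : IsBoundaryPair Ω γ (c • G) (conj c • H) := by
  refine ⟨h.left.const_smul c, h.right.const_smul _, fun j t => ?_⟩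
  filter_upwards [h.rel j t] with s hs
  simp only [Pi.smul_apply, smul_eq_mul, hs, map_mul, conj_conj]
  ring

theorem sub (h : IsBoundaryPair Ω γ G H) (h₁ : IsBoundaryPair Ω γ G₁ H₁) :
    IsBoundaryPair Ω γ (fun w => G w - G₁ w) (fun w => H w - H₁ w) := by
  refine ⟨h.left.sub h₁.left, h.right.sub h₁.right, fun j t => ?_⟩
  filter_upwards [h.rel j t, h₁.rel j t] with s hs hs₁
  simp only [hs, hs₁, sub_mul, map_sub]

theorem sum {ι : Type*} (s : Finset ι) {G H : ι → ℂ → ℂ}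
    (h : ∀ i ∈ s, IsBoundaryPair Ω γ (G i) (H i)) :
    IsBoundaryPair Ω γ (fun w => ∑ i ∈ s, G i w) (fun w => ∑ i ∈ s, H i w) := by
  refine ⟨fun x hx => MeromorphicAt.fun_sum fun i hi => (h i hi).left x hx,
    fun x hx => MeromorphicAt.fun_sum fun i hi => (h i hi).right x hx, fun j t => ?_⟩
  filter_upwards [(Filter.eventually_all_finset s).2 fun i hi => (h i hi).rel j t] with x hx
  rw [Finset.sum_mul, map_sum]
  exact Finset.sum_congr rfl hx

theorem eq_of_continuousAt (hΩ : IsAnalyticDomain Ω γ) (h : IsBoundaryPair Ω γ G H) {z : ℂ}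
    (hz : z ∈ frontier Ω) (hG : ContinuousAt G z) (hH : ContinuousAt H z) :
    G z = conj (H z * unitTangent γ z) := by
  obtain ⟨j, t, rfl⟩ := hΩ.exists_curve hz
  have hγ := (hΩ.continuous_curve j).continuousAt (x := t)
  have h1 : ContinuousAt (fun s => G (γ j s)) t := ContinuousAt.comp hG hγ
  have h2 : ContinuousAt (fun s => conj (H (γ j s) * unitTangent γ (γ j s))) t :=
    continuous_conj.continuousAt.comp ((ContinuousAt.comp hH hγ).mul
      (hΩ.continuous_unitTangent j).continuousAt)
  exact tendsto_nhds_unique_of_eventuallyEq (h1.tendsto.mono_left nhdsWithin_le_nhds)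
    (h2.tendsto.mono_left nhdsWithin_le_nhds) (h.rel j t)

theorem of_forall_analyticAt (hΩ : IsAnalyticDomain Ω γ) (hG : MeromorphicOn G (closure Ω))
    (hH : MeromorphicOn H (closure Ω)) (h : ∀ z ∈ frontier Ω, AnalyticAt ℂ G z → AnalyticAt ℂ H z →
      G z = conj (H z * unitTangent γ z)) : IsBoundaryPair Ω γ G H := by
  refine ⟨hG, hH, fun j t => ?_⟩
  have hz := hΩ.curve_mem_closure j t
  filter_upwards [(hΩ.tendsto_curve j t).eventually (hG _ hz).eventually_analyticAt,
    (hΩ.tendsto_curve j t).eventually (hH _ hz).eventually_analyticAt] with s h1 h2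
  exact h _ (hΩ.curve_mem_frontier j s) h1 h2

/-- If one function of a pair has no pole at a boundary point, neither has the other. -/
theorem isRemovableAt (hΩ : IsAnalyticDomain Ω γ) (h : IsBoundaryPair Ω γ G H) {z : ℂ}
    (hz : z ∈ frontier Ω) (hG : IsRemovableAt G z) : IsRemovableAt H z := by
  obtain ⟨j, t, rfl⟩ := hΩ.exists_curve hz
  have hH := h.right _ (frontier_subset_closure hz)
  refine IsRemovableAt.of_nonneg hH (not_lt.1 fun hneg => ?_)
  -- A pole of `H` would make `H` unbounded along the curve, whereas the relation gives it a finite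
  -- limit there.
  have h1 := (tendsto_cobounded_of_meromorphicOrderAt_neg hneg).comp (hΩ.tendsto_curve j t)
  obtain ⟨c, hc⟩ := hG.tendsto
  have h2 : Tendsto (fun s => conj (G (γ j s) * unitTangent γ (γ j s))) (𝓝[≠] t)
      (𝓝 (conj (c * unitTangent γ (γ j t)))) :=
    (continuous_conj.tendsto _).comp ((hc.comp (hΩ.tendsto_curve j t)).mul
      ((hΩ.continuous_unitTangent j).continuousAt.tendsto.mono_left nhdsWithin_le_nhds))
  have h3 : Tendsto (H ∘ γ j) (𝓝[≠] t) (𝓝 (conj (c * unitTangent γ (γ j t)))) :=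
    h2.congr' ((h.symm hΩ).rel j t |>.mono fun s hs => hs.symm)
  exact not_tendsto_atTop_of_tendsto_nhds h3.norm (tendsto_norm_cobounded_atTop.comp h1)

/-- A pair of holomorphic functions vanishes. -/
theorem eq_zero (hΩ : IsAnalyticDomain Ω γ) (h : IsBoundaryPair Ω γ G H)
    (hG : AnalyticOnNhd ℂ G (closure Ω)) (hH : AnalyticOnNhd ℂ H (closure Ω)) :
    ∀ z ∈ closure Ω, G z = 0 := by
  obtain ⟨δ, Γ, σ, hT⟩ := exists_tube hΩ
  have hδ := hT.pos
  have hd : ∀ {F : ℂ → ℂ}, AnalyticOnNhd ℂ F (closure Ω) → DifferentiableOn ℂ F Ω := fun hF w hw =>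
    (hF w (subset_closure hw)).differentiableAt.differentiableWithinAt
  have hrel : ∀ j t, G (γ j t) = conj (H (γ j t) * unitTangent γ (γ j t)) := fun j t =>
    h.eq_of_continuousAt hΩ (hΩ.curve_mem_frontier j t) (hG _ (hΩ.curve_mem_closure j t)).continuousAt
      (hH _ (hΩ.curve_mem_closure j t)).continuousAt
  have h1 := hT.heightIntegral_eq_zero le_rfl hδ ((hd hG).fun_mul (hd hH)) fun j => by
    have hs : {ξ : ℂ | 0 ≤ ξ.im ∧ ξ.im < δ} ⊆ horizStrip δ := fun ξ hξ =>
      mem_horizStrip.2 ⟨by linarith [hξ.1], hξ.2⟩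
    exact (hG.continuousOn.mul hH.continuousOn).comp ((hT.diff j).continuousOn.mono hs) fun ξ hξ =>
      (hT.apply_mem_closure_iff j (hs hξ)).2 hξ.1
  -- Since `H T = conj G`, the form `G H dw` is `|G|² ds` on the boundary.
  have h2 : ∀ j t, G (γ j t) * H (γ j t) * deriv (γ j) t =
      ((‖deriv (γ j) t‖ * ‖G (γ j t)‖ ^ 2 : ℝ) : ℂ) := by
    intro j t
    have e0 : (‖deriv (γ j) t‖ : ℂ) ≠ 0 := by
      exact_mod_cast norm_ne_zero_iff.2 (hΩ.deriv_ne_zero j t)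
    have e1 := congrArg conj (hrel j t)
    rw [conj_conj, _root_.unitTangent_apply hΩ] at e1
    push_cast
    rw [← Complex.mul_conj', e1]
    field_simp
  have h3 : ∑ j, ∫ t in (0 : ℝ)..1, ‖deriv (γ j) t‖ * ‖G (γ j t)‖ ^ 2 = 0 := by
    unfold heightIntegral at h1
    simp only [ofReal_zero, zero_mul, add_zero, hT.apply_ofReal, hT.deriv_ofReal, h2,
      intervalIntegral.integral_ofReal] at h1
    exact_mod_cast h1
  have h4 : EqOn G 0 (frontier Ω) := by
    intro z hz
    obtain ⟨j, t, rfl⟩ := hΩ.exists_curve hz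
    have h5 := eq_zero_of_sum_integral_eq_zero
      (F := fun j t => ‖deriv (γ j) t‖ * ‖G (γ j t)‖ ^ 2) (fun j => ?_) (fun j t => ?_)
      (fun j t => by positivity) h3 j t
    · simpa [hΩ.deriv_ne_zero j t] using h5
    · refine (hΩ.continuous_deriv j).norm.mul (Continuous.pow (Continuous.norm ?_) 2)
      exact hG.continuousOn.comp_continuous (hΩ.continuous_curve j) (hΩ.curve_mem_closure j)
    · have h5 := hT.deriv_periodic j t
      have h6 := hΩ.periodic j t
      have h7 : deriv (γ j) (t + 1) = deriv (γ j) t := by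
        rw [← hT.deriv_ofReal, ← hT.deriv_ofReal]
        push_cast
        exact h5
      simp only [h6, h7]
  exact eqOn_closure_of_eqOn_frontier hΩ.isBounded ⟨hd hG, hG.continuousOn⟩ diffContOnCl_const h4

/-- A pair without poles vanishes. -/
theorem eventuallyEq_zero (hΩ : IsAnalyticDomain Ω γ) (h : IsBoundaryPair Ω γ G H)
    (hG : ∀ a ∈ closure Ω, IsRemovableAt G a) (hH : ∀ a ∈ closure Ω, IsRemovableAt H a) :
    G =ᶠ[codiscreteWithin Ω] 0 := by
  have hGa : AnalyticOnNhd ℂ (fun z => limUnder (𝓝[≠] z) G) (closure Ω) := fun a ha =>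
    (hG a ha).analyticAt_limUnder
  have hHa : AnalyticOnNhd ℂ (fun z => limUnder (𝓝[≠] z) H) (closure Ω) := fun a ha =>
    (hH a ha).analyticAt_limUnder
  have h1 : IsBoundaryPair Ω γ (fun z => limUnder (𝓝[≠] z) G) (fun z => limUnder (𝓝[≠] z) H) := by
    refine ⟨hGa.meromorphicOn, hHa.meromorphicOn, fun j t => ?_⟩
    have hz := hΩ.curve_mem_closure j t
    filter_upwards [h.rel j t, (hΩ.tendsto_curve j t).eventually (hG _ hz).eventuallyEq_limUnder,
      (hΩ.tendsto_curve j t).eventually (hH _ hz).eventuallyEq_limUnder] with s h2 h3 h4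
    rw [← h3, ← h4, h2]
  refine eventuallyEq_codiscreteWithin fun x hx => ?_
  filter_upwards [(hG x (subset_closure hx)).eventuallyEq_limUnder,
    mem_nhdsWithin_of_mem_nhds (hΩ.isOpen.mem_nhds hx)] with y hy hyΩ
  rw [hy]
  exact h1.eq_zero hΩ hGa hHa y (subset_closure hyΩ)

end IsBoundaryPair

namespace IsPolePair

variable {a : ℂ} {m : ℕ} {k H : ℂ → ℂ}

theorem isBoundaryPair (hΩ : IsAnalyticDomain Ω γ) (hp : IsPolePair Ω γ a m k H) :
    IsBoundaryPair Ω γ (poleFun a m k) H := by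
  refine ⟨fun w hw => meromorphicAt_poleFun (hp.analytic w hw), fun w hw => ?_, fun j t => ?_⟩
  · by_cases hwa : w = a
    · rw [hwa]
      exact hp.mero
    · exact (hp.analyticAt w hw fun h => absurd h hwa).meromorphicAt
  · filter_upwards [hΩ.eventually_curve_ne j t a] with s hs
    exact hp.rel _ (hΩ.curve_mem_frontier j s) hs

end IsPolePair

/-! ### The class `ℬ` and the two inclusions. -/

/-- The class `ℬ` as a linear subspace. -/
def classBSubmodule (Ω : Set ℂ) (γ : Fin n → ℝ → ℂ) : Submodule ℂ (ℂ → ℂ) where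
  carrier := classB Ω γ
  zero_mem' := ⟨0, Submodule.zero_mem _, EventuallyEq.rfl⟩
  add_mem' := by
    rintro f g ⟨b, hb, hf⟩ ⟨c, hc, hg⟩
    exact ⟨b + c, Submodule.add_mem _ hb hc, hf.add hg⟩
  smul_mem' := by
    rintro c f ⟨b, hb, hf⟩
    exact ⟨c • b, Submodule.smul_mem _ c hb, hf.const_smul c⟩

namespace IsPolePair

variable {a : ℂ} {m : ℕ} {k H : ℂ → ℂ}

theorem garabedianDeriv_eventuallyEq (hΩ : IsAnalyticDomain Ω γ) (hp : IsPolePair Ω γ a m k H)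
    (ha : a ∈ closure Ω) : (fun z => garabedianDeriv Ω γ m z a) =ᶠ[codiscreteWithin Ω]
      ((2 * Real.pi : ℂ)⁻¹ * m.factorial) • poleFun a m k := by
  refine eventuallyEq_codiscreteWithin fun x hx => ?_
  have h1 : ∀ᶠ w in 𝓝[≠] x, w ≠ a := by
    by_cases hxa : x = a
    · rw [hxa]
      exact self_mem_nhdsWithin
    · exact mem_nhdsWithin_of_mem_nhds (isOpen_ne.mem_nhds hxa)
  filter_upwards [h1, mem_nhdsWithin_of_mem_nhds (hΩ.isOpen.mem_nhds hx)] with w hwa hw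
  exact hp.garabedianDeriv_eq_mul hΩ ha hw hwa

theorem szegoDeriv_eventuallyEq (hΩ : IsAnalyticDomain Ω γ) (hp : IsPolePair Ω γ a m k H)
    (ha : a ∈ closure Ω) : (fun z => szegoDeriv Ω γ m z a) =ᶠ[codiscreteWithin Ω]
      (I / (2 * Real.pi) * m.factorial) • H := by
  refine eventuallyEq_codiscreteWithin fun x hx => ?_
  filter_upwards [mem_nhdsWithin_of_mem_nhds (hΩ.isOpen.mem_nhds hx)] with w hw
  exact hp.szegoDeriv_eq_mul hΩ ha hw

theorem poleFun_mem_classB (hΩ : IsAnalyticDomain Ω γ) (hp : IsPolePair Ω γ a m k H)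
    (ha : a ∈ closure Ω) : poleFun a m k ∈ classBSubmodule Ω γ := by
  have h0 : (2 * Real.pi : ℂ)⁻¹ * m.factorial ≠ 0 :=
    mul_ne_zero (inv_ne_zero two_pi_ne) (by exact_mod_cast m.factorial_ne_zero)
  refine (Submodule.smul_mem_iff _ h0).1 ⟨_, Submodule.subset_span ⟨m, a, ha, Or.inr rfl⟩, ?_⟩
  exact (hp.garabedianDeriv_eventuallyEq hΩ ha).symm

theorem mem_classB (hΩ : IsAnalyticDomain Ω γ) (hp : IsPolePair Ω γ a m k H)
    (ha : a ∈ closure Ω) : H ∈ classBSubmodule Ω γ := by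
  have h0 : (I / (2 * Real.pi) * m.factorial : ℂ) ≠ 0 :=
    mul_ne_zero (div_ne_zero I_ne_zero two_pi_ne) (by exact_mod_cast m.factorial_ne_zero)
  refine (Submodule.smul_mem_iff _ h0).1 ⟨_, Submodule.subset_span ⟨m, a, ha, Or.inl rfl⟩, ?_⟩
  exact (hp.szegoDeriv_eventuallyEq hΩ ha).symm

end IsPolePair

/-- Each generator is a multiple of a member of a pole pair, and by symmetry either member may come
first. -/
theorem exists_isBoundaryPair_of_mem_span (hΩ : IsAnalyticDomain Ω γ) {b : ℂ → ℂ}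
    (hb : b ∈ Submodule.span ℂ (classBGenerators Ω γ)) :
    ∃ G H, IsBoundaryPair Ω γ G H ∧ b =ᶠ[codiscreteWithin Ω] G := by
  induction hb using Submodule.span_induction with
  | mem x hx =>
    obtain ⟨m, a, ha, rfl | rfl⟩ := hx
    · obtain ⟨k, H, hp⟩ := exists_isPolePair hΩ ha m
      exact ⟨_, _, ((hp.isBoundaryPair hΩ).symm hΩ).smul _, hp.szegoDeriv_eventuallyEq hΩ ha⟩
    · obtain ⟨k, H, hp⟩ := exists_isPolePair hΩ ha m
      exact ⟨_, _, (hp.isBoundaryPair hΩ).smul _, hp.garabedianDeriv_eventuallyEq hΩ ha⟩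
  | zero => exact ⟨0, 0, IsBoundaryPair.zero, EventuallyEq.rfl⟩
  | add x y _ _ hx hy =>
    obtain ⟨G, H, h, e⟩ := hx
    obtain ⟨G', H', h', e'⟩ := hy
    exact ⟨_, _, h.add h', e.add e'⟩
  | smul c x _ hx =>
    obtain ⟨G, H, h, e⟩ := hx
    exact ⟨_, _, h.smul c, e.const_smul c⟩

theorem sum_mul_mem {P : Finset ℂ} {N : ℂ → ℕ} {c : ℂ → ℕ → ℂ} {f : ℂ → ℕ → ℂ → ℂ}
    (V : Submodule ℂ (ℂ → ℂ)) (h : ∀ b ∈ P, ∀ m, f b m ∈ V) :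
    (fun w => ∑ b ∈ P, ∑ m ∈ Finset.range (N b), c b m * f b m w) ∈ V := by
  have : (fun w => ∑ b ∈ P, ∑ m ∈ Finset.range (N b), c b m * f b m w) =
      ∑ b ∈ P, ∑ m ∈ Finset.range (N b), c b m • f b m := by
    funext w
    simp [Finset.sum_apply]
  rw [this]
  exact V.sum_mem fun b hb => V.sum_mem fun m _ => V.smul_mem _ (h b hb m)

theorem IsBoundaryPair.sum_mul {P : Finset ℂ} {N : ℂ → ℕ} {c : ℂ → ℕ → ℂ} {f g : ℂ → ℕ → ℂ → ℂ}
    (h : ∀ b ∈ P, ∀ m, IsBoundaryPair Ω γ (f b m) (g b m)) :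
    IsBoundaryPair Ω γ (fun w => ∑ b ∈ P, ∑ m ∈ Finset.range (N b), c b m * f b m w)
      (fun w => ∑ b ∈ P, ∑ m ∈ Finset.range (N b), conj (c b m) * g b m w) :=
  IsBoundaryPair.sum P fun b hb => IsBoundaryPair.sum _ fun m _ => (h b hb m).smul (c b m)

/-- Subtracting pole functions and partners, all of which belong to `ℬ`, leads to a pair without
poles, which is zero. -/
theorem IsBoundaryPair.mem_classB (hΩ : IsAnalyticDomain Ω γ) {G H : ℂ → ℂ}
    (h : IsBoundaryPair Ω γ G H) : G ∈ classBSubmodule Ω γ := by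
  classical
  choose! κ E hp using fun a (ha : a ∈ closure Ω) m => exists_isPolePair hΩ ha m
  obtain ⟨P, hP⟩ := hΩ.isCompact_closure.exists_finset_not_analyticAt h.left
  obtain ⟨N, c, hG₁⟩ := exists_isRemovableAt_sub_sum (K := closure Ω) (F := G) P (κ := κ)
    (fun a ha haP => by
      rw [hP, not_and, not_not] at haP
      exact (haP ha).isRemovableAt) (fun a ha => h.left a ((hP a).1 ha).1)
    fun a ha m => (hp a ((hP a).1 ha).1 m).analytic
  have h₁ := h.sub (IsBoundaryPair.sum_mul (P := P) (N := N) (c := c) fun b hb m =>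
    (hp b ((hP b).1 hb).1 m).isBoundaryPair hΩ)
  have hD₁ := sum_mul_mem (P := P) (N := N) (c := c) (classBSubmodule Ω γ) fun b hb m =>
    (hp b ((hP b).1 hb).1 m).poleFun_mem_classB hΩ ((hP b).1 hb).1
  rw [← Submodule.sub_mem_iff_left _ hD₁]
  change (fun w => G w - ∑ b ∈ P, ∑ m ∈ Finset.range (N b), c b m * poleFun b m (κ b m) w) ∈ _
  generalize (fun w => G w - ∑ b ∈ P, ∑ m ∈ Finset.range (N b), c b m * poleFun b m (κ b m) w) = G₁
    at h₁ hG₁ ⊢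
  generalize (fun w => H w - ∑ b ∈ P, ∑ m ∈ Finset.range (N b), conj (c b m) * E b m w) = H₁ at h₁
  obtain ⟨Q₀, hQ₀⟩ := hΩ.isCompact_closure.exists_finset_not_analyticAt h₁.right
  -- Only interior poles of `H₁` need treatment: `G₁` has none, so the boundary relation excludes
  -- poles of `H₁` on the boundary.
  set Q := Q₀.filter fun a => a ∈ Ω with hQ
  have hQΩ : ∀ a ∈ Q, a ∈ Ω := fun a ha => (Finset.mem_filter.1 ha).2
  obtain ⟨N', c', hH₂⟩ := exists_isRemovableAt_sub_sum (K := closure Ω) (F := H₁) Q (κ := κ)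
    (fun a ha haQ => by
      by_cases haΩ : a ∈ Ω
      · by_contra hcon
        exact haQ (Finset.mem_filter.2 ⟨(hQ₀ a).2 ⟨ha, fun h => hcon h.isRemovableAt⟩, haΩ⟩)
      · refine h₁.isRemovableAt hΩ ?_ (hG₁ a ha)
        rw [hΩ.isOpen.frontier_eq]
        exact ⟨ha, haΩ⟩)
    (fun a ha => h₁.right a (subset_closure (hQΩ a ha)))
    fun a ha m => (hp a (subset_closure (hQΩ a ha)) m).analytic
  -- The pole pairs enter with members exchanged: the pole functions are subtracted from `H₁` and
  -- their partners from `G₁`. The partners of interior poles are holomorphic on the closed domain,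
  -- so no new poles arise.
  have h₂ := h₁.sub (((IsBoundaryPair.sum_mul (P := Q) (N := N') (c := c') fun b hb m =>
    (hp b (subset_closure (hQΩ b hb)) m).isBoundaryPair hΩ)).symm hΩ)
  have hG₂ : ∀ a ∈ closure Ω, IsRemovableAt
      (fun w => G₁ w - ∑ b ∈ Q, ∑ m ∈ Finset.range (N' b), conj (c' b m) * E b m w) a := fun a ha =>
    (hG₁ a ha).sub (Finset.analyticAt_fun_sum _ fun b hb => Finset.analyticAt_fun_sum _ fun m _ =>
      analyticAt_const.mul ((hp b (subset_closure (hQΩ b hb)) m).analyticAt a ha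
        fun _ => hQΩ b hb)).isRemovableAt
  have hD₂ := sum_mul_mem (P := Q) (N := N') (c := fun b m => conj (c' b m)) (classBSubmodule Ω γ)
    fun b hb m => (hp b (subset_closure (hQΩ b hb)) m).mem_classB hΩ (subset_closure (hQΩ b hb))
  rw [← Submodule.sub_mem_iff_left _ hD₂]
  exact ⟨0, Submodule.zero_mem _, h₂.eventuallyEq_zero hΩ hG₂ hH₂⟩

theorem lemma6p1 {n : ℕ} (Ω : Set ℂ) (γ : Fin n → ℝ → ℂ) (hΩ : IsAnalyticDomain Ω γ) :
    classB Ω γ =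
      {g : ℂ → ℂ | ∃ G H : ℂ → ℂ,
        MeromorphicOn G (closure Ω) ∧ MeromorphicOn H (closure Ω) ∧
        g =ᶠ[codiscreteWithin Ω] G ∧
        ∀ z ∈ frontier Ω, AnalyticAt ℂ G z → AnalyticAt ℂ H z →
          G z = conj (H z * unitTangent γ z)} := by
  ext g
  constructor
  · rintro ⟨b, hb, hgb⟩
    obtain ⟨G, H, h, hbG⟩ := exists_isBoundaryPair_of_mem_span hΩ hb
    exact ⟨G, H, h.left, h.right, hgb.trans hbG, fun z hz hG hH =>
      h.eq_of_continuousAt hΩ hz hG.continuousAt hH.continuousAt⟩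
  · rintro ⟨G, H, hG, hH, hgG, h⟩
    obtain ⟨b, hb, hGb⟩ := (IsBoundaryPair.of_forall_analyticAt hΩ hG hH h).mem_classB hΩ
    exact ⟨b, hb, hgG.trans hGb⟩
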